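/- Let $\Bbbk$ be an algebraically closed field of characteristic zero, $G$ a finite group, $\chi\colon G\to\Bbbk^\times$ a linear character, $g$ a central element of $G$, $n$ the order of $\chi(g)$, and $\mu\in\Bbbk$. Suppose that the group datum $(G,\chi,g,\mu)$ is of non-nilpotent type, that is, $\mu(g^n-1)\neq 0$ in $\Bbbk G$ and $\chi^n=1$, and that $n\ge 2$. Let $H$ be the associated pointed rank one Hopf algebra: as an algebra it is generated by $y$ and the group $G$ subject to $$y^n=\mu(g^n-1),\qquad yh=\chi(h)hy\quad(h\in G),$$ with $\Delta(y)=y\otimes g+1\otimes y$, $\varepsilon(y)=0$, $S(y)=-yg^{-1}$ and $\Delta(h)=h\otimes h$, $\varepsilon(h)=1$, $S(h)=h^{-1}$ for $h\in G$. Let $r(H)$ be the Green ring of $H$: the free abelian group on the isomorphism classes $[M]$ of finite dimensional left $H$-modules, with multiplication $[M][N]=[M\otimes N]$, modulo the relations $[M\oplus N]=[M]+[N]$. Let $a=[V_{\chi^{-1}}]$ be the class of the one-dimensional $H$-module on which $h\in G$ acts by $\chi^{-1}(h)$ and $y$ acts by $0$. Let $M[n,0]$ be the class of the $n$-dimensional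 $H$-module with basis $1,x,\dots,x^{n-1}$ on which $h\cdot x^i=\chi^{-i}(h)x^i$ for $h\in G$, $y\cdot x^i=x^{i+1}$ for $0\le i\le n-2$, and $y\cdot x^{n-1}=0$. Then the Jacobson radical of $r(H)$ is the principal ideal generated by $(1-a)M[n,0]$. -/

import Mathlib

open scoped TensorProduct

universe u v

/-- Gaussian binomial coefficients `c m p`, through the `q`-Pascal rule. -/
def qBinom {k : Type*} [Field k] (q : k) : ℕ → ℕ → k
  | 0, 0 => 1
  | 0, _ + 1 => 0
  | _ + 1, 0 => 1
  | m + 1, p + 1 => qBinom q m p + q ^ (p + 1) * qBinom q m (p + 1)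

theorem qBinom_zero_right {k : Type*} [Field k] (q : k) (m : ℕ) : qBinom q m 0 = 1 := by
  cases m <;> rfl

theorem qBinom_eq_zero {k : Type*} [Field k] (q : k) (m p : ℕ) (h : m < p) :
    qBinom q m p = 0 := by
  induction m generalizing p with
  | zero => cases p with
    | zero => omega
    | succ p => rfl
  | succ m ih => cases p with
    | zero => omega
    | succ p => rw [qBinom, ih p (by omega), ih (p + 1) (by omega)]; simp

theorem qBinom_self {k : Type*} [Field k] (q : k) (m : ℕ) : qBinom q m m = 1 := by
  induction m with
  | zero => rfl
  | succ m ih => rw [qBinom, ih, qBinom_eq_zero q m (m + 1) (by omega)]; simp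

theorem qBinom_mul {k : Type*} [Field k] (q : k) (m p : ℕ) :
    qBinom q m (p + 1) * (q ^ (p + 1) - 1) = qBinom q m p * (q ^ (m - p) - 1) := by
  induction m generalizing p with
  | zero => cases p <;> simp [qBinom]
  | succ m ih =>
    rcases Nat.lt_or_ge m p with h | h
    · rw [qBinom_eq_zero q (m + 1) (p + 1) (by omega), show m + 1 - p = 0 by omega]; simp
    · have e1 : q ^ (p + 1) * q ^ (m - p) = q ^ (m + 1) := by
        rw [← pow_add]; congr 1; omega
      have h1 : qBinom q (m + 1) (p + 1) * (q ^ (p + 1) - 1)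
          = qBinom q m p * (q ^ (m + 1) - 1) := by
        rw [qBinom]
        linear_combination q ^ (p + 1) * ih p + qBinom q m p * e1
      rw [h1]
      cases p with
      | zero => simp [qBinom_zero_right]
      | succ p =>
        have e2 : q ^ (p + 1) * q ^ (m + 1 - (p + 1)) = q ^ (m + 1) := by
          rw [← pow_add]; congr 1; omega
        have e3 : m - p = m + 1 - (p + 1) := by omega
        have := ih p
        rw [e3] at this
        rw [qBinom]
        linear_combination this - qBinom q m (p + 1) * e2

theorem qBinom_primitive {k : Type*} [Field k] {q : k} {n : ℕ} (hq : IsPrimitiveRoot q n)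
    (p : ℕ) (h0 : 0 < p) (h1 : p < n) : qBinom q n p = 0 := by
  have key : ∀ p, p + 1 < n → qBinom q n (p + 1) = 0 := by
    intro p
    induction p with
    | zero =>
      intro hp
      have := qBinom_mul q n 0
      rw [Nat.sub_zero, hq.pow_eq_one, sub_self, mul_zero] at this
      exact (mul_eq_zero.1 this).resolve_right
        (sub_ne_zero.2 (hq.pow_ne_one_of_pos_of_lt (by omega) hp))
    | succ p ih =>
      intro hp
      have := qBinom_mul q n (p + 1)
      rw [ih (by omega), zero_mul] at this
      exact (mul_eq_zero.1 this).resolve_right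
        (sub_ne_zero.2 (hq.pow_ne_one_of_pos_of_lt (by omega) hp))
  obtain ⟨p, rfl⟩ : ∃ r, p = r + 1 := ⟨p - 1, by omega⟩
  exact key p h1

theorem q_commute_pow {k R : Type*} [Field k] [Ring R] [Algebra k R] {q : k} {a b : R}
    (h : b * a = q • (a * b)) (p : ℕ) : b * a ^ p = q ^ p • (a ^ p * b) := by
  induction p with
  | zero => simp
  | succ p ih =>
    rw [pow_succ, ← mul_assoc, ih, smul_mul_assoc, mul_assoc, h, mul_smul_comm, smul_smul,
      pow_succ, mul_assoc]

/-- The `q`-binomial formula. -/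
theorem q_add_pow {k R : Type*} [Field k] [Ring R] [Algebra k R] {q : k} {a b : R}
    (h : b * a = q • (a * b)) (m : ℕ) :
    (a + b) ^ m = ∑ p ∈ Finset.range (m + 1), qBinom q m p • (a ^ p * b ^ (m - p)) := by
  induction m with
  | zero => simp [qBinom]
  | succ m ih =>
    rw [pow_succ', ih, add_mul, Finset.mul_sum, Finset.mul_sum]
    have hb : ∀ p ∈ Finset.range (m + 1), b * (qBinom q m p • (a ^ p * b ^ (m - p)))
        = (q ^ p * qBinom q m p) • (a ^ p * b ^ (m + 1 - p)) := by
      intro p hp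
      have hp' : p ≤ m := by simpa [Nat.lt_succ_iff] using hp
      rw [mul_smul_comm, ← mul_assoc, q_commute_pow h, smul_mul_assoc, smul_smul, mul_assoc,
        ← pow_succ', mul_comm (qBinom q m p), show m - p + 1 = m + 1 - p by omega]
    have ha : ∀ p ∈ Finset.range (m + 1), a * (qBinom q m p • (a ^ p * b ^ (m - p)))
        = qBinom q m p • (a ^ (p + 1) * b ^ (m + 1 - (p + 1))) := by
      intro p _
      rw [mul_smul_comm, ← mul_assoc, ← pow_succ', show m - p = m + 1 - (p + 1) by omega]
    rw [Finset.sum_congr rfl ha, Finset.sum_congr rfl hb]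
    have hlast : ∑ p ∈ Finset.range (m + 1), (q ^ p * qBinom q m p) • (a ^ p * b ^ (m + 1 - p))
        = ∑ p ∈ Finset.range (m + 2), (q ^ p * qBinom q m p) • (a ^ p * b ^ (m + 1 - p)) := by
      rw [Finset.sum_range_succ _ (m + 1), qBinom_eq_zero q m (m + 1) (by omega)]; simp
    rw [hlast, Finset.sum_range_succ' _ (m + 1), Finset.sum_range_succ' _ (m + 1), ← add_assoc,
      ← Finset.sum_add_distrib]
    simp only [qBinom, add_smul, qBinom_zero_right, pow_zero, one_mul]

theorem q_add_pow_primitive {k R : Type*} [Field k] [Ring R] [Algebra k R] {q : k} {n : ℕ}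
    (hq : IsPrimitiveRoot q n) (hn : 0 < n) {a b : R} (h : b * a = q • (a * b)) :
    (a + b) ^ n = a ^ n + b ^ n := by
  obtain ⟨m, rfl⟩ : ∃ m, n = m + 1 := ⟨n - 1, by omega⟩
  rw [q_add_pow h, Finset.sum_range_succ, Finset.sum_range_succ', Finset.sum_eq_zero]
  · simp [qBinom_self, qBinom_zero_right, add_comm]
  · intro p hp
    rw [qBinom_primitive hq (p + 1) (by omega) (by simpa using hp), zero_smul]

theorem q_neg_mul_pow {k R : Type*} [Field k] [Ring R] [Algebra k R] {q : k} {n : ℕ}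
    (hq : IsPrimitiveRoot q n) (hn : 0 < n) {y s : R} (h : s * y = q • (y * s)) :
    (-(y * s)) ^ n = -(y ^ n * s ^ n) := by
  have h1 : ∀ m : ℕ, (-(y * s)) ^ m = (∏ i ∈ Finset.range m, (0 - q ^ i)) • (y ^ m * s ^ m) := by
    intro m
    induction m with
    | zero => simp
    | succ m ih =>
      rw [pow_succ', ih, Finset.prod_range_succ, mul_smul_comm, mul_smul, neg_mul, mul_assoc,
        ← mul_assoc s, q_commute_pow h, zero_sub, neg_smul, smul_mul_assoc, mul_smul_comm,
        pow_succ' y, pow_succ' s]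
      simp only [mul_assoc]
  have h2 : ∏ i ∈ Finset.range n, (0 - q ^ i) = -1 := by
    have h3 := congrArg (Polynomial.eval 0) (Polynomial.X_pow_sub_one_eq_prod hn hq)
    rw [Polynomial.eval_prod] at h3
    simp only [Polynomial.eval_sub, Polynomial.eval_pow, Polynomial.eval_X, Polynomial.eval_one,
      Polynomial.eval_C, zero_pow hn.ne'] at h3
    rw [zero_sub] at h3
    rw [h3]
    refine Finset.prod_bij (fun i _ => q ^ i) ?_ ?_ ?_ (fun _ _ => rfl)
    · intro i _
      rw [Polynomial.mem_nthRootsFinset hn, ← pow_mul, mul_comm, pow_mul, hq.pow_eq_one, one_pow]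
    · intro i hi j hj hij
      exact hq.pow_inj (Finset.mem_range.1 hi) (Finset.mem_range.1 hj) hij
    · intro z hz
      have : NeZero n := ⟨hn.ne'⟩
      obtain ⟨i, hi, rfl⟩ := hq.eq_pow_of_pow_eq_one ((Polynomial.mem_nthRootsFinset hn _).1 hz)
      exact ⟨i, Finset.mem_range.2 hi, rfl⟩
  rw [h1, h2, neg_one_smul]

/-- A group datum `(G, χ, g, μ)` for a finite group `G` (finiteness is assumed where it is used).
The order of `χ g` is written out in `compat`; it is named `n` below. -/
structure GroupDatum (k G : Type*) [Field k] [Group G] where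
  χ : G →* kˣ
  g : G
  g_central : g ∈ Subgroup.center G
  μ : k
  compat : χ ^ orderOf (χ g) = 1 ∨
    μ • (MonoidAlgebra.of k G (g ^ orderOf (χ g)) - 1) = 0

namespace GroupDatum

section Algebra

variable {k G : Type*} [Field k] [Group G] (D : GroupDatum k G)

/-- The order of `q = χ g`. -/
noncomputable def n : ℕ := orderOf (D.χ D.g)

/-- The group datum is of non-nilpotent type. -/
def IsNonNilpotent : Prop :=
  D.μ • (MonoidAlgebra.of k G (D.g ^ D.n) - 1) ≠ 0 ∧ D.χ ^ D.n = 1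

/-- The free generators: `some h` for `h ∈ G`, and `none` for `y`. -/
abbrev Free (_D : GroupDatum k G) := FreeAlgebra k (Option G)

/-- The defining relations of the algebra attached to a group datum. -/
inductive Rel : D.Free → D.Free → Prop
  | one : Rel (FreeAlgebra.ι k (some 1)) 1
  | mul (h h' : G) : Rel (FreeAlgebra.ι k (some (h * h')))
      (FreeAlgebra.ι k (some h) * FreeAlgebra.ι k (some h'))
  | y_pow : Rel (FreeAlgebra.ι k none ^ D.n)
      (D.μ • (FreeAlgebra.ι k (some (D.g ^ D.n)) - 1))
  | y_mul (h : G) : Rel (FreeAlgebra.ι k none * FreeAlgebra.ι k (some h))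
      ((D.χ h : k) • (FreeAlgebra.ι k (some h) * FreeAlgebra.ι k none))

/-- The algebra `H` generated by `y` and the group `G`, with the relations `y ^ n = μ (g ^ n - 1)`
and `y h = χ(h) h y`. -/
def H := RingQuot D.Rel

noncomputable instance : Ring D.H := inferInstanceAs (Ring (RingQuot D.Rel))
noncomputable instance : Algebra k D.H := inferInstanceAs (Algebra k (RingQuot D.Rel))

/-- The generator `y` of `H`. -/
noncomputable def y : D.H := RingQuot.mkAlgHom k D.Rel (FreeAlgebra.ι k none)

/-- The inclusion of the group `G` into `H`. -/
noncomputable def of : G →* D.H where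
  toFun h := RingQuot.mkAlgHom k D.Rel (FreeAlgebra.ι k (some h))
  map_one' := by rw [RingQuot.mkAlgHom_rel k Rel.one, map_one]; rfl
  map_mul' h h' := by rw [RingQuot.mkAlgHom_rel k (Rel.mul h h'), map_mul]; rfl

theorem y_pow : D.y ^ D.n = D.μ • (D.of (D.g ^ D.n) - 1) := by
  have := RingQuot.mkAlgHom_rel k (s := D.Rel) Rel.y_pow
  rw [map_pow, map_smul, map_sub, map_one] at this
  exact this

theorem y_mul (h : G) : D.y * D.of h = (D.χ h : k) • (D.of h * D.y) := by
  have := RingQuot.mkAlgHom_rel k (s := D.Rel) (Rel.y_mul h)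
  rw [map_mul, map_smul, map_mul] at this
  exact this

/-- The universal property of `H`. -/
noncomputable def lift {B : Type*} [Ring B] [Algebra k B] (f : G →* B) (b : B)
    (h1 : b ^ D.n = D.μ • (f (D.g ^ D.n) - 1))
    (h2 : ∀ h, b * f h = (D.χ h : k) • (f h * b)) : D.H →ₐ[k] B :=
  RingQuot.liftAlgHom k ⟨FreeAlgebra.lift k (fun o : Option G => o.elim b f), by
    intro _ _ hr
    cases hr with
    | one => simp
    | mul h h' => simp
    | y_pow => simpa using h1
    | y_mul h => simpa using h2 h⟩

@[simp] theorem lift_y {B : Type*} [Ring B] [Algebra k B] (f : G →* B) (b : B) (h1) (h2) :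
    D.lift f b h1 h2 D.y = b := by
  refine (RingQuot.liftAlgHom_mkAlgHom_apply k _ _ _).trans ?_
  simp

@[simp] theorem lift_of {B : Type*} [Ring B] [Algebra k B] (f : G →* B) (b : B) (h1) (h2)
    (h : G) : D.lift f b h1 h2 (D.of h) = f h := by
  refine (RingQuot.liftAlgHom_mkAlgHom_apply k _ _ _).trans ?_
  simp

theorem induction {P : D.H → Prop} (hc : ∀ c : k, P (algebraMap k D.H c)) (hy : P D.y)
    (hof : ∀ h, P (D.of h)) (hadd : ∀ a b, P a → P b → P (a + b))
    (hmul : ∀ a b, P a → P b → P (a * b)) (a : D.H) : P a := by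
  obtain ⟨a, rfl⟩ := RingQuot.mkAlgHom_surjective k D.Rel a
  induction a using FreeAlgebra.induction with
  | grade0 r =>
    have h := AlgHom.commutes (RingQuot.mkAlgHom k D.Rel) r
    exact h ▸ hc r
  | grade1 x => cases x with
    | none => exact hy
    | some h => exact hof h
  | mul a b ha hb => rw [map_mul]; exact hmul _ _ ha hb
  | add a b ha hb => rw [map_add]; exact hadd _ _ ha hb

theorem algHom_ext {B : Type*} [Ring B] [Algebra k B] {f f' : D.H →ₐ[k] B}
    (hy : f D.y = f' D.y) (hof : ∀ h, f (D.of h) = f' (D.of h)) : f = f' := by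
  refine AlgHom.ext fun a => ?_
  induction a using D.induction with
  | hc c => simp
  | hy => exact hy
  | hof h => exact hof h
  | hadd a b ha hb => simp [ha, hb]
  | hmul a b ha hb => simp [ha, hb]

theorem commute_g (h : G) : h * D.g = D.g * h :=
  Subgroup.mem_center_iff.1 D.g_central h

theorem isPrimitiveRoot : IsPrimitiveRoot (D.χ D.g : k) D.n :=
  IsPrimitiveRoot.coe_units_iff.2 (IsPrimitiveRoot.orderOf _)

theorem n_pos [Finite G] : 0 < D.n :=
  (MonoidHom.isOfFinOrder D.χ (isOfFinOrder_of_finite D.g)).orderOf_pos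

end Algebra

section Hopf

variable {k G : Type*} [Field k] [Group G] [Finite G] (D : GroupDatum k G)

/-- `Δ h = h ⊗ h` and `Δ y = y ⊗ g + 1 ⊗ y`. -/
noncomputable def comulHom : D.H →ₐ[k] D.H ⊗[k] D.H :=
  D.lift
    { toFun := fun h => D.of h ⊗ₜ[k] D.of h
      map_one' := by rw [map_one]; rfl
      map_mul' := fun h h' => by rw [map_mul, Algebra.TensorProduct.tmul_mul_tmul] }
    (D.y ⊗ₜ[k] D.of D.g + 1 ⊗ₜ[k] D.y)
    (by
      rw [q_add_pow_primitive D.isPrimitiveRoot D.n_pos, Algebra.TensorProduct.tmul_pow,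
        Algebra.TensorProduct.tmul_pow, D.y_pow, one_pow, ← map_pow]
      · simp only [MonoidHom.coe_mk, OneHom.coe_mk, ← TensorProduct.smul_tmul',
          TensorProduct.tmul_smul, TensorProduct.sub_tmul, TensorProduct.tmul_sub,
          Algebra.TensorProduct.one_def, ← smul_add]
        congr 1
        abel
      · simp [D.y_mul])
    (fun h => by
      simp only [MonoidHom.coe_mk, OneHom.coe_mk, add_mul, mul_add,
        Algebra.TensorProduct.tmul_mul_tmul, D.y_mul, ← map_mul, D.commute_g h, one_mul, mul_one,
        smul_add, TensorProduct.tmul_smul, TensorProduct.smul_tmul'])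

/-- `ε h = 1` and `ε y = 0`. -/
noncomputable def counitHom : D.H →ₐ[k] k :=
  D.lift 1 0 (by simp [D.n_pos.ne']) (by simp)

@[simp] theorem comulHom_y : D.comulHom D.y = D.y ⊗ₜ[k] D.of D.g + 1 ⊗ₜ[k] D.y := by
  simp [comulHom]

@[simp] theorem comulHom_of (h : G) : D.comulHom (D.of h) = D.of h ⊗ₜ[k] D.of h := by
  simp [comulHom]

@[simp] theorem counitHom_y : D.counitHom D.y = 0 := by simp [counitHom]

@[simp] theorem counitHom_of (h : G) : D.counitHom (D.of h) = 1 := by simp [counitHom]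

noncomputable instance : Bialgebra k D.H :=
  Bialgebra.ofAlgHom D.comulHom D.counitHom
    (D.algHom_ext
      (by simp [TensorProduct.add_tmul, TensorProduct.tmul_add, add_assoc,
          Algebra.TensorProduct.one_def])
      (fun h => by simp))
    (D.algHom_ext (by simp) (fun h => by simp))
    (D.algHom_ext (by simp) (fun h => by simp))

/-- The antipode as a homomorphism to the opposite algebra: `S h = h⁻¹`, `S y = -y g⁻¹`. -/
noncomputable def antipodeHom : D.H →ₐ[k] D.Hᵐᵒᵖ :=
  D.lift
    { toFun := fun h => MulOpposite.op (D.of h⁻¹)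
      map_one' := by simp
      map_mul' := fun h h' => by simp [← MulOpposite.op_mul] }
    (MulOpposite.op (-(D.y * D.of D.g⁻¹)))
    (by
      have hs : D.of D.g⁻¹ * D.y = (D.χ D.g : k) • (D.y * D.of D.g⁻¹) := by
        rw [D.y_mul, smul_smul]; simp
      rw [← MulOpposite.op_pow, q_neg_mul_pow D.isPrimitiveRoot D.n_pos hs, D.y_pow]
      apply MulOpposite.unop_injective
      simp only [MonoidHom.coe_mk, OneHom.coe_mk, MulOpposite.unop_op, MulOpposite.unop_smul,
        MulOpposite.unop_sub, MulOpposite.unop_one, smul_mul_assoc, sub_mul, ← map_pow,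
        ← map_mul, one_mul, ← inv_pow]
      simp [← smul_neg])
    (fun h => by
      apply MulOpposite.unop_injective
      have hc : D.g⁻¹ * h⁻¹ = h⁻¹ * D.g⁻¹ := by
        rw [← mul_inv_rev, ← mul_inv_rev, D.commute_g]
      simp only [MonoidHom.coe_mk, OneHom.coe_mk, MulOpposite.unop_op, MulOpposite.unop_smul,
        MulOpposite.unop_mul, neg_mul, mul_neg, mul_assoc, ← map_mul, hc]
      rw [map_mul, ← mul_assoc D.y, D.y_mul h⁻¹]
      simp [smul_smul, mul_assoc])

/-- The antipode `S` of `H`. -/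
noncomputable def antipodeMap : D.H →ₗ[k] D.H :=
  (MulOpposite.opLinearEquiv k).symm.toLinearMap ∘ₗ D.antipodeHom.toLinearMap

theorem antipodeMap_mul (a b : D.H) :
    D.antipodeMap (a * b) = D.antipodeMap b * D.antipodeMap a := by simp [antipodeMap]

@[simp] theorem antipodeMap_one : D.antipodeMap 1 = 1 := by simp [antipodeMap]

@[simp] theorem antipodeMap_y : D.antipodeMap D.y = -(D.y * D.of D.g⁻¹) := by
  simp [antipodeMap, antipodeHom]

@[simp] theorem antipodeMap_of (h : G) : D.antipodeMap (D.of h) = D.of h⁻¹ := by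
  simp [antipodeMap, antipodeHom]

theorem antipode_left_mul (t u : D.H ⊗[k] D.H) (c : k)
    (ht : LinearMap.mul' k D.H (D.antipodeMap.rTensor D.H t) = algebraMap k D.H c) :
    LinearMap.mul' k D.H (D.antipodeMap.rTensor D.H (t * u)) =
      c • LinearMap.mul' k D.H (D.antipodeMap.rTensor D.H u) := by
  induction u with
  | zero => simp
  | add u v hu hv => simp only [mul_add, map_add, hu, hv, smul_add]
  | tmul u v =>
    have key : LinearMap.mul' k D.H (D.antipodeMap.rTensor D.H (t * u ⊗ₜ[k] v)) =
        D.antipodeMap u * LinearMap.mul' k D.H (D.antipodeMap.rTensor D.H t) * v := by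
      clear ht
      induction t with
      | zero => simp
      | add t s ht hs => simp only [add_mul, map_add, ht, hs, mul_add]
      | tmul t s => simp [antipodeMap_mul, mul_assoc]
    rw [key, ht, ← Algebra.commutes, mul_assoc, ← Algebra.smul_def]
    simp

theorem antipode_right_mul (t u : D.H ⊗[k] D.H) (c : k)
    (hu : LinearMap.mul' k D.H (D.antipodeMap.lTensor D.H u) = algebraMap k D.H c) :
    LinearMap.mul' k D.H (D.antipodeMap.lTensor D.H (t * u)) =
      c • LinearMap.mul' k D.H (D.antipodeMap.lTensor D.H t) := by
  induction t with
  | zero => simp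
  | add t s ht hs => simp only [add_mul, map_add, ht, hs, smul_add]
  | tmul t s =>
    have key : LinearMap.mul' k D.H (D.antipodeMap.lTensor D.H (t ⊗ₜ[k] s * u)) =
        t * LinearMap.mul' k D.H (D.antipodeMap.lTensor D.H u) * D.antipodeMap s := by
      clear hu
      induction u with
      | zero => simp
      | add u v hu hv => simp only [add_mul, map_add, hu, hv, mul_add]
      | tmul u v => simp [antipodeMap_mul, mul_assoc]
    rw [key, hu, ← Algebra.commutes, mul_assoc, ← Algebra.smul_def]
    simp

theorem antipode_left (a : D.H) :
    LinearMap.mul' k D.H (D.antipodeMap.rTensor D.H (D.comulHom a)) =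
      algebraMap k D.H (D.counitHom a) := by
  induction a using D.induction with
  | hc c =>
    rw [AlgHom.commutes, AlgHom.commutes, Algebra.TensorProduct.algebraMap_apply]
    simp [Algebra.algebraMap_eq_smul_one]
  | hy => simp [mul_assoc, ← map_mul]
  | hof h => simp [← map_mul]
  | hadd a b ha hb => simp only [map_add, ha, hb]
  | hmul a b ha hb =>
    rw [map_mul, D.antipode_left_mul _ _ _ ha, hb, map_mul, map_mul, Algebra.smul_def]

theorem antipode_right (a : D.H) :
    LinearMap.mul' k D.H (D.antipodeMap.lTensor D.H (D.comulHom a)) =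
      algebraMap k D.H (D.counitHom a) := by
  induction a using D.induction with
  | hc c =>
    rw [AlgHom.commutes, AlgHom.commutes, Algebra.TensorProduct.algebraMap_apply]
    simp [Algebra.algebraMap_eq_smul_one]
  | hy => simp
  | hof h => simp [← map_mul]
  | hadd a b ha hb => simp only [map_add, ha, hb]
  | hmul a b ha hb =>
    rw [map_mul, D.antipode_right_mul _ _ _ hb, ha, map_mul, map_mul, Algebra.smul_def,
      Algebra.commutes]

noncomputable instance : HopfAlgebra k D.H where
  antipode := D.antipodeMap
  mul_antipode_rTensor_comul := LinearMap.ext fun a => D.antipode_left a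
  mul_antipode_lTensor_comul := LinearMap.ext fun a => D.antipode_right a

end Hopf

end GroupDatum

/-- A finite dimensional left module over a `k`-algebra `A`, given by its underlying vector space
and the action of `A` on it. -/
structure FDModule (k : Type u) (A : Type v) [Field k] [Ring A] [Algebra k A] where
  V : Type u
  [addCommGroup : AddCommGroup V]
  [module : Module k V]
  [finite : FiniteDimensional k V]
  ρ : A →ₐ[k] Module.End k V

namespace FDModule

attribute [instance] FDModule.addCommGroup FDModule.module FDModule.finite

section Basic

variable {k : Type u} {A : Type v} [Field k] [Ring A] [Algebra k A]

/-- Isomorphism of `A`-modules. -/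
def Iso (M N : FDModule k A) : Prop :=
  ∃ e : M.V ≃ₗ[k] N.V, ∀ (a : A) (v : M.V), e (M.ρ a v) = N.ρ a (e v)

theorem Iso.refl (M : FDModule k A) : M.Iso M := ⟨LinearEquiv.refl k M.V, fun _ _ => rfl⟩

theorem Iso.symm {M N : FDModule k A} : M.Iso N → N.Iso M := fun ⟨e, he⟩ =>
  ⟨e.symm, fun a v => e.injective (by simp [he])⟩

theorem Iso.trans {M N P : FDModule k A} : M.Iso N → N.Iso P → M.Iso P :=
  fun ⟨e, he⟩ ⟨f, hf⟩ => ⟨e.trans f, fun a v => by simp [he, hf]⟩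

/-- The setoid of isomorphic modules. -/
def isoSetoid (k : Type u) (A : Type v) [Field k] [Ring A] [Algebra k A] :
    Setoid (FDModule k A) where
  r := Iso
  iseqv := ⟨Iso.refl, Iso.symm, Iso.trans⟩

/-- The direct sum of two modules. -/
def directSum (M N : FDModule k A) : FDModule k A where
  V := M.V × N.V
  ρ := AlgHom.ofLinearMap
    { toFun := fun a => (M.ρ a).prodMap (N.ρ a)
      map_add' := fun a b => by ext <;> simp
      map_smul' := fun c a => by ext <;> simp }
    (by ext <;> simp) (fun a b => by ext <;> simp)

@[simp] theorem directSum_ρ (M N : FDModule k A) (a : A) (x : M.V × N.V) :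
    (M.directSum N).ρ a x = (M.ρ a x.1, N.ρ a x.2) := rfl

end Basic

section Tensor

/-- The action of `A ⊗ B` on `V ⊗ W`. -/
noncomputable def tensorAct {k A B V W : Type*} [Field k] [Ring A] [Algebra k A] [Ring B]
    [Algebra k B] [AddCommGroup V] [Module k V] [AddCommGroup W] [Module k W]
    (r : A →ₐ[k] Module.End k V) (s : B →ₐ[k] Module.End k W) :
    A ⊗[k] B →ₐ[k] Module.End k (V ⊗[k] W) :=
  (Module.endTensorEndAlgHom (R := k) (S := k) (A := k) (M := V) (N := W)).comp
    (Algebra.TensorProduct.map r s)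

section Unbundled

variable {k A B V W X V' W' : Type*} [Field k] [Ring A] [Ring B]
  [AddCommGroup V] [Module k V] [AddCommGroup W] [Module k W] [AddCommGroup X] [Module k X]
  [AddCommGroup V'] [Module k V'] [AddCommGroup W'] [Module k W']

@[simp] theorem tensorAct_tmul [Algebra k A] [Algebra k B] (r : A →ₐ[k] Module.End k V)
    (s : B →ₐ[k] Module.End k W) (a : A) (b : B) (v : V) (w : W) :
    tensorAct r s (a ⊗ₜ[k] b) (v ⊗ₜ[k] w) = r a v ⊗ₜ[k] s b w := rfl

theorem tensorAct_congr [Algebra k A] [Algebra k B] (r : A →ₐ[k] Module.End k V)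
    (s : B →ₐ[k] Module.End k W) (r' : A →ₐ[k] Module.End k V') (s' : B →ₐ[k] Module.End k W')
    (e : V ≃ₗ[k] V') (f : W ≃ₗ[k] W') (he : ∀ a v, e (r a v) = r' a (e v))
    (hf : ∀ b w, f (s b w) = s' b (f w)) (t : A ⊗[k] B) (v : V ⊗[k] W) :
    TensorProduct.congr e f (tensorAct r s t v)
      = tensorAct r' s' t (TensorProduct.congr e f v) := by
  induction t with
  | zero => simp
  | add t s ht hs => simp only [map_add, LinearMap.add_apply, ht, hs]
  | tmul a b =>
    induction v with
    | zero => simp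
    | add v w hv hw => simp only [map_add, hv, hw]
    | tmul v w => simp [he, hf]

theorem tensorAct_assoc_left [Bialgebra k A] (r : A →ₐ[k] Module.End k V)
    (s : A →ₐ[k] Module.End k W) (p : A →ₐ[k] Module.End k X) (t : A ⊗[k] A)
    (v : (V ⊗[k] W) ⊗[k] X) :
    TensorProduct.assoc k V W X
        (tensorAct ((tensorAct r s).comp (Bialgebra.comulAlgHom k A)) p t v) =
      tensorAct r (tensorAct s p)
        (TensorProduct.assoc k A A A ((Coalgebra.comul (R := k)).rTensor A t))
        (TensorProduct.assoc k V W X v) := by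
  induction t with
  | zero => simp
  | add t s ht hs => simp only [map_add, LinearMap.add_apply, ht, hs]
  | tmul a b =>
    induction v with
    | zero => simp
    | add v w hv hw => simp only [map_add, hv, hw]
    | tmul v w =>
      rw [LinearMap.rTensor_tmul, tensorAct_tmul, AlgHom.comp_apply,
        Bialgebra.comulAlgHom_apply]
      generalize (Coalgebra.comul (R := k) a) = t
      induction t with
      | zero => simp
      | add t s ht hs =>
        simp only [map_add, LinearMap.add_apply, TensorProduct.add_tmul, ht, hs]
      | tmul a a' =>
        induction v with
        | zero => simp
        | add v w hv hw => simp only [map_add, TensorProduct.add_tmul, hv, hw]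
        | tmul v v' => simp

theorem tensorAct_assoc_right [Bialgebra k A] (r : A →ₐ[k] Module.End k V)
    (s : A →ₐ[k] Module.End k W) (p : A →ₐ[k] Module.End k X) (t : A ⊗[k] A)
    (v : V ⊗[k] (W ⊗[k] X)) :
    tensorAct r ((tensorAct s p).comp (Bialgebra.comulAlgHom k A)) t v =
      tensorAct r (tensorAct s p) ((Coalgebra.comul (R := k)).lTensor A t) v := by
  induction t with
  | zero => simp
  | add t s ht hs => simp only [map_add, LinearMap.add_apply, ht, hs]
  | tmul a b =>
    induction v with
    | zero => simp
    | add v w hv hw => simp only [map_add, hv, hw]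
    | tmul v w => simp

theorem tensorAct_lid [Bialgebra k A] (r : A →ₐ[k] Module.End k V) (t : A ⊗[k] A)
    (v : k ⊗[k] V) :
    TensorProduct.lid k V (tensorAct
        ((Algebra.ofId k (Module.End k k)).comp (Bialgebra.counitAlgHom k A)) r t v) =
      r (TensorProduct.lid k A ((Coalgebra.counit (R := k)).rTensor A t))
        (TensorProduct.lid k V v) := by
  induction t with
  | zero => simp
  | add t s ht hs => simp only [map_add, LinearMap.add_apply, ht, hs]
  | tmul a b =>
    induction v with
    | zero => simp
    | add v w hv hw => simp only [map_add, hv, hw]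
    | tmul c w => simp [Algebra.ofId_apply, mul_smul, smul_comm c]

theorem tensorAct_rid [Bialgebra k A] (r : A →ₐ[k] Module.End k V) (t : A ⊗[k] A)
    (v : V ⊗[k] k) :
    TensorProduct.rid k V (tensorAct r
        ((Algebra.ofId k (Module.End k k)).comp (Bialgebra.counitAlgHom k A)) t v) =
      r (TensorProduct.rid k A ((Coalgebra.counit (R := k)).lTensor A t))
        (TensorProduct.rid k V v) := by
  induction t with
  | zero => simp
  | add t s ht hs => simp only [map_add, LinearMap.add_apply, ht, hs]
  | tmul a b =>
    induction v with
    | zero => simp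
    | add v w hv hw => simp only [map_add, hv, hw]
    | tmul w c => simp [Algebra.ofId_apply, mul_smul, smul_comm c]

end Unbundled

variable {k : Type u} {A : Type v} [Field k] [Ring A] [Bialgebra k A]

/-- The tensor product of two modules, on which `A` acts through its comultiplication. -/
noncomputable def tensor (M N : FDModule k A) : FDModule k A where
  V := M.V ⊗[k] N.V
  ρ := (tensorAct M.ρ N.ρ).comp (Bialgebra.comulAlgHom k A)

/-- The trivial module `k`, on which `A` acts through its counit. -/
noncomputable def trivial (k : Type u) (A : Type v) [Field k] [Ring A] [Bialgebra k A] :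
    FDModule k A where
  V := k
  ρ := (Algebra.ofId k (Module.End k k)).comp (Bialgebra.counitAlgHom k A)

theorem Iso.tensor {M M' N N' : FDModule k A} :
    M.Iso M' → N.Iso N' → (M.tensor N).Iso (M'.tensor N') := fun ⟨e, he⟩ ⟨f, hf⟩ =>
  ⟨TensorProduct.congr e f, fun a v =>
    tensorAct_congr M.ρ N.ρ M'.ρ N'.ρ e f he hf (Coalgebra.comul a) v⟩

theorem tensor_assoc (M N P : FDModule k A) :
    ((M.tensor N).tensor P).Iso (M.tensor (N.tensor P)) :=
  ⟨TensorProduct.assoc k M.V N.V P.V, fun a v => by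
    refine (tensorAct_assoc_left M.ρ N.ρ P.ρ (Coalgebra.comul a) v).trans ?_
    rw [Coalgebra.coassoc_apply]
    exact (tensorAct_assoc_right M.ρ N.ρ P.ρ (Coalgebra.comul a) _).symm⟩

theorem trivial_tensor (M : FDModule k A) : ((trivial k A).tensor M).Iso M :=
  ⟨TensorProduct.lid k M.V, fun a v => by
    refine (tensorAct_lid M.ρ (Coalgebra.comul a) v).trans ?_
    rw [Coalgebra.rTensor_counit_comul, TensorProduct.lid_tmul, one_smul]
    rfl⟩

theorem tensor_trivial (M : FDModule k A) : (M.tensor (trivial k A)).Iso M :=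
  ⟨TensorProduct.rid k M.V, fun a v => by
    refine (tensorAct_rid M.ρ (Coalgebra.comul a) v).trans ?_
    rw [Coalgebra.lTensor_counit_comul, TensorProduct.rid_tmul, one_smul]
    rfl⟩

end Tensor

end FDModule

/-- Isomorphism classes of finite dimensional `A`-modules. -/
def IsoClass (k : Type u) (A : Type v) [Field k] [Ring A] [Algebra k A] :=
  Quotient (FDModule.isoSetoid k A)

/-- The isomorphism class of a module. -/
def FDModule.isoClass {k : Type u} {A : Type v} [Field k] [Ring A] [Algebra k A]
    (M : FDModule k A) : IsoClass k A :=
  Quotient.mk (FDModule.isoSetoid k A) M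

section Green

variable (k : Type u) (A : Type v) [Field k] [Ring A] [Bialgebra k A]

/-- Isomorphism classes form a monoid under the tensor product. -/
noncomputable instance : Monoid (IsoClass k A) where
  mul := Quotient.map₂ FDModule.tensor (fun _ _ h _ _ h' => FDModule.Iso.tensor h h')
  one := (FDModule.trivial k A).isoClass
  mul_assoc := by
    rintro ⟨M⟩ ⟨N⟩ ⟨P⟩
    exact Quotient.sound (FDModule.tensor_assoc M N P)
  one_mul := by
    rintro ⟨M⟩
    exact Quotient.sound (FDModule.trivial_tensor M)
  mul_one := by
    rintro ⟨M⟩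
    exact Quotient.sound (FDModule.tensor_trivial M)

variable {k A} in
/-- The basis element `[M]` of the free abelian group `F(A)` on the isomorphism classes, a ring
under `[M][N] = [M ⊗ N]`. -/
noncomputable def freeClass (M : FDModule k A) : MonoidAlgebra ℤ (IsoClass k A) :=
  MonoidAlgebra.of ℤ (IsoClass k A) M.isoClass

/-- The relations `[M ⊕ N] = [M] + [N]`. -/
inductive GreenRel : MonoidAlgebra ℤ (IsoClass k A) → MonoidAlgebra ℤ (IsoClass k A) → Prop
  | directSum (M N : FDModule k A) :
      GreenRel (freeClass (M.directSum N)) (freeClass M + freeClass N)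

/-- The Green ring `r(A)`: the quotient of the ring `F(A)` by the relations
`[M ⊕ N] = [M] + [N]`. -/
def GreenRing := RingQuot (GreenRel k A)

noncomputable instance : Ring (GreenRing k A) := inferInstanceAs (Ring (RingQuot (GreenRel k A)))

variable {k A} in
/-- The class `[M]` in the Green ring. -/
noncomputable def greenClass (M : FDModule k A) : GreenRing k A :=
  RingQuot.mkRingHom (GreenRel k A) (freeClass M)

end Green

namespace GroupDatum

theorem inv_χ_g_pow_n {k G : Type*} [Field k] [Group G] (D : GroupDatum k G) :
    D.χ⁻¹ (D.g ^ D.n) = 1 := by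
  rw [MonoidHom.inv_apply, map_pow, inv_eq_one]
  exact pow_orderOf_eq_one _

variable {k : Type u} {G : Type v} [Field k] [Group G] (D : GroupDatum k G)

/-- The one-dimensional `kG`-module `V_ψ` of a linear character `ψ` that is trivial on `g ^ n`,
as an `H`-module: `h ∈ G` acts by the scalar `ψ h`, and `y` acts by `0`. -/
noncomputable def charModule [Finite G] (ψ : G →* kˣ) (hψ : ψ (D.g ^ D.n) = 1) : FDModule k D.H where
  V := k
  ρ := (Algebra.ofId k (Module.End k k)).comp
    (D.lift ((Units.coeHom k).comp ψ) 0 (by simp [hψ, D.n_pos.ne']) (by simp))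

/-- The shift of `k ^ j = k ⊕ x k ⊕ ⋯ ⊕ x ^ (j - 1) k`: it sends `x ^ i` to `x ^ (i + 1)` for
`i + 1 < j` and `x ^ (j - 1)` to `0`. -/
def shift (k : Type u) [Field k] (j : ℕ) : Module.End k (Fin j → k) where
  toFun v i := if h : (i : ℕ) = 0 then 0 else v ⟨i - 1, by omega⟩
  map_add' v w := by ext i; by_cases h : (i : ℕ) = 0 <;> simp [h]
  map_smul' c v := by ext i; by_cases h : (i : ℕ) = 0 <;> simp [h]

/-- The action of `h ∈ G` on `k ^ j`: it multiplies `x ^ i` by `χ h ^ (-i)`. -/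
def diagAct (j : ℕ) : G →* Module.End k (Fin j → k) where
  toFun h :=
    { toFun := fun v i => ((D.χ h)⁻¹ ^ (i : ℕ) : kˣ) * v i
      map_add' := fun v w => by ext i; simp [mul_add]
      map_smul' := fun c v => by ext i; simp [mul_left_comm] }
  map_one' := by ext; simp
  map_mul' h h' := by
    refine LinearMap.ext fun v => funext fun i => ?_
    simp [mul_pow, mul_assoc, mul_left_comm]

theorem shift_pow_apply (j m : ℕ) (v : Fin j → k) (i : Fin j) :
    (shift k j ^ m) v i = if h : (i : ℕ) < m then 0 else v ⟨i - m, by omega⟩ := by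
  induction m generalizing i with
  | zero => simp
  | succ m ih =>
    rw [pow_succ', Module.End.mul_apply]
    change (if h : (i : ℕ) = 0 then 0 else (shift k j ^ m) v ⟨i - 1, by omega⟩) = _
    by_cases h : (i : ℕ) = 0
    · simp [h]
    · rw [dif_neg h, ih]
      by_cases h' : (i : ℕ) < m + 1
      · rw [dif_pos h', dif_pos (show (i : ℕ) - 1 < m by omega)]
      · rw [dif_neg h', dif_neg (show ¬ (i : ℕ) - 1 < m by omega)]
        exact congrArg v (Fin.ext (by simp; omega))

/-- The action of `H` on `k ^ j`, for `j ≤ n`: `h ∈ G` acts by `diagAct`, and `y` by `shift`. -/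
noncomputable def uniserialHom (j : ℕ) (hj : j ≤ D.n) : D.H →ₐ[k] Module.End k (Fin j → k) :=
  D.lift (D.diagAct j) (shift k j)
    (by
      have h1 : shift k j ^ D.n = 0 := by
        refine LinearMap.ext fun v => funext fun i => ?_
        rw [shift_pow_apply, dif_pos (by omega)]
        rfl
      have h2 : D.diagAct j (D.g ^ D.n) = 1 := by
        refine LinearMap.ext fun v => funext fun i => ?_
        have : D.χ (D.g ^ D.n) = 1 := by rw [map_pow]; exact pow_orderOf_eq_one _
        simp [diagAct, this]
      rw [h1, h2, sub_self, smul_zero])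
    (fun h => by
      refine LinearMap.ext fun v => funext fun i => ?_
      change (if h : (i : ℕ) = 0 then 0 else _) =
        (D.χ h : k) * (((D.χ h)⁻¹ ^ (i : ℕ) : kˣ) * (if h : (i : ℕ) = 0 then 0 else _))
      by_cases hi : (i : ℕ) = 0
      · simp [hi]
      · obtain ⟨m, hm⟩ : ∃ m, (i : ℕ) = m + 1 := ⟨i - 1, by omega⟩
        rw [dif_neg hi, dif_neg hi]
        simp [diagAct, hm, pow_succ', ← mul_assoc])

/-- The `H`-module `M(j, 0) = k ⊕ x k ⊕ ⋯ ⊕ x ^ (j - 1) k`, for `j ≤ n`. -/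
noncomputable def uniserial (j : ℕ) (hj : j ≤ D.n) : FDModule k D.H where
  V := Fin j → k
  ρ := D.uniserialHom j hj

end GroupDatum

/-! Write q = χ(g), a primitive n-th root of unity, and M(j) for the class of M(j, 0). Since χ(g)^n
= 1, the element g^n is central in H. As y^n = μ(g^n - 1) with μ ≠ 0, every module splits into a
part on which g^n = 1 and y is nilpotent, and a part on which g^n - 1, hence y, is bijective. The
first part is a sum of modules V ⊗ M(j, 0) with y = 0 on V (`exists_uniserial_summand`); the second
is determined by its restriction to G (`iso_of_traceOf_eq_of_isUnit`). So every element of the Green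
ring is x = ∑ v_j M(j) + w with 1 ≤ j ≤ n, where v_j comes from modules with y = 0 and w from
modules with y bijective (`exists_decomposition`). The products are governed by M(2) M(j) = M(j + 1)
+ a M(j - 1) for 1 ≤ j < n, M(2) M(n) = (1 + a) M(n), a w = w and M(n) w = n w.

The element z = (1 - a) M(n) is central, and M(n)^2 = (1 + a + ⋯ + a^(n-1)) M(n) gives z^2 = (1 -
a)(1 - a^n) M(n) = 0, because χ^n = 1. A central element of square zero generates an ideal inside
the radical.

Conversely, a ring homomorphism to `k` whose values are algebraic integers kills the radical
(`RingHom.map_eq_zero_of_mem_jacobson`). There are two families of them. One consists of the traces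
of h ∈ G. The other, `blockMap`, kills the modules with y bijective and sends V ⊗ M(j, 0) to tr_V(h)
(u^j - v^j)/(u - v); the conditions uv = χ(h)⁻¹, u ≠ v and u^n = v^n make it compatible with the
product rules. For x in the radical the second family forces v_j = 0 for j < n
(`blockTrace_eq_zero_of_mem_jacobson`). Summing traces over the powers of g^n separates v_n M(n)
from w: it follows that w = 0 and that the traces of v_n vanish on ker χ. Modulo 1 - a every v_n can
be twisted so that g acts trivially, and ker χ together with g generates G, so v_n is a multiple of
1 - a (`exists_eq_mul_one_sub_charClass`). -/

/-! ### Additive maps on quotient rings, and direct sums of modules. -/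

/-- The universal property of `RingQuot` as an additive group. -/
noncomputable def RingQuot.addLift {R B : Type*} [Ring R] [AddCommGroup B] {r : R → R → Prop}
    (F : R →+ B) (h : ∀ x y, RingQuot.Rel r x y → F x = F y) : RingQuot r →+ B where
  toFun x := Quot.lift F h x.toQuot
  map_zero' := by
    rw [← map_zero (RingQuot.mkRingHom r), RingQuot.mkRingHom_def]
    exact map_zero F
  map_add' x y := by
    obtain ⟨x, rfl⟩ := RingQuot.mkRingHom_surjective r x
    obtain ⟨y, rfl⟩ := RingQuot.mkRingHom_surjective r y
    rw [← map_add (RingQuot.mkRingHom r), RingQuot.mkRingHom_def]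
    exact map_add F x y

theorem RingQuot.addLift_mkRingHom {R B : Type*} [Ring R] [AddCommGroup B] {r : R → R → Prop}
    (F : R →+ B) (h : ∀ x y, RingQuot.Rel r x y → F x = F y) (x : R) :
    RingQuot.addLift F h (RingQuot.mkRingHom r x) = F x := by
  rw [RingQuot.mkRingHom_def]
  rfl

namespace FDModule

section Sub

variable {k : Type u} {A : Type v} [Field k] [Ring A] [Algebra k A]

/-- The module structure on an invariant subspace. -/
def sub (X : FDModule k A) (W : Submodule k X.V) (hW : ∀ a, ∀ w ∈ W, X.ρ a w ∈ W) :
    FDModule k A where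
  V := W
  ρ := AlgHom.ofLinearMap
    { toFun := fun a => (X.ρ a).restrict (hW a)
      map_add' := fun a b => by ext; simp
      map_smul' := fun c a => by ext; simp }
    (by ext; simp) (fun a b => by ext; simp)

theorem iso_directSum_sub (X : FDModule k A) {W W' : Submodule k X.V} (h : IsCompl W W')
    (hW : ∀ a, ∀ w ∈ W, X.ρ a w ∈ W) (hW' : ∀ a, ∀ w ∈ W', X.ρ a w ∈ W') :
    ((X.sub W hW).directSum (X.sub W' hW')).Iso X :=
  ⟨W.prodEquivOfIsCompl W' h, fun a (v : W × W') => by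
    change ((X.ρ a v.1 : X.V) + X.ρ a v.2) = X.ρ a (v.1 + v.2)
    rw [map_add]⟩

/-- A module of which `M` is a retract is the direct sum of `M` and a complement. -/
theorem iso_directSum_of_retract (M X : FDModule k A) (i : M.V →ₗ[k] X.V) (r : X.V →ₗ[k] M.V)
    (hi : ∀ a v, i (M.ρ a v) = X.ρ a (i v)) (hr : ∀ a v, r (X.ρ a v) = M.ρ a (r v))
    (h : Function.Injective (r ∘ₗ i)) :
    ∃ hW : ∀ a, ∀ w ∈ LinearMap.ker r, X.ρ a w ∈ LinearMap.ker r,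
      (M.directSum (X.sub (LinearMap.ker r) hW)).Iso X := by
  have hW : ∀ a, ∀ w ∈ LinearMap.ker r, X.ρ a w ∈ LinearMap.ker r := fun a w hw => by
    rw [LinearMap.mem_ker, hr, LinearMap.mem_ker.1 hw, map_zero]
  have hs : Function.Surjective (r ∘ₗ i) := LinearMap.injective_iff_surjective.1 h
  refine ⟨hW, LinearEquiv.ofBijective (i.coprod (LinearMap.ker r).subtype) ⟨?_, ?_⟩, ?_⟩
  · rw [injective_iff_map_eq_zero]
    rintro ⟨m, w⟩ hmw
    rw [LinearMap.coprod_apply] at hmw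
    have h1 : (r ∘ₗ i) m = 0 := by
      have := congrArg r hmw
      rw [map_add, map_zero, Submodule.subtype_apply, LinearMap.mem_ker.1 w.2, add_zero] at this
      exact this
    have h2 : m = 0 := h (by rw [h1, map_zero])
    subst h2
    rw [map_zero, zero_add] at hmw
    exact Prod.ext rfl (Subtype.ext hmw)
  · intro x
    obtain ⟨m, hm⟩ := hs (r x)
    refine ⟨(m, ⟨x - i m, ?_⟩), ?_⟩
    · rw [LinearMap.mem_ker, map_sub, sub_eq_zero]; exact hm.symm
    · simp
  · intro a (v : M.V × LinearMap.ker r)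
    change i (M.ρ a v.1) + (X.ρ a v.2 : X.V) = X.ρ a (i v.1 + v.2)
    rw [map_add, hi]

end Sub

section Distrib

/-- The element `t` is arbitrary rather than a value of the comultiplication, so that the identity
can be checked on pure tensors. -/
theorem tensorAct_prodLeft {k A B V W X : Type*} [Field k] [Ring A] [Ring B]
    [AddCommGroup V] [Module k V] [AddCommGroup W] [Module k W] [AddCommGroup X] [Module k X]
    [Algebra k A] [Algebra k B] (r : A →ₐ[k] Module.End k V) (s : A →ₐ[k] Module.End k W)
    (rs : A →ₐ[k] Module.End k (V × W)) (h : ∀ a x, rs a x = (r a x.1, s a x.2))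
    (p : B →ₐ[k] Module.End k X) (t : A ⊗[k] B) (v : (V × W) ⊗[k] X) :
    TensorProduct.prodLeft k k V W X (tensorAct rs p t v) =
      (tensorAct r p t (TensorProduct.prodLeft k k V W X v).1,
        tensorAct s p t (TensorProduct.prodLeft k k V W X v).2) := by
  induction t with
  | zero => simp; rfl
  | add t s ht hs => simp only [map_add, LinearMap.add_apply, ht, hs, Prod.mk_add_mk]
  | tmul a b =>
    induction v with
    | zero => simp; rfl
    | add v w hv hw => simp only [map_add, hv, hw, Prod.mk_add_mk, Prod.fst_add, Prod.snd_add]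
    | tmul v w =>
      obtain ⟨v, v'⟩ := v
      simp [h]

theorem tensorAct_prodRight {k A B V W X : Type*} [Field k] [Ring A] [Ring B]
    [AddCommGroup V] [Module k V] [AddCommGroup W] [Module k W] [AddCommGroup X] [Module k X]
    [Algebra k A] [Algebra k B] (r : A →ₐ[k] Module.End k V) (s : A →ₐ[k] Module.End k W)
    (rs : A →ₐ[k] Module.End k (V × W)) (h : ∀ a x, rs a x = (r a x.1, s a x.2))
    (p : B →ₐ[k] Module.End k X) (t : B ⊗[k] A) (v : X ⊗[k] (V × W)) :
    TensorProduct.prodRight k k X V W (tensorAct p rs t v) =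
      (tensorAct p r t (TensorProduct.prodRight k k X V W v).1,
        tensorAct p s t (TensorProduct.prodRight k k X V W v).2) := by
  induction t with
  | zero => simp; rfl
  | add t s ht hs => simp only [map_add, LinearMap.add_apply, ht, hs, Prod.mk_add_mk]
  | tmul a b =>
    induction v with
    | zero => simp; rfl
    | add v w hv hw => simp only [map_add, hv, hw, Prod.mk_add_mk, Prod.fst_add, Prod.snd_add]
    | tmul v w => simp [h]

variable {k : Type u} {A : Type v} [Field k] [Ring A] [Bialgebra k A]

theorem directSum_tensor (M N P : FDModule k A) :
    ((M.directSum N).tensor P).Iso ((M.tensor P).directSum (N.tensor P)) :=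
  ⟨TensorProduct.prodLeft k k M.V N.V P.V, fun a v =>
    tensorAct_prodLeft M.ρ N.ρ (M.directSum N).ρ (fun _ _ => rfl) P.ρ (Coalgebra.comul a) v⟩

theorem tensor_directSum (P M N : FDModule k A) :
    (P.tensor (M.directSum N)).Iso ((P.tensor M).directSum (P.tensor N)) :=
  ⟨TensorProduct.prodRight k k P.V M.V N.V, fun a v =>
    tensorAct_prodRight M.ρ N.ρ (M.directSum N).ρ (fun _ _ => rfl) P.ρ (Coalgebra.comul a) v⟩

end Distrib

end FDModule

/-! ### The Green ring: additive generators and additive invariants. -/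

section Green

variable {k : Type u} {A : Type v} [Field k] [Ring A] [Bialgebra k A]

theorem freeClass_congr {M N : FDModule k A} (h : M.Iso N) : freeClass M = freeClass N :=
  congrArg (MonoidAlgebra.of ℤ (IsoClass k A)) (Quotient.sound h)

theorem freeClass_mul (M N : FDModule k A) :
    freeClass M * freeClass N = freeClass (M.tensor N) :=
  ((MonoidAlgebra.of ℤ (IsoClass k A)).map_mul _ _).symm

theorem greenClass_congr {M N : FDModule k A} (h : M.Iso N) : greenClass M = greenClass N :=
  congrArg (RingQuot.mkRingHom (GreenRel k A)) (freeClass_congr h)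

theorem greenClass_directSum (M N : FDModule k A) :
    greenClass (M.directSum N) = greenClass M + greenClass N := by
  have := RingQuot.mkRingHom_rel (GreenRel.directSum M N)
  rw [map_add] at this
  exact this

theorem greenClass_tensor (M N : FDModule k A) :
    greenClass (M.tensor N) = greenClass M * greenClass N := by
  have := map_mul (RingQuot.mkRingHom (GreenRel k A)) (freeClass M) (freeClass N)
  rw [freeClass_mul] at this
  exact this

theorem greenClass_trivial : greenClass (FDModule.trivial k A) = 1 :=
  (congrArg (RingQuot.mkRingHom (GreenRel k A)) (MonoidAlgebra.of ℤ (IsoClass k A)).map_one).trans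
    (map_one (RingQuot.mkRingHom (GreenRel k A)))

theorem greenRing_induction {P : GreenRing k A → Prop} (h : ∀ M : FDModule k A, P (greenClass M))
    (hadd : ∀ x y, P x → P y → P (x + y)) (hneg : ∀ x, P x → P (-x)) (x : GreenRing k A) :
    P x := by
  obtain ⟨x, rfl⟩ := RingQuot.mkRingHom_surjective (GreenRel k A) x
  have h0 : P (RingQuot.mkRingHom (GreenRel k A) 0) := by
    have := hadd _ _ (h (FDModule.trivial k A)) (hneg _ (h (FDModule.trivial k A)))
    rw [add_neg_cancel] at this
    rwa [map_zero]
  have hsm : ∀ (n : ℕ) y, P (RingQuot.mkRingHom (GreenRel k A) y) →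
      P (RingQuot.mkRingHom (GreenRel k A) (n • y)) := by
    intro n y hy
    induction n with
    | zero => rw [zero_smul]; exact h0
    | succ n ih => rw [succ_nsmul, map_add]; exact hadd _ _ ih hy
  induction x using MonoidAlgebra.induction_on with
  | of M =>
    obtain ⟨M, rfl⟩ := Quotient.exists_rep M
    exact h M
  | add x y hx hy => rw [map_add]; exact hadd _ _ hx hy
  | smul c x hx =>
    obtain ⟨n, rfl | rfl⟩ := c.eq_nat_or_neg
    · rw [natCast_zsmul]; exact hsm n x hx
    · rw [neg_smul, map_neg, natCast_zsmul]; exact hneg _ (hsm n x hx)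

section AddLift

variable {B : Type*} [AddCommGroup B] (f : FDModule k A → B)
  (hf : ∀ M N, M.Iso N → f M = f N)

/-- An invariant of modules as a function on isomorphism classes. -/
def classLift : IsoClass k A → B :=
  Quotient.lift (s := FDModule.isoSetoid k A) f hf

/-- The extension of an invariant of modules to the free abelian group on isomorphism classes. -/
noncomputable def freeAddLift : MonoidAlgebra ℤ (IsoClass k A) →+ B :=
  (Finsupp.liftAddHom fun c : IsoClass k A => zmultiplesHom B (classLift f hf c)).comp
      (MonoidAlgebra.coeffAddEquiv).toAddMonoidHom

theorem freeAddLift_freeClass (M : FDModule k A) : freeAddLift f hf (freeClass M) = f M := by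
  have h : freeAddLift f hf (freeClass M) = Finsupp.liftAddHom
      (fun c : IsoClass k A => zmultiplesHom B (classLift f hf c))
        (Finsupp.single M.isoClass (1 : ℤ)) := rfl
  rw [h, Finsupp.liftAddHom_apply_single, zmultiplesHom_apply, one_zsmul]
  rfl

/-- The Green ring is a quotient by a two-sided ideal, so an additive invariant has to respect every
multiple c(x - y)d of a relation. By bilinearity c and d may be taken to be classes of modules, and
then distributivity of ⊗ over ⊕ turns the multiple into a relation of the same kind. -/
theorem freeAddLift_rel (hf' : ∀ M N, f (M.directSum N) = f M + f N)
    {x y : MonoidAlgebra ℤ (IsoClass k A)} (h : RingQuot.Rel (GreenRel k A) x y)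
    (c d : MonoidAlgebra ℤ (IsoClass k A)) :
    freeAddLift f hf (c * x * d) = freeAddLift f hf (c * y * d) := by
  induction h generalizing c d with
  | @of x y h =>
    obtain ⟨M, N⟩ := h
    induction c using MonoidAlgebra.induction_on with
    | of P =>
      obtain ⟨P, rfl⟩ := Quotient.exists_rep P
      induction d using MonoidAlgebra.induction_on with
      | of Q =>
        obtain ⟨Q, rfl⟩ := Quotient.exists_rep Q
        change freeAddLift f hf (freeClass P * freeClass (M.directSum N) * freeClass Q) =
          freeAddLift f hf (freeClass P * (freeClass M + freeClass N) * freeClass Q)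
        rw [mul_add, add_mul, map_add]
        simp only [freeClass_mul, freeAddLift_freeClass]
        rw [← hf']
        exact hf _ _ (((FDModule.tensor_directSum P M N).tensor (FDModule.Iso.refl Q)).trans
          (FDModule.directSum_tensor _ _ Q))
      | add d d' h h' => rw [mul_add, mul_add, map_add, map_add, h, h']
      | smul n d h => rw [mul_smul_comm, mul_smul_comm, map_zsmul, map_zsmul, h]
    | add c c' h h' => rw [add_mul, add_mul, add_mul, add_mul, map_add, map_add, h, h']
    | smul n c h =>
      rw [smul_mul_assoc, smul_mul_assoc, smul_mul_assoc, smul_mul_assoc, map_zsmul, map_zsmul, h]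
  | add_left _ ih => rw [mul_add, mul_add, add_mul, add_mul, map_add, map_add, ih]
  | mul_left _ ih => simpa only [mul_assoc] using ih c (_ * d)
  | mul_right _ ih => simpa only [mul_assoc] using ih (c * _) d

variable (hf' : ∀ M N, f (M.directSum N) = f M + f N)

/-- The extension of an additive invariant of modules to the Green ring. -/
noncomputable def greenAddLift : GreenRing k A →+ B :=
  RingQuot.addLift (freeAddLift f hf)
    (fun x y h => by simpa using freeAddLift_rel f hf hf' h 1 1)

theorem greenAddLift_greenClass (M : FDModule k A) :
    greenAddLift f hf hf' (greenClass M) = f M :=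
  (RingQuot.addLift_mkRingHom _ _ _).trans (freeAddLift_freeClass f hf M)

end AddLift
end Green

/-! ### Characters of finite groups in characteristic zero. -/

theorem LinearMap.trace_eq_add_of_isCompl {k V : Type*} [Field k] [AddCommGroup V] [Module k V]
    [FiniteDimensional k V] {p q : Submodule k V} (h : IsCompl p q) (f : V →ₗ[k] V)
    (hp : ∀ x ∈ p, f x ∈ p) (hq : ∀ x ∈ q, f x ∈ q) :
    LinearMap.trace k V f =
      LinearMap.trace k p (f.restrict hp) + LinearMap.trace k q (f.restrict hq) := by
  rw [← LinearMap.trace_prodMap', ← LinearMap.trace_conj' _ (p.prodEquivOfIsCompl q h)]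
  congr 1
  refine LinearMap.ext fun x => ?_
  obtain ⟨x, rfl⟩ := (p.prodEquivOfIsCompl q h).surjective x
  simp [LinearEquiv.conj_apply]

namespace Representation

variable {k G : Type*} [Field k] [CharZero k] [Group G] [Finite G]

/-- Maschke's theorem, in terms of invariant subspaces. -/
theorem exists_isCompl_invariant {V : Type*} [AddCommGroup V] [Module k V]
    (ρ : Representation k G V) (p : Submodule k V) (hp : ∀ g, ∀ v ∈ p, ρ g v ∈ p) :
    ∃ q : Submodule k V, IsCompl p q ∧ ∀ g, ∀ v ∈ q, ρ g v ∈ q := by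
  have : NeZero (Nat.card G : k) := ⟨Nat.cast_ne_zero.2 Nat.card_pos.ne'⟩
  have : IsSemisimpleRepresentation ρ := inferInstance
  obtain ⟨q, hq⟩ := exists_isCompl (⟨p, fun g v hv => hp g v hv⟩ : Subrepresentation ρ)
  refine ⟨q.toSubmodule, IsCompl.of_eq ?_ ?_, fun g v hv => q.apply_mem_toSubmodule g hv⟩
  · exact congrArg Subrepresentation.toSubmodule hq.inf_eq_bot
  · exact congrArg Subrepresentation.toSubmodule hq.sup_eq_top

/-- The dimension of Hom(ρ, σ) is an average of products of character values. With equal characters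
it equals the dimension of End(ρ), which contains the identity. -/
theorem exists_intertwining_ne_zero {V W : Type*} [AddCommGroup V] [Module k V]
    [FiniteDimensional k V] [AddCommGroup W] [Module k W] [FiniteDimensional k W]
    (ρ : Representation k G V) (σ : Representation k G W)
    (h : ∀ g, ρ.character g = σ.character g) [Nontrivial V] :
    ∃ f : V →ₗ[k] W, f ≠ 0 ∧ ∀ g v, f (ρ g v) = σ g (f v) := by
  have hc : (Nat.card G : k) ≠ 0 := Nat.cast_ne_zero.2 Nat.card_pos.ne'
  have := invertibleOfNonzero hc
  have := Fintype.ofFinite G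
  have h1 := card_inv_mul_sum_char_mul_char_eq_finrank ρ σ
  have h2 := card_inv_mul_sum_char_mul_char_eq_finrank ρ ρ
  simp_rw [← h] at h1
  rw [h2, Nat.cast_inj] at h1
  have h3 : 0 < Module.finrank k (IntertwiningMap ρ ρ) := by
    have : FiniteDimensional k (IntertwiningMap ρ ρ) :=
      (invariantsEquivIntertwiningMap ρ ρ).finiteDimensional
    have : Nontrivial (IntertwiningMap ρ ρ) := by
      refine ⟨⟨IntertwiningMap.id ρ, 0, fun h => ?_⟩⟩
      obtain ⟨v, hv⟩ := exists_ne (0 : V)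
      exact hv (congrArg (fun f : IntertwiningMap ρ ρ => f v) h)
    exact Module.finrank_pos
  rw [h1] at h3
  have := Module.nontrivial_of_finrank_pos h3
  obtain ⟨f, hf⟩ := exists_ne (0 : IntertwiningMap ρ σ)
  refine ⟨f.toLinearMap, fun h => hf ?_, fun g v => ?_⟩
  · ext v; exact LinearMap.congr_fun h v
  · exact LinearMap.congr_fun (f.isIntertwining' g) v

/-- Representations with the same character are isomorphic. -/
theorem exists_equiv_of_character_eq {V W : Type u} [AddCommGroup V] [Module k V]
    [FiniteDimensional k V] [AddCommGroup W] [Module k W] [FiniteDimensional k W]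
    (ρ : Representation k G V) (σ : Representation k G W)
    (h : ∀ g, ρ.character g = σ.character g) :
    ∃ e : V ≃ₗ[k] W, ∀ g v, e (ρ g v) = σ g (e v) := by
  induction hd : Module.finrank k V using Nat.strong_induction_on generalizing V W with
  | h d ih =>
  have hVW : Module.finrank k V = Module.finrank k W := by
    have := h 1
    rwa [char_one, char_one, Nat.cast_inj] at this
  rcases subsingleton_or_nontrivial V with hV | hV
  · refine ⟨LinearEquiv.ofFinrankEq V W hVW, fun g v => ?_⟩
    rw [Subsingleton.elim v 0]; simp
  -- A nonzero intertwiner identifies an invariant complement of its kernel with its range.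
  -- Additivity of traces gives its kernel and a complement of its range the same character, and the
  -- kernel is smaller than V, so induction applies to these two.
  · obtain ⟨f, hf0, hf⟩ := exists_intertwining_ne_zero ρ σ h
    have hk : ∀ g, ∀ v ∈ LinearMap.ker f, ρ g v ∈ LinearMap.ker f := fun g v hv => by
      rw [LinearMap.mem_ker, hf, LinearMap.mem_ker.1 hv, map_zero]
    have hr : ∀ g, ∀ v ∈ LinearMap.range f, σ g v ∈ LinearMap.range f := by
      rintro g _ ⟨v, rfl⟩
      exact ⟨ρ g v, hf g v⟩
    obtain ⟨V1, hV1, hV1'⟩ := exists_isCompl_invariant ρ _ hk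
    obtain ⟨W1, hW1, hW1'⟩ := exists_isCompl_invariant σ _ hr
    let e1 : V1 ≃ₗ[k] LinearMap.range f := LinearEquiv.ofBijective
      ((f.comp V1.subtype).codRestrict _ fun v => LinearMap.mem_range_self f v) (by
      constructor
      · rw [injective_iff_map_eq_zero]
        intro v hv
        have hv' : f v = 0 := congrArg Subtype.val hv
        have : (v : V) ∈ LinearMap.ker f ⊓ V1 := ⟨hv', v.2⟩
        rw [hV1.inf_eq_bot] at this
        exact Subtype.ext this
      · rintro ⟨_, v, rfl⟩
        obtain ⟨a, ha, b, hb, rfl⟩ := Submodule.mem_sup.1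
          (show v ∈ LinearMap.ker f ⊔ V1 by rw [hV1.sup_eq_top]; trivial)
        refine ⟨⟨b, hb⟩, Subtype.ext ?_⟩
        change f b = f (a + b)
        rw [map_add, LinearMap.mem_ker.1 ha, zero_add])
    have he1 : ∀ v : V1, (e1 v : W) = f v := fun _ => rfl
    let ρk : Representation k G (LinearMap.ker f) :=
      (⟨_, fun g v hv => hk g v hv⟩ : Subrepresentation ρ).toRepresentation
    let σ1 : Representation k G W1 :=
      (⟨_, fun g v hv => hW1' g v hv⟩ : Subrepresentation σ).toRepresentation
    obtain ⟨e2, he2⟩ := ih (Module.finrank k (LinearMap.ker f)) (by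
        rw [← hd]
        refine Submodule.finrank_lt fun ht => hf0 (LinearMap.ker_eq_top.1 ht)) ρk σ1 (by
      intro g
      have t1 := LinearMap.trace_eq_add_of_isCompl hV1 (ρ g) (hk g) (hV1' g)
      have t2 := LinearMap.trace_eq_add_of_isCompl hW1 (σ g) (hr g) (hW1' g)
      have t3 : LinearMap.trace k V1 ((ρ g).restrict (hV1' g)) =
          LinearMap.trace k (LinearMap.range f) ((σ g).restrict (hr g)) := by
        rw [← LinearMap.trace_conj' _ e1]
        congr 1
        refine LinearMap.ext fun x => ?_
        obtain ⟨x, rfl⟩ := e1.surjective x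
        refine Subtype.ext ?_
        simp [LinearEquiv.conj_apply, he1, hf]
      have t4 := h g
      simp only [character] at t4
      rw [t1, t2, t3, add_comm, add_left_cancel_iff] at t4
      exact t4) rfl
    let E := ((Submodule.prodEquivOfIsCompl _ _ hV1).symm.trans
      (LinearEquiv.prodComm k _ _)).trans ((e1.prodCongr e2).trans
        (Submodule.prodEquivOfIsCompl _ _ hW1))
    refine ⟨E, fun g v => ?_⟩
    obtain ⟨⟨a, b⟩, rfl⟩ := (Submodule.prodEquivOfIsCompl _ _ hV1).surjective v
    have hE : ∀ a b, E (Submodule.prodEquivOfIsCompl _ _ hV1 (a, b)) = f b + e2 a := by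
      intro a b
      simp [E, he1]
    have hab : ρ g (Submodule.prodEquivOfIsCompl _ _ hV1 (a, b)) =
        Submodule.prodEquivOfIsCompl _ _ hV1 (⟨ρ g a, hk g a a.2⟩, ⟨ρ g b, hV1' g b b.2⟩) := by
      simp
    rw [hab, hE, hE, map_add, ← hf]
    congr 1
    exact congrArg Subtype.val (he2 g a)

end Representation

/-! ### Roots of unity, integrality and the Jacobson radical. -/

/-- In characteristic zero X^N - 1 is a product of pairwise coprime linear factors, one for each
N-th root of unity. -/
theorem Polynomial.X_pow_sub_one_dvd_of_eval {k : Type*} [Field k] [IsAlgClosed k] [CharZero k]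
    {N : ℕ} (hN : 0 < N) (F : Polynomial k) (hF : ∀ w : k, w ^ N = 1 → F.eval w = 0) :
    (X ^ N - 1 : Polynomial k) ∣ F := by
  have : NeZero (N : k) := ⟨Nat.cast_ne_zero.2 hN.ne'⟩
  obtain ⟨w, hw⟩ := HasEnoughRootsOfUnity.exists_primitiveRoot k N
  rw [X_pow_sub_one_eq_prod hN hw]
  refine Finset.prod_dvd_of_coprime ?_ fun z hz => ?_
  · intro x _ y _ hxy
    exact isCoprime_X_sub_C_of_isUnit_sub (sub_ne_zero.2 hxy).isUnit
  · rw [dvd_iff_isRoot]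
    exact hF z ((mem_nthRootsFinset hN _).1 hz)

/-- Integrality of characters. -/
theorem LinearMap.isIntegral_trace_of_pow_eq_one {k V : Type*} [Field k] [IsAlgClosed k]
    [AddCommGroup V] [Module k V] [FiniteDimensional k V] (f : Module.End k V) {N : ℕ}
    (hN : 0 < N) (hf : f ^ N = 1) : IsIntegral ℤ (LinearMap.trace k V f) := by
  rw [Module.End.trace_eq_sum_roots_charpoly_of_splits (IsAlgClosed.splits _)]
  refine IsIntegral.multiset_sum fun w hw => ?_
  have h1 := (Module.End.hasEigenvalue_iff_isRoot_charpoly f w).2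
    ((Polynomial.mem_roots (LinearMap.charpoly_monic f).ne_zero).1 hw)
  obtain ⟨v, hv⟩ := h1.exists_hasEigenvector
  have h2 := hv.pow_apply N
  rw [hf, Module.End.one_apply] at h2
  have h3 : w ^ N = 1 := by
    by_contra h
    have : (w ^ N - 1) • v = 0 := by rw [sub_smul, ← h2, one_smul, sub_self]
    exact hv.2 ((smul_eq_zero.1 this).resolve_left (sub_ne_zero.2 h))
  exact IsIntegral.of_pow hN (h3 ▸ isIntegral_one)

/-- A ring homomorphism with integral values in a field of characteristic zero is zero on the
Jacobson radical. -/
theorem RingHom.map_eq_zero_of_mem_jacobson {R k : Type*} [Ring R] [Field k] [CharZero k]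
    (φ : R →+* k) (hφ : ∀ x, _root_.IsIntegral ℤ (φ x)) {x : R} (hx : x ∈ Ring.jacobson R) :
    φ x = 0 := by
  by_contra h0
  -- As φ(x) ≠ 0, an integral polynomial annihilating it can be chosen with nonzero constant term.
  -- That term is then the value of φ at a multiple of x, so the radical contains an element whose
  -- value is a nonzero integer m.
  obtain ⟨P, hP, hP0⟩ : ∃ P : Polynomial ℤ, P.coeff 0 ≠ 0 ∧ Polynomial.aeval (φ x) P = 0 := by
    obtain ⟨P, hP, hP'⟩ := (hφ x).isAlgebraic.exists_nonzero_coeff_and_aeval_eq_zero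
      (mem_nonZeroDivisors_of_ne_zero h0)
    exact ⟨P, hP, hP'⟩
  have h1 : ∃ x' ∈ Ring.jacobson R, φ x' = P.coeff 0 := by
    refine ⟨-(Polynomial.aeval x P.divX * x), (Ring.jacobson R).neg_mem
      (Ideal.mul_mem_left _ _ hx), ?_⟩
    rw [← Polynomial.divX_mul_X_add P, map_add, map_mul, Polynomial.aeval_X,
      Polynomial.aeval_C] at hP0
    rw [map_neg, map_mul, neg_eq_iff_add_eq_zero, ← hP0]
    congr 2
    have := Polynomial.map_aeval_eq_aeval_map (ψ := φ) (φ := RingHom.id ℤ) (RingHom.ext_int _ _)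
      P.divX x
    rwa [Polynomial.map_id] at this
  obtain ⟨x', hx', hm⟩ := h1
  set m := P.coeff 0
  rw [← Ideal.jacobson_bot, Ideal.mem_jacobson_iff] at hx'
  -- Multiplying by m makes the relevant integer 1 + m² > 1, whatever the sign of m. Its inverse
  -- would be the value φ(z), an algebraic integer and hence, being rational, an integer.
  obtain ⟨z, hz⟩ := hx' m
  rw [Ideal.mem_bot] at hz
  have h2 := congrArg φ hz
  rw [map_sub, map_add, map_mul, map_mul, hm, map_one, map_zero, map_intCast] at h2
  have h3 : φ z * ((m * m + 1 : ℤ) : k) = 1 := by push_cast; linear_combination h2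
  have h4 : (algebraMap ℚ k) ((m * m + 1 : ℤ) : ℚ)⁻¹ = φ z := by
    rw [map_inv₀, map_intCast]; exact (eq_inv_of_mul_eq_one_left h3).symm
  have h5 : _root_.IsIntegral ℤ ((m * m + 1 : ℤ) : ℚ)⁻¹ := by
    rw [← isIntegral_algebraMap_iff (algebraMap ℚ k).injective (A := ℚ) (B := k), h4]
    exact hφ z
  obtain ⟨t, ht⟩ := IsIntegrallyClosed.isIntegral_iff.1 h5
  have hpos : 1 < m * m + 1 := by nlinarith [mul_self_pos.2 hP]
  have h6 : t * (m * m + 1) = 1 := by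
    have : ((m * m + 1 : ℤ) : ℚ) ≠ 0 := by exact_mod_cast (by omega)
    have h7 : (t : ℚ) * ((m * m + 1 : ℤ) : ℚ) = 1 := by
      rw [← eq_intCast (algebraMap ℤ ℚ) t, ht, inv_mul_cancel₀ this]
    exact_mod_cast h7
  have := Int.eq_one_or_neg_one_of_mul_eq_one' h6
  omega

/-! ### The modules V ⊗ M(j, 0) with y acting by zero on V. -/

namespace GroupDatum

/-- The vector `x ^ l` of `k ^ j`, which is zero for `j ≤ l`. -/
def xvec (k : Type u) [Field k] (j l : ℕ) : Fin j → k := fun i => if (i : ℕ) = l then 1 else 0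

theorem xvec_of_le {k : Type u} [Field k] {j l : ℕ} (h : j ≤ l) : xvec k j l = 0 :=
  funext fun i => if_neg (by omega)

theorem shift_xvec {k : Type u} [Field k] (j l : ℕ) :
    shift k j (xvec k j l) = xvec k j (l + 1) := by
  funext i
  change (if h : (i : ℕ) = 0 then 0 else xvec k j l ⟨i - 1, _⟩) = _
  by_cases h : (i : ℕ) = 0
  · simp [xvec, h]
  · rw [dif_neg h]
    simp only [xvec]
    congr 1
    exact propext ⟨fun _ => by omega, fun _ => by omega⟩

theorem tensor_xvec_ext {k V X : Type*} [Field k] [AddCommGroup V] [Module k V] [AddCommGroup X]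
    [Module k X] {j : ℕ} {f f' : V ⊗[k] (Fin j → k) →ₗ[k] X}
    (h : ∀ v, ∀ l < j, f (v ⊗ₜ xvec k j l) = f' (v ⊗ₜ xvec k j l)) : f = f' := by
  refine TensorProduct.ext (LinearMap.ext fun v => LinearMap.pi_ext fun i c => ?_)
  have h1 : (Pi.single i c : Fin j → k) = c • xvec k j i := by
    funext i'
    simp only [xvec, Pi.single_apply, Pi.smul_apply, smul_eq_mul, mul_ite, mul_one, mul_zero,
      Fin.ext_iff]
  rw [h1, map_smul, map_smul]
  exact congrArg _ (h v i i.2)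

variable {k : Type u} {G : Type v} [Field k] [Group G] (D : GroupDatum k G)

theorem map_ρ_of_generators {M N : FDModule k D.H} (f : M.V →ₗ[k] N.V)
    (hy : ∀ v, f (M.ρ D.y v) = N.ρ D.y (f v))
    (hof : ∀ h v, f (M.ρ (D.of h) v) = N.ρ (D.of h) (f v)) (a : D.H) (v : M.V) :
    f (M.ρ a v) = N.ρ a (f v) := by
  induction a using D.induction generalizing v with
  | hc c => simp [Module.algebraMap_end_apply]
  | hy => exact hy v
  | hof h => exact hof h v
  | hadd a b ha hb => simp [ha, hb]
  | hmul a b ha hb => simp [ha, hb]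

theorem invariant_of_generators {X : FDModule k D.H} (W : Submodule k X.V)
    (hy : ∀ v ∈ W, X.ρ D.y v ∈ W) (hof : ∀ h, ∀ v ∈ W, X.ρ (D.of h) v ∈ W) (a : D.H) :
    ∀ v ∈ W, X.ρ a v ∈ W := by
  induction a using D.induction with
  | hc c => intro v hv; simpa [Module.algebraMap_end_apply] using W.smul_mem c hv
  | hy => exact hy
  | hof h => exact hof h
  | hadd a b ha hb => intro v hv; simpa using W.add_mem (ha v hv) (hb v hv)
  | hmul a b ha hb => intro v hv; simpa using ha _ (hb v hv)

theorem ρ_y_of (X : FDModule k D.H) (h : G) (v : X.V) :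
    X.ρ D.y (X.ρ (D.of h) v) = (D.χ h : k) • X.ρ (D.of h) (X.ρ D.y v) := by
  have := congrArg (fun a => X.ρ a v) (D.y_mul h)
  simpa using this

theorem ρ_y_pow_of (X : FDModule k D.H) (h : G) (m : ℕ) (v : X.V) :
    (X.ρ D.y ^ m) (X.ρ (D.of h) v) = (D.χ h ^ m : kˣ) • X.ρ (D.of h) ((X.ρ D.y ^ m) v) := by
  induction m with
  | zero => simp
  | succ m ih =>
    rw [pow_succ', Module.End.mul_apply, ih, Units.smul_def, map_smul, ρ_y_of, smul_smul,
      Module.End.mul_apply, Units.smul_def]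
    simp [pow_succ]

theorem ρ_of_y_pow (X : FDModule k D.H) (h : G) (m : ℕ) (v : X.V) :
    X.ρ (D.of h) ((X.ρ D.y ^ m) v) =
      ((D.χ h)⁻¹ ^ m : kˣ) • (X.ρ D.y ^ m) (X.ρ (D.of h) v) := by
  rw [ρ_y_pow_of, smul_smul, inv_pow, inv_mul_cancel, one_smul]

theorem ρ_y_pow_n (X : FDModule k D.H) :
    X.ρ D.y ^ D.n = D.μ • (X.ρ (D.of (D.g ^ D.n)) - 1) := by
  rw [← map_pow, D.y_pow, map_smul, map_sub, map_one]

theorem uniserial_ρ_y (j : ℕ) (hj : j ≤ D.n) : (D.uniserial j hj).ρ D.y = shift k j := by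
  change D.uniserialHom j hj D.y = _
  rw [uniserialHom, lift_y]

theorem uniserial_ρ_of (j : ℕ) (hj : j ≤ D.n) (h : G) :
    (D.uniserial j hj).ρ (D.of h) = D.diagAct j h := by
  change D.uniserialHom j hj (D.of h) = _
  rw [uniserialHom, lift_of]

theorem diagAct_xvec (j l : ℕ) (h : G) :
    D.diagAct j h (xvec k j l) = ((D.χ h)⁻¹ ^ l : kˣ) • xvec k j l := by
  funext i
  change (((D.χ h)⁻¹ ^ (i : ℕ) : kˣ) : k) * (if (i : ℕ) = l then 1 else 0) =
    (((D.χ h)⁻¹ ^ l : kˣ) : k) * (if (i : ℕ) = l then 1 else 0)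
  split_ifs with h
  · rw [h]
  · simp

/-- The modules on which `y` acts by zero. -/
def IsInfl (V : FDModule k D.H) : Prop := V.ρ D.y = 0

variable {D} in
theorem IsInfl.directSum {V W : FDModule k D.H} (hV : D.IsInfl V) (hW : D.IsInfl W) :
    D.IsInfl (V.directSum W) := by
  refine LinearMap.ext fun v => ?_
  change (V.ρ D.y v.1, W.ρ D.y v.2) = 0
  rw [hV, hW]
  rfl

section Finite

variable [Finite G]

theorem tensor_ρ_y (M N : FDModule k D.H) :
    (M.tensor N).ρ D.y = (TensorProduct.map (M.ρ D.y) (N.ρ (D.of D.g)) +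
      TensorProduct.map LinearMap.id (N.ρ D.y) : M.V ⊗[k] N.V →ₗ[k] M.V ⊗[k] N.V) := by
  change FDModule.tensorAct M.ρ N.ρ (D.comulHom D.y) = _
  rw [comulHom_y, map_add]
  refine congrArg₂ _ rfl ?_
  refine TensorProduct.ext' fun v w => ?_
  simp

theorem tensor_ρ_of (M N : FDModule k D.H) (h : G) :
    (M.tensor N).ρ (D.of h) = (TensorProduct.map (M.ρ (D.of h)) (N.ρ (D.of h)) :
      M.V ⊗[k] N.V →ₗ[k] M.V ⊗[k] N.V) := by
  change FDModule.tensorAct M.ρ N.ρ (D.comulHom (D.of h)) = _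
  rw [comulHom_of]
  rfl

theorem charModule_ρ_y (ψ : G →* kˣ) (hψ) (v : k) : (D.charModule ψ hψ).ρ D.y v = (0 : k) := by
  change (Algebra.ofId k (Module.End k k)) (D.lift _ _ _ _ D.y) v = _
  rw [lift_y, map_zero, LinearMap.zero_apply]

theorem charModule_ρ_of (ψ : G →* kˣ) (hψ) (h : G) (v : k) :
    (D.charModule ψ hψ).ρ (D.of h) v = (ψ h : k) * v := by
  change (Algebra.ofId k (Module.End k k)) (D.lift _ _ _ _ (D.of h)) v = _
  rw [lift_of]
  rfl

theorem isInfl_charModule (ψ : G →* kˣ) (hψ) : D.IsInfl (D.charModule ψ hψ) :=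
  LinearMap.ext fun v => D.charModule_ρ_y ψ hψ v

variable {D} in
theorem IsInfl.tensor {V W : FDModule k D.H} (hV : D.IsInfl V) (hW : D.IsInfl W) :
    D.IsInfl (V.tensor W) := by
  rw [IsInfl, tensor_ρ_y, hV, hW]
  refine TensorProduct.ext' fun v w => ?_
  change (0 : V.V) ⊗ₜ[k] _ + v ⊗ₜ[k] (0 : W.V) = 0
  simp

variable {D} in
theorem IsInfl.tensor_ρ_y {V : FDModule k D.H} (hV : D.IsInfl V) (X : FDModule k D.H) :
    (V.tensor X).ρ D.y = (TensorProduct.map LinearMap.id (X.ρ D.y) :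
      V.V ⊗[k] X.V →ₗ[k] V.V ⊗[k] X.V) := by
  rw [GroupDatum.tensor_ρ_y, hV]
  refine TensorProduct.ext' fun v w => ?_
  change (0 : V.V) ⊗ₜ[k] _ + v ⊗ₜ[k] (X.ρ D.y w) = _
  simp

variable {D} in
theorem IsInfl.ρ_y_tmul_xvec {V : FDModule k D.H} (hV : D.IsInfl V) {j : ℕ} (hj : j ≤ D.n)
    (v : V.V) (l : ℕ) : (V.tensor (D.uniserial j hj)).ρ D.y (v ⊗ₜ[k] xvec k j l) =
      v ⊗ₜ[k] xvec k j (l + 1) := by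
  rw [hV.tensor_ρ_y, uniserial_ρ_y]
  change v ⊗ₜ[k] (shift k j (xvec k j l)) = _
  rw [shift_xvec]

theorem ρ_of_tmul_xvec (V : FDModule k D.H) {j : ℕ} (hj : j ≤ D.n) (h : G)
    (v : V.V) (l : ℕ) : (V.tensor (D.uniserial j hj)).ρ (D.of h) (v ⊗ₜ[k] xvec k j l) =
      ((D.χ h)⁻¹ ^ l : kˣ) • (V.ρ (D.of h) v ⊗ₜ[k] xvec k j l) := by
  rw [D.tensor_ρ_of, uniserial_ρ_of]
  change V.ρ (D.of h) v ⊗ₜ[k] (D.diagAct j h (xvec k j l)) = _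
  rw [diagAct_xvec, Units.smul_def, TensorProduct.tmul_smul, Units.smul_def]

variable {D} in
/-- Morphisms out of `V ⊗ M(j, 0)`. -/
theorem IsInfl.exists_hom {V : FDModule k D.H} (hV : D.IsInfl V) {j : ℕ} (hj : j ≤ D.n)
    (X : FDModule k D.H) (f : V.V →ₗ[k] X.V)
    (hf : ∀ h v, f (V.ρ (D.of h) v) = X.ρ (D.of h) (f v)) (hfj : ∀ v, (X.ρ D.y ^ j) (f v) = 0) :
    ∃ F : V.V ⊗[k] (Fin j → k) →ₗ[k] X.V,
      (∀ a z, F ((V.tensor (D.uniserial j hj)).ρ a z) = X.ρ a (F z)) ∧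
      ∀ v l, F (v ⊗ₜ xvec k j l) = (X.ρ D.y ^ l) (f v) := by
  -- The subspace V ⊗ 1 generates V ⊗ M(j, 0), and x^l = y^l · 1, so the only candidate is v ⊗ x^l ↦
  -- y^l f(v). The hypothesis y^j f(v) = 0 extends this formula to l ≥ j, where x^l = 0; that is
  -- what makes the map commute with y at the top degree.
  let F : V.V ⊗[k] (Fin j → k) →ₗ[k] X.V := TensorProduct.lift
    (LinearMap.mk₂ k (fun v w => ∑ i : Fin j, w i • (X.ρ D.y ^ (i : ℕ)) (f v))
      (by intro v v' w; simp [Finset.sum_add_distrib])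
      (by intro c v w; simp [Finset.smul_sum, smul_comm c])
      (by intro v w w'; simp [Finset.sum_add_distrib, add_smul])
      (by intro c v w; simp [Finset.smul_sum, mul_smul]))
  have hF : ∀ v l, F (v ⊗ₜ xvec k j l) = (X.ρ D.y ^ l) (f v) := by
    intro v l
    change ∑ i : Fin j, xvec k j l i • (X.ρ D.y ^ (i : ℕ)) (f v) = _
    rcases lt_or_ge l j with h | h
    · rw [Finset.sum_eq_single ⟨l, h⟩]
      · simp [xvec]
      · intro i _ hi
        rw [xvec, if_neg fun h => hi (Fin.ext h), zero_smul]
      · simp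
    · rw [xvec_of_le h, ← Nat.sub_add_cancel h, pow_add, Module.End.mul_apply, hfj]
      simp
  refine ⟨F, D.map_ρ_of_generators (M := V.tensor (D.uniserial j hj)) F ?_ ?_, hF⟩
  · intro z
    have : F ∘ₗ (V.tensor (D.uniserial j hj)).ρ D.y = X.ρ D.y ∘ₗ F := by
      refine tensor_xvec_ext fun v l _ => ?_
      change F ((V.tensor (D.uniserial j hj)).ρ D.y (v ⊗ₜ[k] xvec k j l)) = X.ρ D.y (F _)
      rw [hV.ρ_y_tmul_xvec, hF, hF, pow_succ', Module.End.mul_apply]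
    exact LinearMap.congr_fun this z
  · intro h z
    have : F ∘ₗ (V.tensor (D.uniserial j hj)).ρ (D.of h) = X.ρ (D.of h) ∘ₗ F := by
      refine tensor_xvec_ext fun v l _ => ?_
      change F ((V.tensor (D.uniserial j hj)).ρ (D.of h) (v ⊗ₜ[k] xvec k j l)) =
        X.ρ (D.of h) (F _)
      rw [ρ_of_tmul_xvec, hF, Units.smul_def, map_smul, hF, hf, ρ_of_y_pow, Units.smul_def]
    exact LinearMap.congr_fun this z

variable {D} in
/-- A morphism out of `V ⊗ M(j, 0)` is injective if it is so on the socle. -/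
theorem IsInfl.injective_hom {V : FDModule k D.H} (hV : D.IsInfl V) {j : ℕ} (hj : j ≤ D.n)
    (X : FDModule k D.H) (F : V.V ⊗[k] (Fin j → k) →ₗ[k] X.V)
    (hF : ∀ a z, F ((V.tensor (D.uniserial j hj)).ρ a z) = X.ρ a (F z))
    (hF' : ∀ v, F (v ⊗ₜ xvec k j (j - 1)) = 0 → v = 0) : Function.Injective F := by
  -- For j = 0 the truncated index j - 1 does not point to a socle vector; the source is zero then.
  rcases Nat.eq_zero_or_pos j with rfl | hj0
  · intro z z' _
    have : (LinearMap.id : V.V ⊗[k] (Fin 0 → k) →ₗ[k] _) = 0 :=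
      tensor_xvec_ext fun v l hl => absurd hl (by omega)
    rw [← LinearMap.id_apply (R := k) z, ← LinearMap.id_apply (R := k) z', this]; rfl
  let Y : V.V ⊗[k] (Fin j → k) →ₗ[k] V.V ⊗[k] (Fin j → k) :=
    TensorProduct.map LinearMap.id (shift k j)
  have hY : (V.tensor (D.uniserial j hj)).ρ D.y = Y := by
    rw [hV.tensor_ρ_y, uniserial_ρ_y]; rfl
  let c := TensorProduct.piScalarRight k k V.V (Fin j)
  have hc : ∀ z (i : Fin j) (hi : (i : ℕ) + 1 < j), c (Y z) ⟨i + 1, hi⟩ = c z i := by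
    intro z i hi
    have : (LinearMap.proj ⟨i + 1, hi⟩ ∘ₗ c.toLinearMap ∘ₗ Y) =
        (LinearMap.proj i ∘ₗ c.toLinearMap) := by
      refine tensor_xvec_ext fun v l _ => ?_
      change c (v ⊗ₜ[k] (shift k j (xvec k j l))) ⟨i + 1, hi⟩ = c (v ⊗ₜ[k] xvec k j l) i
      rw [shift_xvec]
      simp [c, xvec]
    exact LinearMap.congr_fun this z
  have hker : ∀ z, Y z = 0 → ∃ v, z = v ⊗ₜ xvec k j (j - 1) := by
    intro z hz
    refine ⟨c z ⟨j - 1, by omega⟩, c.injective (funext fun i => ?_)⟩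
    by_cases hi : (i : ℕ) + 1 < j
    · rw [← hc z i hi, hz]
      have : (i : ℕ) ≠ j - 1 := by omega
      simp [c, xvec, this]
    · have : i = ⟨j - 1, by omega⟩ := Fin.ext (by simp; omega)
      rw [this]
      simp [c, xvec]
  have hnil : ∀ z, (Y ^ j) z = 0 := by
    intro z
    have h1 : ∀ m v l, (Y ^ m) (v ⊗ₜ xvec k j l) = v ⊗ₜ xvec k j (l + m) := by
      intro m v l
      induction m with
      | zero => simp
      | succ m ih =>
        rw [pow_succ', Module.End.mul_apply, ih]
        change v ⊗ₜ[k] shift k j _ = _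
        rw [shift_xvec, add_assoc]
    have : Y ^ j = 0 := tensor_xvec_ext fun v l _ => by
      rw [h1, xvec_of_le (by omega)]; simp
    rw [this]; rfl
  have hFY : ∀ m z, F z = 0 → F ((Y ^ m) z) = 0 := by
    intro m z hz
    induction m with
    | zero => simpa using hz
    | succ m ih =>
      have := hF D.y ((Y ^ m) z)
      rw [hY, ih, map_zero] at this
      rw [pow_succ', Module.End.mul_apply]
      exact this
  rw [injective_iff_map_eq_zero]
  intro z hz
  -- Descent along the powers of y: the last nonzero Y^m z would lie in ker Y, which is V ⊗ x^(j-1),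
  -- and in ker F; the hypothesis on the socle excludes this.
  have key : ∀ m, (Y ^ m) z = 0 → z = 0 := by
    intro m
    induction m with
    | zero => simp
    | succ m ih =>
      intro hm
      rw [pow_succ', Module.End.mul_apply] at hm
      obtain ⟨v, hv⟩ := hker _ hm
      apply ih
      have := hFY m z hz
      rw [hv] at this ⊢
      rw [hF' v this, TensorProduct.zero_tmul]
  exact key j (hnil z)

end Finite

end GroupDatum

theorem FDModule.iso_of_injective {k : Type u} {A : Type v} [Field k] [Ring A] [Algebra k A]
    {M N : FDModule k A} (f : M.V →ₗ[k] N.V) (hf : ∀ a v, f (M.ρ a v) = N.ρ a (f v))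
    (hi : Function.Injective f) (h : Module.finrank k M.V = Module.finrank k N.V) : M.Iso N :=
  ⟨LinearEquiv.ofInjectiveOfFinrankEq f hi h, fun a v => hf a v⟩

/-! ### Products with M(2, 0). -/

namespace GroupDatum

section Two

variable {k : Type u} {G : Type v} [Field k] [Group G] (D : GroupDatum k G) {j : ℕ}

/-- The action of `y` on `M(2, 0) ⊗ M(j, 0)`. -/
noncomputable def twoTensorY (j : ℕ) : Module.End k ((Fin 2 → k) ⊗[k] (Fin j → k)) :=
  TensorProduct.map (shift k 2) (D.diagAct j D.g) + TensorProduct.map LinearMap.id (shift k j)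

theorem twoTensorY_zero (m : ℕ) : D.twoTensorY j (xvec k 2 0 ⊗ₜ xvec k j m) =
    ((D.χ D.g : k)⁻¹ ^ m) • (xvec k 2 1 ⊗ₜ[k] xvec k j m) + xvec k 2 0 ⊗ₜ xvec k j (m + 1) := by
  rw [twoTensorY, LinearMap.add_apply, TensorProduct.map_tmul, TensorProduct.map_tmul, shift_xvec,
    shift_xvec, diagAct_xvec, Units.smul_def, TensorProduct.tmul_smul]
  simp

theorem twoTensorY_one (m : ℕ) : D.twoTensorY j (xvec k 2 1 ⊗ₜ xvec k j m) =
    xvec k 2 1 ⊗ₜ xvec k j (m + 1) := by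
  rw [twoTensorY, LinearMap.add_apply, TensorProduct.map_tmul, TensorProduct.map_tmul, shift_xvec,
    shift_xvec, xvec_of_le le_rfl, TensorProduct.zero_tmul, zero_add]
  rfl

theorem twoTensorY_pow_one (d m : ℕ) : (D.twoTensorY j ^ d) (xvec k 2 1 ⊗ₜ xvec k j m) =
    xvec k 2 1 ⊗ₜ xvec k j (m + d) := by
  induction d with
  | zero => simp
  | succ d ih => rw [pow_succ', Module.End.mul_apply, ih, twoTensorY_one, add_assoc]

/-- The factors q^(-m) picked up at each step add up to a geometric sum in q⁻¹. Whether the full sum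
of length j vanishes decides between the cases j < n and j = n of the product with M(2, 0). -/
theorem twoTensorY_pow_zero (d : ℕ) : (D.twoTensorY j ^ d) (xvec k 2 0 ⊗ₜ xvec k j 1) =
    xvec k 2 0 ⊗ₜ xvec k j (d + 1) + ((D.χ D.g : k)⁻¹ *
      ∑ i ∈ Finset.range d, (D.χ D.g : k)⁻¹ ^ i) • (xvec k 2 1 ⊗ₜ xvec k j d) := by
  induction d with
  | zero => simp
  | succ d ih =>
    rw [pow_succ', Module.End.mul_apply, ih, map_add, twoTensorY_zero, map_smul, twoTensorY_one,
      Finset.sum_range_succ, mul_add, add_smul, ← pow_succ']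
    abel

/-- Applying y to x ⊗ x^m gives x ⊗ x^(m+1), and applying y to 1 ⊗ x^m gives 1 ⊗ x^(m+1) up to a
multiple of x ⊗ x^m. So both families lie in W by induction on m. -/
theorem span_twoTensor (W : Submodule k ((Fin 2 → k) ⊗[k] (Fin j → k)))
    (h0 : xvec k 2 0 ⊗ₜ xvec k j 0 ∈ W) (h1 : xvec k 2 1 ⊗ₜ xvec k j 0 ∈ W)
    (hW : ∀ x ∈ W, D.twoTensorY j x ∈ W) : W = ⊤ := by
  have hB : ∀ m, xvec k 2 1 ⊗ₜ xvec k j m ∈ W := by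
    intro m
    induction m with
    | zero => exact h1
    | succ m ih => rw [← D.twoTensorY_one]; exact hW _ ih
  have hA : ∀ m, xvec k 2 0 ⊗ₜ xvec k j m ∈ W := by
    intro m
    induction m with
    | zero => exact h0
    | succ m ih =>
      have := W.sub_mem (hW _ ih) (W.smul_mem ((D.χ D.g : k)⁻¹ ^ m) (hB m))
      rwa [D.twoTensorY_zero, add_sub_cancel_left] at this
  have : W.mkQ = 0 := by
    refine tensor_xvec_ext fun v l _ => ?_
    have hv : v = v 0 • xvec k 2 0 + v 1 • xvec k 2 1 := by
      funext i
      fin_cases i <;> simp [xvec]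
    rw [LinearMap.zero_apply, Submodule.mkQ_apply, Submodule.Quotient.mk_eq_zero, hv,
      TensorProduct.add_tmul, ← TensorProduct.smul_tmul', ← TensorProduct.smul_tmul']
    exact W.add_mem (W.smul_mem _ (hA l)) (W.smul_mem _ (hB l))
  rw [← W.ker_mkQ, this, LinearMap.ker_zero]

end Two

variable {k : Type u} {G : Type v} [Field k] [Group G] [Finite G] (D : GroupDatum k G)

/-- The class of `M(j, 0)` in the Green ring. -/
noncomputable def uniserialClass (j : ℕ) : GreenRing k D.H :=
  if hj : j ≤ D.n then greenClass (D.uniserial j hj) else 0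

theorem uniserialClass_of_le {j : ℕ} (hj : j ≤ D.n) :
    D.uniserialClass j = greenClass (D.uniserial j hj) := dif_pos hj

/-- The class of the one-dimensional module on which `G` acts by the inverse of `χ`. -/
noncomputable def charClass : GreenRing k D.H :=
  greenClass (D.charModule D.χ⁻¹ D.inv_χ_g_pow_n)

theorem isInfl_trivial : D.IsInfl (FDModule.trivial k D.H) := by
  refine LinearMap.ext fun v => ?_
  change (Algebra.ofId k (Module.End k k)) (D.counitHom D.y) v = _
  rw [counitHom_y, map_zero]
  rfl

theorem trivial_ρ_of (h : G) (v : k) : (FDModule.trivial k D.H).ρ (D.of h) v = v := by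
  change (Algebra.ofId k (Module.End k k)) (D.counitHom (D.of h)) v = _
  rw [counitHom_of, map_one]
  rfl

theorem uniserialClass_zero : D.uniserialClass 0 = 0 := by
  rw [D.uniserialClass_of_le (Nat.zero_le _)]
  have h := greenClass_directSum (D.uniserial 0 (Nat.zero_le _)) (D.uniserial 0 (Nat.zero_le _))
  rw [greenClass_congr (N := D.uniserial 0 (Nat.zero_le _))] at h
  · exact left_eq_add.1 h
  · have hs : ∀ x y : (Fin 0 → k), x = y := fun x y => Subsingleton.elim x y
    have hs2 : ∀ x y : (Fin 0 → k) × (Fin 0 → k), x = y := fun x y => Subsingleton.elim x y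
    refine ⟨(LinearEquiv.prodUnique : ((Fin 0 → k) × (Fin 0 → k)) ≃ₗ[k] (Fin 0 → k)), ?_⟩
    intro a v
    exact hs _ _

theorem uniserialClass_one (hn : 1 ≤ D.n) : D.uniserialClass 1 = 1 := by
  rw [D.uniserialClass_of_le hn, ← greenClass_trivial]
  have hx : ∀ v : Fin 1 → k, v = v 0 • xvec k 1 0 := fun v => by
    funext i
    rw [Subsingleton.elim i 0]
    simp [xvec]
  refine greenClass_congr ⟨LinearEquiv.funUnique (Fin 1) k k,
    D.map_ρ_of_generators (M := D.uniserial 1 hn) (N := FDModule.trivial k D.H)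
      (LinearEquiv.funUnique (Fin 1) k k).toLinearMap ?_ ?_⟩
  · intro v
    rw [D.isInfl_trivial, uniserial_ρ_y]
    rfl
  · intro h (v : Fin 1 → k)
    refine Eq.trans ?_ (D.trivial_ρ_of h _).symm
    rw [uniserial_ρ_of]
    have h1 : D.diagAct 1 h v = v := by
      rw [hx v, map_smul, diagAct_xvec, pow_zero, one_smul]
    exact congrArg (LinearEquiv.funUnique (Fin 1) k k) h1

variable {D} in
-- On M(j, 0) ⊗ V the element y acts as the shift tensored with g, so the morphism extending v ↦ 1 ⊗
-- v is v ⊗ x^l ↦ x^l ⊗ g^l v. It is injective on the socle because g is invertible.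
theorem IsInfl.tensor_uniserial_comm {V : FDModule k D.H} (hV : D.IsInfl V) {j : ℕ}
    (hj : j ≤ D.n) (hj0 : 0 < j) :
    (V.tensor (D.uniserial j hj)).Iso ((D.uniserial j hj).tensor V) := by
  let Y : Module.End k ((Fin j → k) ⊗[k] V.V) :=
    TensorProduct.map (shift k j) (V.ρ (D.of D.g))
  have hY : ((D.uniserial j hj).tensor V).ρ D.y = Y := by
    rw [GroupDatum.tensor_ρ_y, hV, uniserial_ρ_y]
    refine TensorProduct.ext' fun (w : Fin j → k) v => ?_
    change shift k j w ⊗ₜ[k] V.ρ (D.of D.g) v + w ⊗ₜ[k] (0 : V.V) = _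
    rw [TensorProduct.tmul_zero, add_zero]
    rfl
  have hyp : ∀ l v, (Y ^ l) (xvec k j 0 ⊗ₜ[k] v) =
      xvec k j l ⊗ₜ[k] V.ρ (D.of (D.g ^ l)) v := by
    intro l v
    induction l with
    | zero => rw [pow_zero, pow_zero, map_one, map_one]; rfl
    | succ l ih =>
      rw [pow_succ', Module.End.mul_apply, ih, pow_succ', map_mul, map_mul, TensorProduct.map_tmul,
        shift_xvec]
      rfl
  obtain ⟨F, hF, hF'⟩ := hV.exists_hom hj ((D.uniserial j hj).tensor V)
    (TensorProduct.mk k (Fin j → k) V.V (xvec k j 0)) (by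
      intro h v
      rw [D.tensor_ρ_of, uniserial_ρ_of]
      change _ = (D.diagAct j h (xvec k j 0)) ⊗ₜ[k] _
      rw [diagAct_xvec, pow_zero, one_smul]
      rfl) (by
      intro v
      rw [hY]
      refine (hyp j v).trans ?_
      rw [xvec_of_le le_rfl, TensorProduct.zero_tmul]
      rfl)
  refine FDModule.iso_of_injective (M := V.tensor (D.uniserial j hj)) F hF
    (hV.injective_hom hj _ F hF fun v hv => ?_) ?_
  · rw [hY] at hF'
    have h1 : xvec k j (j - 1) ⊗ₜ[k] V.ρ (D.of (D.g ^ (j - 1))) v = 0 :=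
      (hyp (j - 1) v).symm.trans ((hF' v (j - 1)).symm.trans hv)
    have h2 := congrArg (fun z => TensorProduct.lid k V.V (TensorProduct.map
      (LinearMap.proj (R := k) (φ := fun _ => k) (⟨j - 1, by omega⟩ : Fin j))
      LinearMap.id z)) h1
    simp only [TensorProduct.map_tmul, TensorProduct.lid_tmul, LinearMap.proj_apply, xvec,
      if_true, one_smul, LinearMap.id_apply, map_zero] at h2
    have h3 := congrArg (V.ρ (D.of (D.g ^ (j - 1))⁻¹)) h2
    rw [← Module.End.mul_apply, ← map_mul, ← map_mul, inv_mul_cancel, map_one, map_one,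
      map_zero] at h3
    exact h3
  · change Module.finrank k (V.V ⊗[k] (Fin j → k)) = Module.finrank k ((Fin j → k) ⊗[k] V.V)
    simp [mul_comm]

/-- A module of dimension `j₁ + j₂` generated by a `G`-invariant vector `w` with `y ^ j₁ w = 0` and
a vector `v` of weight `χ⁻¹` with `y ^ j₂ v = 0`. -/
theorem greenClass_eq_of_two_generators {j₁ j₂ : ℕ} (h₁ : j₁ ≤ D.n) (h₂ : j₂ ≤ D.n)
    (X : FDModule k D.H) (w v : X.V) (hw : ∀ h, X.ρ (D.of h) w = w)
    (hv : ∀ h, X.ρ (D.of h) v = ((D.χ h)⁻¹ : kˣ) • v) (hw' : (X.ρ D.y ^ j₁) w = 0)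
    (hv' : (X.ρ D.y ^ j₂) v = 0) (hdim : Module.finrank k X.V = j₁ + j₂)
    (hgen : ∀ W : Submodule k X.V, w ∈ W → v ∈ W → (∀ x ∈ W, X.ρ D.y x ∈ W) → W = ⊤) :
    greenClass X = D.uniserialClass j₁ + D.charClass * D.uniserialClass j₂ := by
  rw [D.uniserialClass_of_le h₁, D.uniserialClass_of_le h₂]
  have e1 : greenClass (D.uniserial j₁ h₁) =
      greenClass ((FDModule.trivial k D.H).tensor (D.uniserial j₁ h₁)) :=
    (greenClass_congr (FDModule.trivial_tensor _)).symm
  rw [e1, charClass, ← greenClass_tensor, ← greenClass_directSum]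
  obtain ⟨F₁, hF₁, hF₁'⟩ := D.isInfl_trivial.exists_hom h₁ X (LinearMap.toSpanSingleton k X.V w)
    (by
      intro h (c : k)
      refine (congrArg (LinearMap.toSpanSingleton k X.V w) (D.trivial_ρ_of h c)).trans ?_
      change c • w = X.ρ (D.of h) (c • w)
      rw [map_smul, hw])
    (by
      intro (c : k)
      change (X.ρ D.y ^ j₁) (c • w) = 0
      rw [map_smul, hw', smul_zero])
  obtain ⟨F₂, hF₂, hF₂'⟩ := (D.isInfl_charModule _ D.inv_χ_g_pow_n).exists_hom h₂ X
    (LinearMap.toSpanSingleton k X.V v)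
    (by
      intro h (c : k)
      refine (congrArg (LinearMap.toSpanSingleton k X.V v) (D.charModule_ρ_of _ _ h c)).trans ?_
      change (((D.χ h)⁻¹ : kˣ) * c : k) • v = X.ρ (D.of h) (c • v)
      rw [map_smul, hv, mul_comm, mul_smul, Units.smul_def])
    (by
      intro (c : k)
      change (X.ρ D.y ^ j₂) (c • v) = 0
      rw [map_smul, hv', smul_zero])
  symm
  refine greenClass_congr ?_
  -- The image of F is stable under y and contains both generators, so F is surjective; equality of
  -- dimensions makes it bijective.
  let F : ((k ⊗[k] (Fin j₁ → k)) × (k ⊗[k] (Fin j₂ → k))) →ₗ[k] X.V := F₁.coprod F₂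
  have hF : ∀ a z, F ((((FDModule.trivial k D.H).tensor (D.uniserial j₁ h₁)).directSum
      ((D.charModule D.χ⁻¹ D.inv_χ_g_pow_n).tensor (D.uniserial j₂ h₂))).ρ a z) =
        X.ρ a (F z) := by
    rintro a ⟨z, z'⟩
    exact (congrArg₂ (· + ·) (hF₁ a z) (hF₂ a z')).trans (map_add (X.ρ a) (F₁ z) (F₂ z')).symm
  have hd : Module.finrank k ((k ⊗[k] (Fin j₁ → k)) × (k ⊗[k] (Fin j₂ → k))) =
      Module.finrank k X.V := by
    rw [hdim]; simp
  refine FDModule.iso_of_injective (M := ((FDModule.trivial k D.H).tensor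
    (D.uniserial j₁ h₁)).directSum ((D.charModule D.χ⁻¹ D.inv_χ_g_pow_n).tensor
      (D.uniserial j₂ h₂))) F hF
    ((LinearMap.injective_iff_surjective_of_finrank_eq_finrank hd).2
      (LinearMap.range_eq_top.1 ?_)) hd
  refine hgen _ ?_ ?_ ?_
  · refine ⟨((1 : k) ⊗ₜ xvec k j₁ 0, 0), ?_⟩
    change F₁ _ + F₂ 0 = w
    rw [map_zero, add_zero]
    exact (hF₁' (1 : k) 0).trans (one_smul k w)
  · refine ⟨(0, (1 : k) ⊗ₜ xvec k j₂ 0), ?_⟩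
    change F₁ 0 + F₂ _ = v
    rw [map_zero, zero_add]
    exact (hF₂' (1 : k) 0).trans (one_smul k v)
  · rintro _ ⟨z, rfl⟩
    exact ⟨_, hF D.y z⟩

section Two

variable {j : ℕ}

theorem two_tensor_ρ_y (hn : 2 ≤ D.n) (hj : j ≤ D.n) :
    ((D.uniserial 2 hn).tensor (D.uniserial j hj)).ρ D.y = D.twoTensorY j := by
  rw [D.tensor_ρ_y, uniserial_ρ_y, uniserial_ρ_y, uniserial_ρ_of]
  rfl

theorem two_tensor_ρ_of (hn : 2 ≤ D.n) (hj : j ≤ D.n) (h : G) (l m : ℕ) :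
    ((D.uniserial 2 hn).tensor (D.uniserial j hj)).ρ (D.of h) (xvec k 2 l ⊗ₜ[k] xvec k j m) =
      ((D.χ h)⁻¹ ^ (l + m) : kˣ) • (xvec k 2 l ⊗ₜ[k] xvec k j m) := by
  rw [D.tensor_ρ_of, uniserial_ρ_of, uniserial_ρ_of]
  change D.diagAct 2 h (xvec k 2 l) ⊗ₜ[k] D.diagAct j h (xvec k j m) = _
  rw [diagAct_xvec, diagAct_xvec, Units.smul_def, Units.smul_def, Units.smul_def,
    TensorProduct.smul_tmul_smul]
  congr 1
  rw [pow_add]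
  rfl

/-- A Clebsch–Gordan rule: the vector 1 ⊗ 1 generates a block of length j + 1, and a correction of 1
⊗ x by a multiple of x ⊗ 1 generates a block of length j - 1 with top weight χ⁻¹. -/
theorem uniserialClass_two_mul (hn : 2 ≤ D.n) (hj : 1 ≤ j) (hj' : j < D.n) :
    D.uniserialClass 2 * D.uniserialClass j =
      D.uniserialClass (j + 1) + D.charClass * D.uniserialClass (j - 1) := by
  rw [D.uniserialClass_of_le hn, D.uniserialClass_of_le hj'.le, ← greenClass_tensor]
  set x := (D.χ D.g : k)⁻¹ with hx
  have hx1 : ∀ i, 0 < i → i < D.n → x ^ i ≠ 1 := by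
    intro i h0 h1 h
    refine D.isPrimitiveRoot.pow_ne_one_of_pos_of_lt h0.ne' h1 ?_
    rw [hx, inv_pow, inv_eq_one] at h
    exact h
  have hsum : ∑ i ∈ Finset.range j, x ^ i ≠ 0 := by
    intro h
    have := geom_sum_mul x j
    rw [h, zero_mul] at this
    exact hx1 j hj hj' (sub_eq_zero.1 this.symm)
  obtain ⟨m, rfl⟩ : ∃ m, j = m + 1 := ⟨j - 1, by omega⟩
  -- The coefficient is the one that makes y^(j-1) kill the second generator. Then y(1 ⊗ 1) minus
  -- that generator is (1 + q⁻¹ + ⋯ + q^(-(j-1))) x ⊗ 1, and this sum is nonzero because j < n; so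
  -- the two generators produce everything. For j = 1 the second generator is 0 and the second block
  -- is zero.
  refine D.greenClass_eq_of_two_generators (j₁ := m + 1 + 1) (j₂ := m) (by omega) (by omega)
    ((D.uniserial 2 hn).tensor (D.uniserial (m + 1) hj'.le))
    (xvec k 2 0 ⊗ₜ[k] xvec k (m + 1) 0)
    (xvec k 2 0 ⊗ₜ[k] xvec k (m + 1) 1 -
      (x * ∑ i ∈ Finset.range m, x ^ i) • (xvec k 2 1 ⊗ₜ[k] xvec k (m + 1) 0)) ?_ ?_ ?_ ?_ ?_ ?_
  · intro h
    refine (D.two_tensor_ρ_of hn hj'.le h 0 0).trans ?_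
    rw [pow_zero, one_smul]
    rfl
  · intro h
    refine (map_sub _ _ _).trans ?_
    refine (congrArg₂ (· - ·) (D.two_tensor_ρ_of hn hj'.le h 0 1)
      ((map_smul _ _ _).trans (congrArg _ (D.two_tensor_ρ_of hn hj'.le h 1 0)))).trans ?_
    change ((D.χ h)⁻¹ ^ 1 : kˣ) • (xvec k 2 0 ⊗ₜ[k] xvec k (m + 1) 1) -
      (x * ∑ i ∈ Finset.range m, x ^ i) •
        (((D.χ h)⁻¹ ^ 1 : kˣ) • (xvec k 2 1 ⊗ₜ[k] xvec k (m + 1) 0)) = _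
    rw [pow_one, smul_comm]
    exact (smul_sub ((D.χ h)⁻¹ : kˣ) (xvec k 2 0 ⊗ₜ[k] xvec k (m + 1) 1) _).symm
  · rw [D.two_tensor_ρ_y hn hj'.le]
    change (D.twoTensorY (m + 1) ^ (m + 1 + 1)) (xvec k 2 0 ⊗ₜ[k] xvec k (m + 1) 0) = 0
    rw [pow_succ, Module.End.mul_apply, twoTensorY_zero, map_add, map_smul, twoTensorY_pow_one,
      twoTensorY_pow_zero, xvec_of_le (show m + 1 ≤ 0 + (m + 1) by omega), xvec_of_le le_rfl,
      xvec_of_le (show m + 1 ≤ m + 1 + 1 by omega)]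
    simp
  · rw [D.two_tensor_ρ_y hn hj'.le]
    change (D.twoTensorY (m + 1) ^ m) (_ - _) = 0
    rw [map_sub, map_smul, twoTensorY_pow_one, twoTensorY_pow_zero, xvec_of_le le_rfl, zero_add,
      ← hx]
    simp
  · change Module.finrank k ((Fin 2 → k) ⊗[k] (Fin (m + 1) → k)) = _
    rw [Module.finrank_tensorProduct]
    simp
    omega
  · intro W hw hv hW
    rw [D.two_tensor_ρ_y hn hj'.le] at hW
    refine D.span_twoTensor W hw ?_ hW
    have h1 := W.sub_mem (hW _ hw) hv
    have h2 : D.twoTensorY (m + 1) (xvec k 2 0 ⊗ₜ[k] xvec k (m + 1) 0) -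
        (xvec k 2 0 ⊗ₜ[k] xvec k (m + 1) 1 -
          (x * ∑ i ∈ Finset.range m, x ^ i) • (xvec k 2 1 ⊗ₜ[k] xvec k (m + 1) 0)) =
        (∑ i ∈ Finset.range (m + 1), x ^ i) • (xvec k 2 1 ⊗ₜ[k] xvec k (m + 1) 0) := by
      rw [twoTensorY_zero, geom_sum_succ, add_smul]
      simp
      abel
    have h3 : (∑ i ∈ Finset.range (m + 1), x ^ i) •
        (xvec k 2 1 ⊗ₜ[k] xvec k (m + 1) 0) ∈ W := h2 ▸ h1
    exact (W.smul_mem_iff hsum).1 h3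

/-- For j = n the geometric sum 1 + q⁻¹ + ⋯ + q^(-(n-1)) vanishes, so y^n already kills 1 ⊗ 1. The
generators 1 ⊗ 1 and x ⊗ 1 give two blocks of length n. -/
theorem uniserialClass_two_mul_n (hn : 2 ≤ D.n) :
    D.uniserialClass 2 * D.uniserialClass D.n =
      D.uniserialClass D.n + D.charClass * D.uniserialClass D.n := by
  conv_lhs => rw [D.uniserialClass_of_le hn, D.uniserialClass_of_le le_rfl, ← greenClass_tensor]
  set x := (D.χ D.g : k)⁻¹ with hx
  have hsum : ∑ i ∈ Finset.range D.n, x ^ i = 0 :=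
    (D.isPrimitiveRoot.inv).geom_sum_eq_zero (by omega)
  obtain ⟨m, hm⟩ : ∃ m, D.n = m + 1 := ⟨D.n - 1, by omega⟩
  refine D.greenClass_eq_of_two_generators le_rfl le_rfl
    ((D.uniserial 2 hn).tensor (D.uniserial D.n le_rfl))
    (xvec k 2 0 ⊗ₜ[k] xvec k D.n 0) (xvec k 2 1 ⊗ₜ[k] xvec k D.n 0) ?_ ?_ ?_ ?_ ?_ ?_
  · intro h
    refine (D.two_tensor_ρ_of hn le_rfl h 0 0).trans ?_
    rw [pow_zero, one_smul]
    rfl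
  · intro h
    refine (D.two_tensor_ρ_of hn le_rfl h 1 0).trans ?_
    rw [add_zero, pow_one]
    rfl
  · rw [D.two_tensor_ρ_y hn le_rfl]
    change (D.twoTensorY D.n ^ D.n) (xvec k 2 0 ⊗ₜ[k] xvec k D.n 0) = 0
    have : D.twoTensorY D.n ^ D.n = D.twoTensorY D.n ^ (m + 1) := by rw [hm]
    rw [this, pow_succ, Module.End.mul_apply, twoTensorY_zero, map_add, map_smul,
      twoTensorY_pow_one, twoTensorY_pow_zero, ← hx, xvec_of_le hm.le, TensorProduct.tmul_zero,
      zero_add, zero_add, pow_zero, ← add_smul, add_comm, ← geom_sum_succ, ← hm, hsum, zero_smul]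
  · rw [D.two_tensor_ρ_y hn le_rfl]
    change (D.twoTensorY D.n ^ D.n) (xvec k 2 1 ⊗ₜ[k] xvec k D.n 0) = 0
    rw [twoTensorY_pow_one, zero_add, xvec_of_le (j := D.n) le_rfl, TensorProduct.tmul_zero]
  · change Module.finrank k ((Fin 2 → k) ⊗[k] (Fin D.n → k)) = _
    rw [Module.finrank_tensorProduct]
    simp
    omega
  · intro W hw hv hW
    rw [D.two_tensor_ρ_y hn le_rfl] at hW
    exact D.span_twoTensor W hw hv hW

end Two

end GroupDatum

/-! ### Decomposition of modules into Jordan blocks and a part on which y is bijective. -/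

/-- An automorphism of finite order in characteristic zero is diagonalizable. -/
theorem Module.End.isCompl_ker_range_of_pow_eq_one {k V : Type*} [Field k] [CharZero k]
    [AddCommGroup V] [Module k V] [FiniteDimensional k V] (t : Module.End k V) {N : ℕ}
    (hN : 0 < N) (ht : t ^ N = 1) (c : k) :
    IsCompl (LinearMap.ker (t - algebraMap k _ c)) (LinearMap.range (t - algebraMap k _ c)) := by
  rw [Submodule.isCompl_iff_disjoint _ _ (by rw [add_comm, LinearMap.finrank_range_add_finrank_ker]),
    Submodule.disjoint_def]
  rintro w hw ⟨x, hx⟩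
  have hw' : t w = c • w := by
    simpa [sub_eq_zero, Module.algebraMap_end_apply] using hw
  have hx' : t x = c • x + w := by
    rw [← hx]; simp [Module.algebraMap_end_apply]
  have h1 : ∀ m, (t ^ m) w = c ^ m • w := by
    intro m
    induction m with
    | zero => simp
    | succ m ih => rw [pow_succ', Module.End.mul_apply, ih, map_smul, hw', smul_smul, pow_succ]
  -- A nontrivial Jordan block tx = cx + w would give t^N x = c^N x + N c^(N-1) w; in characteristic
  -- zero this contradicts t^N = 1.
  have h2 : ∀ m, (t ^ (m + 1)) x = c ^ (m + 1) • x + ((m + 1 : ℕ) * c ^ m) • w := by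
    intro m
    induction m with
    | zero => simp [hx']
    | succ m ih =>
      rw [pow_succ', Module.End.mul_apply, ih, map_add, map_smul, map_smul, hw', hx', smul_add,
        smul_smul, smul_smul, add_assoc, ← add_smul]
      congr 2 <;> push_cast <;> ring
  obtain ⟨m, rfl⟩ : ∃ m, N = m + 1 := ⟨N - 1, by omega⟩
  have h3 := h1 (m + 1)
  have h4 := h2 m
  rw [ht, Module.End.one_apply] at h3 h4
  by_contra hw0
  have h5 : c ^ (m + 1) = 1 := by
    by_contra h
    have : (c ^ (m + 1) - 1) • w = 0 := by rw [sub_smul, ← h3, one_smul, sub_self]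
    exact hw0 ((smul_eq_zero.1 this).resolve_left (sub_ne_zero.2 h))
  rw [h5, one_smul, left_eq_add, smul_eq_zero, mul_eq_zero] at h4
  rcases h4 with (h4 | h4) | h4
  · exact absurd h4 (Nat.cast_ne_zero.2 (by omega))
  · rw [pow_succ, h4, zero_mul] at h5; exact zero_ne_one h5
  · exact hw0 h4

namespace GroupDatum

variable {k : Type u} {G : Type v} [Field k] [Group G] (D : GroupDatum k G)

theorem ρ_of_pow_card (X : FDModule k D.H) (h : G) : X.ρ (D.of h) ^ Nat.card G = 1 := by
  rw [← map_pow, ← map_pow, pow_card_eq_one', map_one, map_one]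

theorem ρ_g_pow_n_of_nilpotent (hμ : D.μ ≠ 0) (X : FDModule k D.H) (h : X.ρ D.y ^ D.n = 0) :
    X.ρ (D.of (D.g ^ D.n)) = 1 := by
  rw [D.ρ_y_pow_n, smul_eq_zero] at h
  exact sub_eq_zero.1 (h.resolve_left hμ)

theorem g_pow_n_comm (h : G) : h * D.g ^ D.n = D.g ^ D.n * h :=
  ((Commute.pow_right (D.commute_g h) D.n : Commute h (D.g ^ D.n))).eq

/-- Moving g^n past y costs χ(g)^n = 1, so g^n is central in H and its eigenspaces are submodules.
-/
theorem ρ_y_g_pow_n (X : FDModule k D.H) (v : X.V) :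
    X.ρ D.y (X.ρ (D.of (D.g ^ D.n)) v) = X.ρ (D.of (D.g ^ D.n)) (X.ρ D.y v) := by
  rw [ρ_y_of, map_pow]
  have : D.χ D.g ^ D.n = 1 := pow_orderOf_eq_one _
  rw [this, Units.val_one, one_smul]

variable [Finite G]

/-- The splitting off of an eigenspace of a central element of `G` whose action commutes with that
of `y`. -/
theorem exists_eigenspace_decomposition [CharZero k] (X : FDModule k D.H) (z : G)
    (hz : ∀ h, h * z = z * h) (hzy : ∀ v, X.ρ D.y (X.ρ (D.of z) v) = X.ρ (D.of z) (X.ρ D.y v))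
    (c : k) : ∃ (Y Z : FDModule k D.H) (i : Y.V →ₗ[k] X.V) (j : Z.V →ₗ[k] X.V),
      (Y.directSum Z).Iso X ∧ (∀ a v, i (Y.ρ a v) = X.ρ a (i v)) ∧
      (∀ a v, j (Z.ρ a v) = X.ρ a (j v)) ∧ Function.Injective i ∧ Function.Injective j ∧
      LinearMap.range i = LinearMap.ker (X.ρ (D.of z) - algebraMap k _ c) ∧
      (∀ v, Z.ρ (D.of z) v = c • v → v = 0) := by
  have hc := (X.ρ (D.of z)).isCompl_ker_range_of_pow_eq_one Nat.card_pos (D.ρ_of_pow_card X z) c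
  set t := X.ρ (D.of z) - algebraMap k (Module.End k X.V) c with ht
  have hty : ∀ v, X.ρ D.y (t v) = t (X.ρ D.y v) := fun v => by
    simp [ht, hzy, Module.algebraMap_end_apply]
  have hth : ∀ h v, X.ρ (D.of h) (t v) = t (X.ρ (D.of h) v) := fun h v => by
    have : X.ρ (D.of h) (X.ρ (D.of z) v) = X.ρ (D.of z) (X.ρ (D.of h) v) := by
      rw [← Module.End.mul_apply, ← Module.End.mul_apply, ← map_mul, ← map_mul, ← map_mul,
        ← map_mul, hz]
    simp [ht, this, Module.algebraMap_end_apply]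
  have hk := D.invariant_of_generators (X := X) (LinearMap.ker t)
    (fun v hv => by rw [LinearMap.mem_ker, ← hty, LinearMap.mem_ker.1 hv, map_zero])
    (fun h v hv => by rw [LinearMap.mem_ker, ← hth, LinearMap.mem_ker.1 hv, map_zero])
  have hr := D.invariant_of_generators (X := X) (LinearMap.range t)
    (by rintro _ ⟨v, rfl⟩; exact ⟨_, (hty v).symm⟩)
    (by rintro h _ ⟨v, rfl⟩; exact ⟨_, (hth h v).symm⟩)
  refine ⟨X.sub _ hk, X.sub _ hr, (LinearMap.ker t).subtype, (LinearMap.range t).subtype,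
    X.iso_directSum_sub hc hk hr, fun _ _ => rfl, fun _ _ => rfl, Subtype.val_injective,
    Subtype.val_injective, Submodule.range_subtype _, fun (v : LinearMap.range t) hv => ?_⟩
  have h1 : X.ρ (D.of z) (v : X.V) = c • (v : X.V) :=
    congrArg (LinearMap.range t).subtype hv
  have h2 : (v : X.V) ∈ LinearMap.ker t ⊓ LinearMap.range t :=
    ⟨by simp [ht, h1, Module.algebraMap_end_apply], v.2⟩
  rw [hc.inf_eq_bot] at h2
  exact Subtype.ext h2

/-- A representation of `G` that is trivial on `g ^ n`, as a module on which `y` acts by zero. -/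
noncomputable def inflation (V : Type u) [AddCommGroup V] [Module k V] [FiniteDimensional k V]
    (σ : Representation k G V) (h : σ (D.g ^ D.n) = 1) : FDModule k D.H where
  V := V
  ρ := D.lift σ 0 (by rw [zero_pow D.n_pos.ne', h, sub_self, smul_zero]) (by simp)

theorem isInfl_inflation (V : Type u) [AddCommGroup V] [Module k V] [FiniteDimensional k V]
    (σ : Representation k G V) (h : σ (D.g ^ D.n) = 1) : D.IsInfl (D.inflation V σ h) :=
  D.lift_y (B := Module.End k V) σ 0
    (by rw [zero_pow D.n_pos.ne', h, sub_self, smul_zero]) (by simp)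

theorem inflation_ρ_of (V : Type u) [AddCommGroup V] [Module k V] [FiniteDimensional k V]
    (σ : Representation k G V) (h : σ (D.g ^ D.n) = 1) (x : G) :
    (D.inflation V σ h).ρ (D.of x) = σ x :=
  D.lift_of (B := Module.End k V) σ 0
    (by rw [zero_pow D.n_pos.ne', h, sub_self, smul_zero]) (by simp) x

/-- The splitting off of a maximal Jordan block. -/
theorem exists_uniserial_summand [CharZero k] (hμ : D.μ ≠ 0) (X : FDModule k D.H)
    (h : X.ρ D.y ^ D.n = 0) [Nontrivial X.V] :
    ∃ (j : ℕ) (hj : j ≤ D.n) (V Z : FDModule k D.H), 1 ≤ j ∧ D.IsInfl V ∧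
      ((V.tensor (D.uniserial j hj)).directSum Z).Iso X ∧
      Module.finrank k Z.V < Module.finrank k X.V ∧ Z.ρ D.y ^ D.n = 0 := by
  classical
  have hex : ∃ j, X.ρ D.y ^ j = 0 := ⟨_, h⟩
  -- The nilpotency index j = m + 1 of y is the length of the longest blocks; all blocks of this
  -- length are split off at once.
  set j := Nat.find hex with hjdef
  have hj : X.ρ D.y ^ j = 0 := Nat.find_spec hex
  have hjn : j ≤ D.n := Nat.find_min' hex h
  obtain ⟨m, hm⟩ : ∃ m, j = m + 1 := by
    refine ⟨j - 1, ?_⟩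
    rcases Nat.eq_zero_or_pos j with h0 | h0
    · rw [h0, pow_zero] at hj
      exact absurd hj one_ne_zero
    · omega
  have hm' : X.ρ D.y ^ m ≠ 0 := Nat.find_min hex (by omega)
  let σ : Representation k G X.V := (X.ρ : D.H →* Module.End k X.V).comp D.of
  have hσ : ∀ x v, σ x v = X.ρ (D.of x) v := fun _ _ => rfl
  -- V is a G-stable space of tops of the longest blocks: y^m is injective on it, and y^m V consists
  -- of their socles.
  obtain ⟨V, hKV, hV⟩ := σ.exists_isCompl_invariant (LinearMap.ker (X.ρ D.y ^ m)) (by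
    intro x v hv
    rw [LinearMap.mem_ker, hσ, D.ρ_y_pow_of, LinearMap.mem_ker.1 hv, map_zero, smul_zero])
  have hVinj : ∀ v ∈ V, (X.ρ D.y ^ m) v = 0 → v = 0 := by
    intro v hv hv'
    have : v ∈ LinearMap.ker (X.ρ D.y ^ m) ⊓ V := ⟨hv', hv⟩
    rwa [hKV.inf_eq_bot] at this
  have hVne : ∃ v : V, v ≠ 0 := by
    by_contra! hall
    apply hm'
    have : V = ⊥ := (Submodule.eq_bot_iff _).2 fun v hv => congrArg Subtype.val (hall ⟨v, hv⟩)
    rw [this] at hKV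
    exact LinearMap.ker_eq_top.1 (eq_top_of_isCompl_bot hKV)
  let T : V →ₗ[k] X.V := (X.ρ D.y ^ m) ∘ₗ V.subtype
  have hTinj : LinearMap.ker T = ⊥ :=
    (Submodule.eq_bot_iff _).2 fun v hv => Subtype.ext (hVinj v v.2 hv)
  obtain ⟨C, hWC, hC⟩ := σ.exists_isCompl_invariant (LinearMap.range T) (by
    rintro x _ ⟨v, rfl⟩
    refine ⟨((D.χ x)⁻¹ ^ m : kˣ) • ⟨σ x v, hV x v v.2⟩, ?_⟩
    change (X.ρ D.y ^ m) (((D.χ x)⁻¹ ^ m : kˣ) • X.ρ (D.of x) (v : X.V)) =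
      X.ρ (D.of x) ((X.ρ D.y ^ m) v)
    rw [ρ_of_y_pow, Units.smul_def, map_smul, Units.smul_def])
  let E : V ≃ₗ[k] LinearMap.range T := LinearEquiv.ofInjective T (LinearMap.ker_eq_bot.1 hTinj)
  -- A left inverse of y^m on V that vanishes on a G-stable complement of y^m V; it is G-equivariant
  -- up to the twist by χ^(-m).
  let P : X.V →ₗ[k] V := E.symm.toLinearMap ∘ₗ (LinearMap.range T).projectionOnto C hWC
  have hPT : ∀ v : V, P ((X.ρ D.y ^ m) v) = v := by
    intro v
    have h1 : (LinearMap.range T).projectionOnto C hWC ((X.ρ D.y ^ m) v) = E v :=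
      Submodule.projectionOnto_apply_left hWC (E v)
    change E.symm _ = v
    rw [h1, LinearEquiv.symm_apply_apply]
  have hPC : ∀ c ∈ C, P c = 0 := by
    intro c hc
    change E.symm _ = 0
    rw [Submodule.projectionOnto_apply_right hWC ⟨c, hc⟩, map_zero]
  have hg : X.ρ (D.of (D.g ^ D.n)) = 1 := D.ρ_g_pow_n_of_nilpotent hμ X h
  let τ : Representation k G V :=
    (⟨V, fun x v hv => hV x v hv⟩ : Subrepresentation σ).toRepresentation
  have hPσ : ∀ x v, P (X.ρ (D.of x) v) = ((D.χ x)⁻¹ ^ m : kˣ) • τ x (P v) := by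
    intro x v
    obtain ⟨w, hw, c, hc, rfl⟩ := Submodule.mem_sup.1
      (show v ∈ LinearMap.range T ⊔ C by rw [hWC.sup_eq_top]; trivial)
    obtain ⟨v, rfl⟩ := hw
    change P (X.ρ (D.of x) ((X.ρ D.y ^ m) v + c)) =
      ((D.χ x)⁻¹ ^ m : kˣ) • τ x (P ((X.ρ D.y ^ m) v + c))
    have hPxc : P (X.ρ (D.of x) c) = 0 := hPC _ (hC x c hc)
    rw [map_add, map_add, map_add, hPC _ hc, hPxc, hPT, add_zero, add_zero,
      ρ_of_y_pow, Units.smul_def, map_smul, Units.smul_def]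
    exact congrArg _ (hPT (τ x v))
  -- Letting y act by zero on V respects y^n = μ(g^n - 1) only if g^n = 1 on V; this holds because
  -- y^n = 0 on X and μ ≠ 0.
  have hτ : τ (D.g ^ D.n) = 1 := by
    refine LinearMap.ext fun v => Subtype.ext ?_
    change X.ρ (D.of (D.g ^ D.n)) (v : X.V) = v
    rw [hg]; rfl
  let M := D.inflation V τ hτ
  have hM : D.IsInfl M := D.isInfl_inflation V τ hτ
  have hMof : ∀ x, M.ρ (D.of x) = τ x := D.inflation_ρ_of V τ hτ
  obtain ⟨ι, hι, hι'⟩ := hM.exists_hom hjn X V.subtype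
    (fun x (v : V) => by rw [hMof]; rfl) (fun v => by rw [hj]; rfl)
  -- The retraction reads the component at x^i off by applying y^(m-i), which carries degree i to
  -- the socle, and then P. It commutes with y because y shifts the index; the two boundary terms
  -- vanish by y^j = 0 on X and x^j = 0.
  let r : X.V →ₗ[k] V ⊗[k] (Fin j → k) := ∑ i ∈ Finset.range j,
    ((TensorProduct.mk k V (Fin j → k)).flip (xvec k j i)) ∘ₗ P ∘ₗ (X.ρ D.y ^ (m - i))
  have hr : ∀ x, r x = ∑ i ∈ Finset.range j, P ((X.ρ D.y ^ (m - i)) x) ⊗ₜ[k] xvec k j i := by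
    intro x
    simp [r]
  have hrlin : ∀ a x, r (X.ρ a x) = (M.tensor (D.uniserial j hjn)).ρ a (r x) := by
    refine D.map_ρ_of_generators (M := X) (N := M.tensor (D.uniserial j hjn)) r ?_ ?_
    · intro x
      refine (hr _).trans (Eq.trans ?_ (congrArg _ (hr _)).symm)
      refine Eq.trans ?_ (map_sum _ _ _).symm
      have h1 : ∀ i ∈ Finset.range j, (M.tensor (D.uniserial j hjn)).ρ D.y
          (P ((X.ρ D.y ^ (m - i)) x) ⊗ₜ[k] xvec k j i) =
            P ((X.ρ D.y ^ (m - i)) x) ⊗ₜ[k] xvec k j (i + 1) :=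
        fun i _ => hM.ρ_y_tmul_xvec hjn _ i
      refine Eq.trans ?_ (Finset.sum_congr rfl h1).symm
      have hjr : Finset.range j = Finset.range (m + 1) := by rw [hm]
      have h2 : (∑ i ∈ Finset.range (m + 1), P ((X.ρ D.y ^ (m - i)) (X.ρ D.y x)) ⊗ₜ[k] xvec k j i) =
          ∑ i ∈ Finset.range (m + 1), P ((X.ρ D.y ^ (m - i)) x) ⊗ₜ[k] xvec k j (i + 1) := by
        rw [Finset.sum_range_succ', Finset.sum_range_succ _ m, xvec_of_le hm.le,
          TensorProduct.tmul_zero, ← Module.End.mul_apply, ← pow_succ, Nat.sub_zero, ← hm, hj,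
          LinearMap.zero_apply, map_zero, TensorProduct.zero_tmul]
        congr 1
        refine Finset.sum_congr rfl fun i hi => ?_
        rw [← Module.End.mul_apply, ← pow_succ, show m - (i + 1) + 1 = m - i by
          have := Finset.mem_range.1 hi; omega]
      rw [hjr]
      exact h2
    · intro x v
      refine (hr _).trans (Eq.trans ?_ (congrArg _ (hr _)).symm)
      refine Eq.trans ?_ (map_sum _ _ _).symm
      refine Finset.sum_congr rfl fun i hi => ?_
      refine Eq.trans ?_ (D.ρ_of_tmul_xvec M hjn x _ i).symm
      rw [ρ_y_pow_of, Units.smul_def, map_smul, hPσ, hMof, Units.smul_def, Units.smul_def,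
        smul_smul, ← TensorProduct.smul_tmul']
      congr 1
      rw [← Units.val_mul]
      congr 1
      have hi' : i ≤ m := by have := Finset.mem_range.1 hi; omega
      obtain ⟨d, rfl⟩ := Nat.exists_eq_add_of_le hi'
      rw [Nat.add_sub_cancel_left, pow_add, mul_comm, mul_assoc, ← mul_pow, inv_mul_cancel,
        one_pow, mul_one]
  have hinj : Function.Injective (r ∘ₗ ι) := by
    refine hM.injective_hom hjn (M.tensor (D.uniserial j hjn)) (r ∘ₗ ι) (fun a z => ?_)
      fun (v : V) hv => ?_
    · exact (congrArg r (hι a z)).trans (hrlin a (ι z))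
    -- On the socle only the term i = m survives: for i < m the exponent (m - i) + m is at least j.
    · have h1 : r ((X.ρ D.y ^ m) v) = v ⊗ₜ xvec k j m := by
        rw [hr, Finset.sum_eq_single m]
        · rw [Nat.sub_self, pow_zero, Module.End.one_apply, hPT]
        · intro i hi him
          have hi' : m - i + m = (m - i - 1) + j := by have := Finset.mem_range.1 hi; omega
          rw [← Module.End.mul_apply, ← pow_add, hi', pow_add, hj, mul_zero,
            LinearMap.zero_apply, map_zero, TensorProduct.zero_tmul]
        · intro h; exact absurd (Finset.mem_range.2 (by omega)) h
      have h2 : v ⊗ₜ xvec k j m = (0 : V ⊗[k] (Fin j → k)) := by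
        rw [← h1]
        refine Eq.trans (congrArg r ?_) hv
        have := hι' v (j - 1)
        rw [show j - 1 = m by omega] at this ⊢
        exact this.symm
      have h3 := congrArg (fun z => TensorProduct.piScalarRight k k V (Fin j) z ⟨m, by omega⟩) h2
      have h4 : v = (0 : V) := by simpa [xvec] using h3
      exact h4
  obtain ⟨hW, hiso⟩ := FDModule.iso_directSum_of_retract (M.tensor (D.uniserial j hjn)) X ι r hι
    hrlin hinj
  refine ⟨j, hjn, M, X.sub (LinearMap.ker r) hW, by omega, hM, hiso, ?_, ?_⟩
  · obtain ⟨v, hv⟩ := hVne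
    refine Submodule.finrank_lt fun ht => hv ?_
    have hr0 : r = 0 := LinearMap.ker_eq_top.1 ht
    have hz : (r ∘ₗ ι) (v ⊗ₜ xvec k j m) = (r ∘ₗ ι) 0 := by rw [hr0]; rfl
    have h2 : v ⊗ₜ xvec k j m = (0 : V ⊗[k] (Fin j → k)) := hinj hz
    have h3 := congrArg (fun z => TensorProduct.piScalarRight k k V (Fin j) z ⟨m, by omega⟩) h2
    simpa [xvec] using h3
  · have hs : ∀ (d : ℕ) (w : LinearMap.ker r), (LinearMap.ker r).subtype
        (((X.sub (LinearMap.ker r) hW).ρ D.y ^ d) w) = (X.ρ D.y ^ d) w := by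
      intro d w
      rw [← map_pow, ← map_pow]
      rfl
    refine LinearMap.ext fun w => Subtype.ext ?_
    refine (hs D.n w).trans ?_
    rw [h]
    rfl

/-- The classes of the modules `V ⊗ M(j, 0)` with `y` acting by zero on `V`, and of the modules on
which `y` acts bijectively. -/
def generators : Set (GreenRing k D.H) :=
  {x | ∃ V j, D.IsInfl V ∧ 1 ≤ j ∧ j ≤ D.n ∧ x = greenClass V * D.uniserialClass j} ∪
    {x | ∃ N : FDModule k D.H, IsUnit (N.ρ D.y) ∧ x = greenClass N}

theorem greenClass_eq_zero_of_subsingleton (X : FDModule k D.H) [Subsingleton X.V] :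
    greenClass X = 0 := by
  have h := greenClass_directSum X X
  rw [greenClass_congr (N := X)] at h
  · exact left_eq_add.1 h
  · have hs2 : ∀ x y : X.V × X.V, x = y := fun x y => Subsingleton.elim x y
    exact ⟨(0 : (X.V × X.V) ≃ₗ[k] X.V),
      fun a v => Subsingleton.elim _ _⟩

/-- A vector killed by y is killed by y^n = μ(g^n - 1), hence fixed by g^n. -/
theorem isUnit_ρ_y_of_injective (hμ : D.μ ≠ 0) (Z : FDModule k D.H)
    (h : ∀ v, Z.ρ (D.of (D.g ^ D.n)) v = v → v = 0) : IsUnit (Z.ρ D.y) := by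
  rw [LinearMap.isUnit_iff_ker_eq_bot, Submodule.eq_bot_iff]
  intro v hv
  have h1 : (Z.ρ D.y ^ D.n) v = 0 := by
    obtain ⟨m, hm⟩ : ∃ m, D.n = m + 1 := ⟨D.n - 1, by have := D.n_pos; omega⟩
    rw [hm, pow_succ, Module.End.mul_apply, LinearMap.mem_ker.1 hv, map_zero]
  rw [D.ρ_y_pow_n, LinearMap.smul_apply, smul_eq_zero] at h1
  exact h v (sub_eq_zero.1 (h1.resolve_left hμ))

theorem greenClass_mem_closure_of_nilpotent [CharZero k] (hμ : D.μ ≠ 0) (X : FDModule k D.H)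
    (h : X.ρ D.y ^ D.n = 0) : greenClass X ∈ AddSubgroup.closure D.generators := by
  induction hd : Module.finrank k X.V using Nat.strong_induction_on generalizing X with
  | h d ih =>
    rcases subsingleton_or_nontrivial X.V with hX | hX
    · rw [D.greenClass_eq_zero_of_subsingleton X]; exact zero_mem _
    · obtain ⟨j, hj, V, Z, hj1, hV, hiso, hlt, hZ⟩ := D.exists_uniserial_summand hμ X h
      rw [← greenClass_congr hiso, greenClass_directSum, greenClass_tensor]
      refine add_mem (AddSubgroup.subset_closure (Or.inl ⟨V, j, hV, hj1, hj, ?_⟩))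
        (ih _ (hd ▸ hlt) Z hZ rfl)
      rw [D.uniserialClass_of_le hj]

/-- The eigenspace of g^n for the eigenvalue 1 is a nilpotent direct summand, and on its complement
g^n has no fixed vector, so y is bijective there. -/
theorem closure_generators [CharZero k] (hμ : D.μ ≠ 0) (x : GreenRing k D.H) :
    x ∈ AddSubgroup.closure D.generators := by
  induction x using greenRing_induction with
  | hadd x y hx hy => exact add_mem hx hy
  | hneg x hx => exact neg_mem hx
  | h X =>
    obtain ⟨Y, Z, i, j, hiso, hi, -, hii, -, hri, hZ⟩ := D.exists_eigenspace_decomposition X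
      (D.g ^ D.n) D.g_pow_n_comm (D.ρ_y_g_pow_n X) 1
    rw [← greenClass_congr hiso, greenClass_directSum]
    refine add_mem (D.greenClass_mem_closure_of_nilpotent hμ Y ?_)
      (AddSubgroup.subset_closure (Or.inr ⟨Z, D.isUnit_ρ_y_of_injective hμ Z ?_, rfl⟩))
    · rw [D.ρ_y_pow_n]
      have : Y.ρ (D.of (D.g ^ D.n)) = 1 := by
        refine LinearMap.ext fun v => hii ?_
        have hv : i v ∈ LinearMap.range i := ⟨v, rfl⟩
        rw [hri, LinearMap.mem_ker, map_one, LinearMap.sub_apply, sub_eq_zero] at hv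
        rw [hi, hv]
        rfl
      rw [this, sub_self, smul_zero]
    · intro v hv
      exact hZ v (by rw [hv, one_smul])

end GroupDatum

/-! ### Modules on which y is bijective are determined by their characters. -/

/-- Two units `Y`, `Z` with the same `n`-th power are conjugate if there is an idempotent `E` whose
conjugates by the powers of `Y`, and by the powers of `Z`, decompose the identity. -/
theorem Units.sum_conj_mul_sum_conj {A : Type*} [Ring A] {n : ℕ} (Y Z : Aˣ) (E : A)
    (hE : E * E = E) (hY : ∑ i ∈ Finset.range n, (Y ^ i : Aˣ) * E * ((Y ^ i)⁻¹ : Aˣ) = 1)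
    (hZ : ∀ d, 0 < d → d < n → E * (Z ^ d : Aˣ) * E = 0)
    (hc : (Z ^ n : Aˣ) * E = E * (Z ^ n : Aˣ)) :
    (∑ j ∈ Finset.range n, (Y ^ j : Aˣ) * E * ((Z ^ j)⁻¹ : Aˣ)) *
      (∑ i ∈ Finset.range n, (Z ^ i : Aˣ) * E * ((Y ^ i)⁻¹ : Aˣ)) = 1 := by
  have hc' : ((Z ^ n)⁻¹ : Aˣ) * E = E * ((Z ^ n)⁻¹ : Aˣ) := by
    rw [Units.inv_mul_eq_iff_eq_mul, ← mul_assoc, Units.eq_mul_inv_iff_mul_eq, hc]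
  -- The cross terms contain E Z^(i-j) E. A negative exponent is moved into the range 0 < d < n by
  -- adding n, which is harmless because Z^n commutes with E.
  have h0 : ∀ j < n, ∀ i < n, i ≠ j → E * ((Z ^ j)⁻¹ : Aˣ) * (Z ^ i : Aˣ) * E = 0 := by
    intro j hj i hi hij
    rcases lt_or_gt_of_ne hij with h | h
    · have : (Z ^ j)⁻¹ * Z ^ i = Z ^ (n + i - j) * (Z ^ n)⁻¹ := by
        rw [_root_.eq_mul_inv_iff_mul_eq, mul_assoc, _root_.inv_mul_eq_iff_eq_mul, ← pow_add, ← pow_add]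
        congr 1; omega
      rw [mul_assoc E, ← Units.val_mul, this, Units.val_mul, mul_assoc, mul_assoc, hc',
        ← mul_assoc, ← mul_assoc, hZ _ (by omega) (by omega), zero_mul]
    · have : (Z ^ j)⁻¹ * Z ^ i = Z ^ (i - j) := by
        rw [_root_.inv_mul_eq_iff_eq_mul, ← pow_add]
        congr 1; omega
      rw [mul_assoc E, ← Units.val_mul, this, hZ _ (by omega) (by omega)]
  rw [Finset.sum_mul_sum, ← hY]
  refine Finset.sum_congr rfl fun j hj => ?_
  rw [Finset.sum_eq_single j]
  · rw [show ((Y ^ j : Aˣ) : A) * E * ((Z ^ j)⁻¹ : Aˣ) * ((Z ^ j : Aˣ) * E * ((Y ^ j)⁻¹ : Aˣ)) =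
      (Y ^ j : Aˣ) * E * (((Z ^ j)⁻¹ : Aˣ) * (Z ^ j : Aˣ)) * E * ((Y ^ j)⁻¹ : Aˣ) by
        simp only [mul_assoc], Units.inv_mul, mul_one, mul_assoc _ E E, hE]
  · intro i hi hij
    rw [show ((Y ^ j : Aˣ) : A) * E * ((Z ^ j)⁻¹ : Aˣ) * ((Z ^ i : Aˣ) * E * ((Y ^ i)⁻¹ : Aˣ)) =
      (Y ^ j : Aˣ) * (E * ((Z ^ j)⁻¹ : Aˣ) * (Z ^ i : Aˣ) * E) * ((Y ^ i)⁻¹ : Aˣ) by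
        simp only [mul_assoc], h0 j (Finset.mem_range.1 hj) i (Finset.mem_range.1 hi) hij, mul_zero,
      zero_mul]
  · intro h; exact absurd hj h

/-- Conjugation in the form Z · Y⁻¹ shifts the summation index by one, and the terms for i = 0 and i
= n agree since Z^n E = E Y^n. So the sum intertwines Y and Z. -/
theorem Units.mul_sum_conj {A : Type*} [Ring A] {n : ℕ} (Y Z : Aˣ) (E : A)
    (hYZ : (Z ^ n : Aˣ) * E = E * (Y ^ n : Aˣ)) :
    (Z : A) * (∑ i ∈ Finset.range n, (Z ^ i : Aˣ) * E * ((Y ^ i)⁻¹ : Aˣ)) =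
      (∑ i ∈ Finset.range n, (Z ^ i : Aˣ) * E * ((Y ^ i)⁻¹ : Aˣ)) * Y := by
  rw [← Units.mul_inv_eq_iff_eq_mul, Finset.mul_sum, Finset.sum_mul]
  have h1 : ∀ i ∈ Finset.range n, (Z : A) * ((Z ^ i : Aˣ) * E * ((Y ^ i)⁻¹ : Aˣ)) * (Y⁻¹ : Aˣ) =
      (Z ^ (i + 1) : Aˣ) * E * ((Y ^ (i + 1))⁻¹ : Aˣ) := by
    intro i _
    rw [pow_succ' Z, pow_succ' Y, mul_inv_rev, Units.val_mul, Units.val_mul]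
    simp only [mul_assoc]
  rw [Finset.sum_congr rfl h1]
  have h2 := Finset.sum_range_succ (fun i => ((Z ^ i : Aˣ) : A) * E * ((Y ^ i)⁻¹ : Aˣ)) n
  rw [Finset.sum_range_succ'] at h2
  rw [hYZ, Units.mul_inv_cancel_right] at h2
  simpa using h2

/-- For a primitive `n`-th root of unity `q` with `q ^ N = 1`, a polynomial that takes the value one
at exactly one element of each orbit of `q` on the `N`-th roots of unity, and zero at the others. -/
theorem IsPrimitiveRoot.exists_indicator {k : Type*} [Field k] [IsAlgClosed k] {q : k} {n N : ℕ}
    (hq : IsPrimitiveRoot q n) (hn : 0 < n) (hN : 0 < N) (hqN : q ^ N = 1) :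
    ∃ P : Polynomial k, (∀ w : k, w ^ N = 1 → P.eval w * P.eval w = P.eval w) ∧
      (∀ w : k, w ^ N = 1 → ∑ i ∈ Finset.range n, P.eval (q ^ i * w) = 1) ∧
      ∀ w : k, w ^ N = 1 → ∀ d, 0 < d → d < n → P.eval (q ^ d * w) * P.eval w = 0 := by
  classical
  -- The orbit of w under multiplication by q is the set of n-th roots of w^n. A choice of one n-th
  -- root for each scalar selects one point of each orbit, and Lagrange interpolation at the N-th
  -- roots of unity makes the selection polynomial.
  choose r hr using fun c : k => IsAlgClosed.exists_pow_nat_eq c hn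
  let ind : k → k := fun w => if r (w ^ n) = w then 1 else 0
  let P := Lagrange.interpolate (Polynomial.nthRootsFinset N (1 : k)) id ind
  have hP : ∀ w : k, w ^ N = 1 → P.eval w = ind w := fun w hw =>
    Lagrange.eval_interpolate_at_node ind (Function.injective_id.injOn)
      ((Polynomial.mem_nthRootsFinset hN _).2 hw)
  have hqw : ∀ i w, w ^ N = 1 → (q ^ i * w) ^ N = 1 := fun i w hw => by
    rw [mul_pow, hw, mul_one, ← pow_mul, mul_comm, pow_mul, hqN, one_pow]
  have hqn : ∀ i w, (q ^ i * w) ^ n = w ^ n := fun i w => by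
    rw [mul_pow, ← pow_mul, mul_comm i, pow_mul, hq.pow_eq_one, one_pow, one_mul]
  have hw0 : ∀ w : k, w ^ N = 1 → w ≠ 0 := by
    rintro w hw rfl
    rw [zero_pow hN.ne'] at hw
    exact zero_ne_one hw
  refine ⟨P, fun w hw => ?_, fun w hw => ?_, fun w hw d hd hdn => ?_⟩
  · rw [hP w hw]
    simp only [ind]
    split_ifs <;> simp
  · have : NeZero n := ⟨hn.ne'⟩
    have h1 : (r (w ^ n) * w⁻¹) ^ n = 1 := by
      rw [mul_pow, hr, ← mul_pow, mul_inv_cancel₀ (hw0 w hw), one_pow]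
    obtain ⟨i, hi, hi'⟩ := hq.eq_pow_of_pow_eq_one h1
    have h2 : q ^ i * w = r (w ^ n) := by
      rw [hi', mul_assoc, inv_mul_cancel₀ (hw0 w hw), mul_one]
    rw [Finset.sum_eq_single i]
    · rw [hP _ (hqw i w hw)]
      simp only [ind]
      rw [hqn, if_pos h2.symm]
    · intro i' hi'' hne
      rw [hP _ (hqw i' w hw)]
      simp only [ind]
      rw [hqn, if_neg]
      intro h
      rw [← h2] at h
      exact hne (hq.pow_inj (Finset.mem_range.1 hi'') hi (mul_right_cancel₀ (hw0 w hw) h.symm))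
    · intro h; exact absurd (Finset.mem_range.2 hi) h
  · rw [hP _ (hqw d w hw), hP w hw]
    simp only [ind]
    rw [hqn]
    split_ifs with h1 h2
    · rw [h2] at h1
      exact absurd (mul_right_cancel₀ (hw0 w hw) (h1.symm.trans (one_mul w).symm))
        (hq.pow_ne_one_of_pos_of_lt hd.ne' hdn)
    all_goals simp

/-- Conjugation by Y rescales t by q, so it moves the spectral projections of t along the orbits of
q on the eigenvalues. -/
theorem pow_mul_aeval_of_q_commute {k A : Type*} [Field k] [Ring A] [Algebra k A] {q : k} {Y t : A}
    (h : Y * t = q • (t * Y)) (i : ℕ) (P : Polynomial k) :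
    Y ^ i * Polynomial.aeval t P =
      Polynomial.aeval t (P.comp (Polynomial.C (q ^ i) * Polynomial.X)) * Y ^ i := by
  have h1 : Y ^ i * t = q ^ i • (t * Y ^ i) := by
    induction i with
    | zero => simp
    | succ i ih =>
      rw [pow_succ, mul_assoc, h, mul_smul_comm, ← mul_assoc, ih, smul_mul_assoc, smul_smul,
        mul_assoc, pow_succ']
  have h2 : ∀ m, Y ^ i * t ^ m = (q ^ i • t) ^ m * Y ^ i := by
    intro m
    induction m with
    | zero => simp
    | succ m ih => rw [pow_succ, ← mul_assoc, ih, mul_assoc, h1, pow_succ]; simp [mul_assoc]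
  induction P using Polynomial.induction_on' with
  | add P Q hP hQ => rw [map_add, mul_add, hP, hQ, Polynomial.add_comp, map_add, add_mul]
  | monomial m c =>
    rw [Polynomial.aeval_monomial, Polynomial.monomial_comp, map_mul, Polynomial.aeval_C, map_pow,
      map_mul, Polynomial.aeval_C, Polynomial.aeval_X, ← mul_assoc, ← Algebra.commutes, mul_assoc,
      h2, ← Algebra.smul_def (q ^ i) t, mul_assoc]

theorem aeval_eq_of_forall_eval {k A : Type*} [Field k] [IsAlgClosed k] [CharZero k] [Ring A]
    [Algebra k A] {t : A} {N : ℕ} (hN : 0 < N) (ht : t ^ N = 1) (P Q : Polynomial k)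
    (h : ∀ w : k, w ^ N = 1 → P.eval w = Q.eval w) :
    Polynomial.aeval t P = Polynomial.aeval t Q := by
  obtain ⟨R, hR⟩ := Polynomial.X_pow_sub_one_dvd_of_eval hN (P - Q) fun w hw => by
    rw [Polynomial.eval_sub, h w hw, sub_self]
  have := congrArg (Polynomial.aeval t) hR
  rw [map_sub, map_mul, map_sub, map_pow, Polynomial.aeval_X, map_one, ht, sub_self, zero_mul,
    sub_eq_zero] at this
  exact this

namespace GroupDatum

variable {k : Type u} {G : Type v} [Field k] [Group G] (D : GroupDatum k G)

/-- The trace of `h ∈ G` on a module. -/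
noncomputable def traceOf (h : G) (X : FDModule k D.H) : k :=
  LinearMap.trace k X.V (X.ρ (D.of h))

theorem traceOf_congr (h : G) {X Y : FDModule k D.H} (e : X.Iso Y) :
    D.traceOf h X = D.traceOf h Y := by
  obtain ⟨e, he⟩ := e
  rw [traceOf, traceOf, ← LinearMap.trace_conj' _ e]
  congr 1
  refine LinearMap.ext fun x => ?_
  rw [LinearEquiv.conj_apply_apply, he, LinearEquiv.apply_symm_apply]

theorem traceOf_directSum (h : G) (X Y : FDModule k D.H) :
    D.traceOf h (X.directSum Y) = D.traceOf h X + D.traceOf h Y :=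
  LinearMap.trace_prodMap' (X.ρ (D.of h)) (Y.ρ (D.of h))

variable [Finite G]

theorem iso_of_traceOf_eq_of_isInfl [CharZero k] {V W : FDModule k D.H} (hV : D.IsInfl V)
    (hW : D.IsInfl W) (h : ∀ x, D.traceOf x V = D.traceOf x W) : V.Iso W := by
  obtain ⟨e, he⟩ := Representation.exists_equiv_of_character_eq
    ((V.ρ : D.H →* Module.End k V.V).comp D.of) ((W.ρ : D.H →* Module.End k W.V).comp D.of) h
  refine ⟨e, D.map_ρ_of_generators e.toLinearMap (fun v => ?_) fun h v => he h v⟩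
  rw [hV, hW]
  exact map_zero e

/-- Modules on which `y` acts bijectively are determined by their restriction to `G`. -/
theorem iso_of_traceOf_eq_of_isUnit [CharZero k] [IsAlgClosed k] {V W : FDModule k D.H}
    (hV : IsUnit (V.ρ D.y)) (hW : IsUnit (W.ρ D.y))
    (h : ∀ x, D.traceOf x V = D.traceOf x W) : V.Iso W := by
  obtain ⟨e, he⟩ := Representation.exists_equiv_of_character_eq
    ((V.ρ : D.H →* Module.End k V.V).comp D.of) ((W.ρ : D.H →* Module.End k W.V).comp D.of) h
  have he : ∀ x v, e (V.ρ (D.of x) v) = W.ρ (D.of x) (e v) := he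
  let A := Module.End k V.V
  -- The two modules are isomorphic over G. With the action of y on W transported to V as Z, what
  -- remains is a G-automorphism T of V with ZT = TY, where Y and Z have the same commutation rules
  -- with G and the same n-th power.
  obtain ⟨Y, hY⟩ := hV
  have hZu : IsUnit (e.symm.conj (W.ρ D.y)) := hW.map (e.symm.conjRingEquiv)
  obtain ⟨Z, hZ⟩ := hZu
  have hZe : ∀ v, e ((Z : A) v) = W.ρ D.y (e v) := fun v => by
    rw [hZ]; simp [LinearEquiv.conj_apply_apply]
  have hYh : ∀ x, (Y : A) * V.ρ (D.of x) = (D.χ x : k) • (V.ρ (D.of x) * (Y : A)) := fun x =>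
    LinearMap.ext fun v => by rw [hY]; exact D.ρ_y_of V x v
  have hZh : ∀ x, (Z : A) * V.ρ (D.of x) = (D.χ x : k) • (V.ρ (D.of x) * (Z : A)) := fun x =>
    LinearMap.ext fun v => e.injective (by
      rw [Module.End.mul_apply, hZe, he, D.ρ_y_of, LinearMap.smul_apply, map_smul,
        Module.End.mul_apply, he, hZe])
  have hYn : (Y : A) ^ D.n = D.μ • (V.ρ (D.of (D.g ^ D.n)) - 1) := by rw [hY, D.ρ_y_pow_n]
  have hZn : (Z : A) ^ D.n = D.μ • (V.ρ (D.of (D.g ^ D.n)) - 1) := by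
    have h1 : ∀ m v, e (((Z : A) ^ m) v) = (W.ρ D.y ^ m) (e v) := by
      intro m v
      induction m with
      | zero => simp
      | succ m ih => rw [pow_succ', Module.End.mul_apply, hZe, ih, pow_succ', Module.End.mul_apply]
    refine LinearMap.ext fun v => e.injective ?_
    rw [h1, D.ρ_y_pow_n]
    rw [LinearMap.smul_apply, LinearMap.smul_apply, map_smul, LinearMap.sub_apply,
      LinearMap.sub_apply, map_sub, he]
    rfl
  set t := V.ρ (D.of D.g) with ht
  have htN : t ^ Nat.card G = 1 := D.ρ_of_pow_card V D.g
  have hN : 0 < Nat.card G := Nat.card_pos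
  obtain ⟨P, hP1, hP2, hP3⟩ := D.isPrimitiveRoot.exists_indicator D.n_pos hN (by
    rw [← Units.val_pow_eq_pow_val, ← map_pow, pow_card_eq_one', map_one, Units.val_one])
  -- E projects onto the eigenspaces of g for one eigenvalue in each q-orbit. Both Y and Z move the
  -- eigenspaces along these orbits, so V is the sum of the Y^i E V and also of the Z^i E V; T is
  -- Z^i Y^(-i) on Y^i E V.
  set E : A := Polynomial.aeval t P with hEdef
  have hEE : E * E = E := by
    rw [hEdef, ← map_mul]
    exact aeval_eq_of_forall_eval hN htN _ _ fun w hw => by rw [Polynomial.eval_mul, hP1 w hw]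
  have hsum : ∀ U : Aˣ, (∀ x, (U : A) * V.ρ (D.of x) = (D.χ x : k) • (V.ρ (D.of x) * (U : A))) →
      ∑ i ∈ Finset.range D.n, (U ^ i : Aˣ) * E * ((U ^ i)⁻¹ : Aˣ) = 1 := by
    intro U hU
    have h1 : ∀ i ∈ Finset.range D.n, ((U ^ i : Aˣ) : A) * E * ((U ^ i)⁻¹ : Aˣ) =
        Polynomial.aeval t (P.comp (Polynomial.C ((D.χ D.g : k) ^ i) * Polynomial.X)) := by
      intro i _
      rw [Units.mul_inv_eq_iff_eq_mul, Units.val_pow_eq_pow_val]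
      exact pow_mul_aeval_of_q_commute (hU D.g) i P
    rw [Finset.sum_congr rfl h1, ← map_sum, ← map_one (Polynomial.aeval (R := k) t)]
    refine aeval_eq_of_forall_eval hN htN _ _ fun w hw => ?_
    rw [Polynomial.eval_finsetSum, Polynomial.eval_one, ← hP2 w hw]
    refine Finset.sum_congr rfl fun i _ => ?_
    simp
  have horth : ∀ U : Aˣ, (∀ x, (U : A) * V.ρ (D.of x) = (D.χ x : k) • (V.ρ (D.of x) * (U : A))) →
      ∀ d, 0 < d → d < D.n → E * (U ^ d : Aˣ) * E = 0 := by
    intro U hU d hd hdn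
    rw [mul_assoc, Units.val_pow_eq_pow_val, pow_mul_aeval_of_q_commute (hU D.g) d P, ← mul_assoc,
      hEdef, ← map_mul]
    rw [aeval_eq_of_forall_eval hN htN _ 0 fun w hw => ?_, map_zero, zero_mul]
    have := hP3 w hw d hd hdn
    rw [Polynomial.eval_mul, mul_comm, Polynomial.eval_zero, ← this]
    simp
  have htn : V.ρ (D.of (D.g ^ D.n)) = t ^ D.n := by rw [map_pow, map_pow]
  have hcomm : (t ^ D.n) * E = E * t ^ D.n := by
    rw [hEdef, ← Polynomial.aeval_X_pow (R := k), ← map_mul, ← map_mul, mul_comm]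
  have hcomm' : (D.μ • (V.ρ (D.of (D.g ^ D.n)) - 1)) * E =
      E * (D.μ • (V.ρ (D.of (D.g ^ D.n)) - 1)) := by
    rw [smul_mul_assoc, mul_smul_comm, sub_mul, mul_sub, htn, hcomm, one_mul, mul_one]
  have hST := Units.sum_conj_mul_sum_conj (n := D.n) Y Z E hEE (hsum Y hYh) (horth Z hZh)
    (by rw [Units.val_pow_eq_pow_val, hZn, hcomm'])
  have hTS := Units.sum_conj_mul_sum_conj (n := D.n) Z Y E hEE (hsum Z hZh) (horth Y hYh)
    (by rw [Units.val_pow_eq_pow_val, hYn, hcomm'])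
  have hZT := Units.mul_sum_conj (n := D.n) Y Z E
    (by rw [Units.val_pow_eq_pow_val, Units.val_pow_eq_pow_val, hYn, hZn, hcomm'])
  set T : A := ∑ i ∈ Finset.range D.n, (Z ^ i : Aˣ) * E * ((Y ^ i)⁻¹ : Aˣ) with hT
  set S : A := ∑ i ∈ Finset.range D.n, (Y ^ i : Aˣ) * E * ((Z ^ i)⁻¹ : Aˣ) with hS
  have hEh : ∀ x, E * V.ρ (D.of x) = V.ρ (D.of x) * E := by
    intro x
    have h1 : Commute t (V.ρ (D.of x)) := by
      rw [Commute, SemiconjBy, ht, ← map_mul, ← map_mul, ← map_mul, ← map_mul, D.commute_g]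
    -- Since g is central in G, the commutation rule applies with q = 1.
    have h2 := pow_mul_aeval_of_q_commute (q := (1 : k)) (Y := V.ρ (D.of x)) (t := t)
      (by rw [one_smul]; exact h1.symm) 1 P
    simpa using h2.symm
  have hTh : ∀ x, T * V.ρ (D.of x) = V.ρ (D.of x) * T := by
    intro x
    have hpow : ∀ U : Aˣ, (∀ x, (U : A) * V.ρ (D.of x) =
        (D.χ x : k) • (V.ρ (D.of x) * (U : A))) → ∀ i, ((U ^ i : Aˣ) : A) * V.ρ (D.of x) =
        ((D.χ x : k) ^ i) • (V.ρ (D.of x) * ((U ^ i : Aˣ) : A)) := by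
      intro U hU i
      induction i with
      | zero => simp
      | succ i ih =>
        rw [pow_succ U, Units.val_mul, mul_assoc, hU, mul_smul_comm, ← mul_assoc, ih,
          smul_mul_assoc, smul_smul, pow_succ', mul_assoc]
    rw [hT, Finset.sum_mul, Finset.mul_sum]
    -- The twist χ(x)^i from Z^i cancels the twist χ(x)^(-i) from Y^(-i), so each summand commutes
    -- with G.
    refine Finset.sum_congr rfl fun i _ => ?_
    have h1 : V.ρ (D.of x) * ((Y ^ i : Aˣ) : A) =
        (((D.χ x)⁻¹ ^ i : kˣ) : k) • (((Y ^ i : Aˣ) : A) * V.ρ (D.of x)) := by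
      rw [hpow Y hYh, smul_smul, ← Units.val_pow_eq_pow_val, ← Units.val_mul, ← mul_pow,
        inv_mul_cancel, one_pow, Units.val_one, one_smul]
    have h2 : (((Y ^ i)⁻¹ : Aˣ) : A) * V.ρ (D.of x) =
        (((D.χ x)⁻¹ ^ i : kˣ) : k) • (V.ρ (D.of x) * (((Y ^ i)⁻¹ : Aˣ) : A)) := by
      rw [Units.inv_mul_eq_iff_eq_mul, mul_smul_comm, ← mul_assoc,
        ← smul_mul_assoc (_ : k) (((Y ^ i : Aˣ) : A) * _), ← h1, Units.mul_inv_cancel_right]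
    rw [mul_assoc, h2, mul_smul_comm, mul_assoc (Z ^ i : Aˣ).val, ← mul_assoc E, hEh,
      mul_assoc _ E, ← mul_assoc (Z ^ i : Aˣ).val, hpow Z hZh, smul_mul_assoc, smul_smul,
      ← Units.val_pow_eq_pow_val, ← Units.val_mul, ← mul_pow, inv_mul_cancel, one_pow,
      Units.val_one, one_smul]
    simp only [mul_assoc]
  let F : V.V ≃ₗ[k] V.V := LinearEquiv.ofLinearMap T S hTS hST
  refine ⟨F.trans e, D.map_ρ_of_generators (F.trans e).toLinearMap (fun v => ?_) fun x v => ?_⟩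
  · change e (T (V.ρ D.y v)) = W.ρ D.y (e (T v))
    rw [← hZe, ← hY]
    exact congrArg e (LinearMap.congr_fun hZT v).symm
  · change e (T (V.ρ (D.of x) v)) = W.ρ (D.of x) (e (T v))
    rw [← he]
    exact congrArg e (LinearMap.congr_fun (hTh x) v)

end GroupDatum

/-! ### Traces of group elements, and the action on the classes of modules with y bijective. -/

/-- Differences of classes of modules with a property that is stable under direct sums. -/
theorem exists_eq_greenClass_sub_greenClass {k : Type u} {A : Type v} [Field k] [Ring A]
    [Bialgebra k A] {P : FDModule k A → Prop} (h0 : ∃ M, P M)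
    (h : ∀ M N, P M → P N → P (M.directSum N)) {x : GreenRing k A}
    (hx : x ∈ AddSubgroup.closure {x | ∃ M, P M ∧ x = greenClass M}) :
    ∃ M N, P M ∧ P N ∧ x = greenClass M - greenClass N := by
  induction hx using AddSubgroup.closure_induction with
  | mem x hx =>
    obtain ⟨M, hM, rfl⟩ := hx
    exact ⟨M.directSum M, M, h _ _ hM hM, hM, by rw [greenClass_directSum, add_sub_cancel_right]⟩
  | zero =>
    obtain ⟨M, hM⟩ := h0
    exact ⟨M, M, hM, hM, (sub_self _).symm⟩
  | add x y _ _ hx hy =>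
    obtain ⟨M, N, hM, hN, rfl⟩ := hx
    obtain ⟨M', N', hM', hN', rfl⟩ := hy
    exact ⟨M.directSum M', N.directSum N', h _ _ hM hM', h _ _ hN hN', by
      rw [greenClass_directSum, greenClass_directSum]; abel⟩
  | neg x _ hx =>
    obtain ⟨M, N, hM, hN, rfl⟩ := hx
    exact ⟨N, M, hN, hM, neg_sub _ _⟩

namespace GroupDatum

variable {k : Type u} {G : Type v} [Field k] [Group G] (D : GroupDatum k G)

/-- Conjugation by y multiplies h by χ(h) and preserves its trace. -/
theorem traceOf_of_isUnit {N : FDModule k D.H} (hN : IsUnit (N.ρ D.y)) {h : G}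
    (hh : (D.χ h : k) ≠ 1) : D.traceOf h N = 0 := by
  obtain ⟨Y, hY⟩ := hN
  have h1 : (Y : Module.End k N.V) * N.ρ (D.of h) = (D.χ h : k) • (N.ρ (D.of h) * Y) :=
    LinearMap.ext fun v => by rw [hY]; exact D.ρ_y_of N h v
  have h2 : D.traceOf h N = (D.χ h : k) * D.traceOf h N := by
    have h3 := LinearMap.trace_mul_comm k (N.ρ (D.of h) * (Y : Module.End k N.V))
      ((Y⁻¹ : (Module.End k N.V)ˣ) : Module.End k N.V)
    rw [Units.mul_inv_cancel_right] at h3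
    have h4 : (N.ρ (D.of h) * (Y : Module.End k N.V)) =
        (((D.χ h)⁻¹ : kˣ) : k) • ((Y : Module.End k N.V) * N.ρ (D.of h)) := by
      rw [h1, smul_smul, ← Units.val_mul, inv_mul_cancel, Units.val_one, one_smul]
    rw [h4, mul_smul_comm, Units.inv_mul_cancel_left, map_smul, smul_eq_mul] at h3
    unfold traceOf
    conv_rhs => rw [h3]
    rw [← mul_assoc, ← Units.val_mul, mul_inv_cancel, Units.val_one, one_mul]
  by_contra h0
  exact hh (mul_right_cancel₀ h0 (h2.symm.trans (one_mul _).symm))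

theorem isUnit_ρ_y_directSum {M N : FDModule k D.H} (hM : IsUnit (M.ρ D.y))
    (hN : IsUnit (N.ρ D.y)) : IsUnit ((M.directSum N).ρ D.y) := by
  rw [Module.End.isUnit_iff] at hM hN ⊢
  exact hM.prodMap hN

theorem isUnit_g_pow_n_sub_one (hμ : D.μ ≠ 0) {N : FDModule k D.H} (hN : IsUnit (N.ρ D.y)) :
    IsUnit (N.ρ (D.of (D.g ^ D.n)) - 1) := by
  have h1 := hN.pow D.n
  rw [D.ρ_y_pow_n] at h1
  exact (isUnit_smul_iff (Units.mk0 D.μ hμ) _).1 h1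

/-- The sum of the powers of g^n is annihilated by the invertible operator g^n - 1, hence it is
zero. This averaging removes the modules with y bijective from trace identities. -/
theorem sum_traceOf_of_isUnit (hμ : D.μ ≠ 0) {N : FDModule k D.H} (hN : IsUnit (N.ρ D.y)) (h : G) :
    ∑ m ∈ Finset.range (Nat.card G), D.traceOf (h * (D.g ^ D.n) ^ m) N = 0 := by
  have h1 : ∑ m ∈ Finset.range (Nat.card G), (N.ρ (D.of (D.g ^ D.n))) ^ m = 0 := by
    apply (D.isUnit_g_pow_n_sub_one hμ hN).mul_left_injective
    change (∑ m ∈ Finset.range (Nat.card G), (N.ρ (D.of (D.g ^ D.n))) ^ m) *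
      (N.ρ (D.of (D.g ^ D.n)) - 1) = 0 * (N.ρ (D.of (D.g ^ D.n)) - 1)
    rw [geom_sum_mul, D.ρ_of_pow_card, sub_self, zero_mul]
  have h2 : ∀ m ∈ Finset.range (Nat.card G), D.traceOf (h * (D.g ^ D.n) ^ m) N =
      LinearMap.trace k N.V (N.ρ (D.of h) * (N.ρ (D.of (D.g ^ D.n))) ^ m) := by
    intro m _
    rw [traceOf, map_mul, map_mul, map_pow D.of, map_pow N.ρ]
  rw [Finset.sum_congr rfl h2, ← map_sum, ← Finset.mul_sum, h1, mul_zero, map_zero]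

theorem traceOf_uniserial (h : G) {j : ℕ} (hj : j ≤ D.n) :
    D.traceOf h (D.uniserial j hj) = ∑ l ∈ Finset.range j, ((D.χ h : k)⁻¹) ^ l := by
  rw [traceOf, D.uniserial_ρ_of]
  have h1 : LinearMap.trace k (Fin j → k) (D.diagAct j h) =
      ∑ i : Fin j, ((D.χ h : k)⁻¹) ^ (i : ℕ) := by
    rw [LinearMap.trace_eq_matrix_trace k (Pi.basisFun k (Fin j)), Matrix.trace]
    refine Finset.sum_congr rfl fun i _ => ?_
    rw [Matrix.diag_apply, LinearMap.toMatrix_apply]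
    simp [diagAct]
  exact h1.trans (Finset.sum_range fun l => ((D.χ h : k)⁻¹) ^ l).symm

theorem uniserial_ρ_y_pow_n {j : ℕ} (hj : j ≤ D.n) : (D.uniserial j hj).ρ D.y ^ D.n = 0 := by
  rw [uniserial_ρ_y]
  refine LinearMap.ext fun (v : Fin j → k) => funext fun i => ?_
  refine (shift_pow_apply j D.n v i).trans ?_
  rw [dif_pos (by omega)]
  rfl

variable [Finite G]

theorem traceOf_tensor (h : G) (X Y : FDModule k D.H) :
    D.traceOf h (X.tensor Y) = D.traceOf h X * D.traceOf h Y := by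
  rw [traceOf, D.tensor_ρ_of]
  exact LinearMap.trace_tensorProduct' (X.ρ (D.of h)) (Y.ρ (D.of h))

theorem traceOf_trivial (h : G) : D.traceOf h (FDModule.trivial k D.H) = 1 := by
  have : (FDModule.trivial k D.H).ρ (D.of h) = (LinearMap.id : k →ₗ[k] k) :=
    LinearMap.ext fun v => D.trivial_ρ_of h v
  rw [traceOf, this]
  exact (LinearMap.trace_id k k).trans (by simp)

theorem traceOf_charModule (h : G) (ψ : G →* kˣ) (hψ) :
    D.traceOf h (D.charModule ψ hψ) = ψ h := by
  have : (D.charModule ψ hψ).ρ (D.of h) = ((ψ h : k) • LinearMap.id : k →ₗ[k] k) :=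
    LinearMap.ext fun v => D.charModule_ρ_of ψ hψ h v
  rw [traceOf, this]
  refine (map_smul (LinearMap.trace k k) _ _).trans ?_
  rw [LinearMap.trace_id]
  simp

/-- The trace of `h ∈ G` as a homomorphism on the Green ring. -/
noncomputable def traceHom (h : G) : GreenRing k D.H →+* k :=
  { greenAddLift (D.traceOf h) (fun _ _ e => D.traceOf_congr h e) (D.traceOf_directSum h) with
    map_one' := by
      change greenAddLift (D.traceOf h) _ _ 1 = 1
      rw [← greenClass_trivial, greenAddLift_greenClass, traceOf_trivial]
    map_mul' := fun x y => by
      change greenAddLift (D.traceOf h) _ _ (x * y) =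
        greenAddLift (D.traceOf h) _ _ x * greenAddLift (D.traceOf h) _ _ y
      induction x using greenRing_induction with
      | hadd x x' hx hx' => rw [add_mul, map_add, map_add, hx, hx', add_mul]
      | hneg x hx => rw [neg_mul, map_neg, map_neg, hx, neg_mul]
      | h X =>
        induction y using greenRing_induction with
        | hadd y y' hy hy' => rw [mul_add, map_add, map_add, hy, hy', mul_add]
        | hneg y hy => rw [mul_neg, map_neg, map_neg, hy, mul_neg]
        | h Y =>
          rw [← greenClass_tensor, greenAddLift_greenClass, greenAddLift_greenClass,
            greenAddLift_greenClass, traceOf_tensor] }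

theorem traceHom_greenClass (h : G) (X : FDModule k D.H) :
    D.traceHom h (greenClass X) = D.traceOf h X :=
  greenAddLift_greenClass _ _ (D.traceOf_directSum h) X

theorem traceHom_charClass (h : G) : D.traceHom h D.charClass = (D.χ h : k)⁻¹ := by
  rw [charClass, traceHom_greenClass, traceOf_charModule]
  simp

theorem traceHom_uniserialClass (h : G) {j : ℕ} (hj : j ≤ D.n) :
    D.traceHom h (D.uniserialClass j) = ∑ l ∈ Finset.range j, ((D.χ h : k)⁻¹) ^ l := by
  rw [D.uniserialClass_of_le hj, traceHom_greenClass, traceOf_uniserial]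

theorem isIntegral_traceHom [IsAlgClosed k] (h : G) (x : GreenRing k D.H) :
    IsIntegral ℤ (D.traceHom h x) := by
  induction x using greenRing_induction with
  | hadd x y hx hy => rw [map_add]; exact hx.add hy
  | hneg x hx => rw [map_neg]; exact hx.neg
  | h X =>
    rw [traceHom_greenClass]
    exact LinearMap.isIntegral_trace_of_pow_eq_one _ Nat.card_pos (D.ρ_of_pow_card X h)

/-- The subgroup spanned by the classes of modules on which `y` acts by zero. -/
noncomputable def inflClasses : AddSubgroup (GreenRing k D.H) :=
  AddSubgroup.closure {x | ∃ V, D.IsInfl V ∧ x = greenClass V}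

/-- The subgroup spanned by the classes of modules on which `y` acts bijectively. -/
noncomputable def unitClasses : AddSubgroup (GreenRing k D.H) :=
  AddSubgroup.closure {x | ∃ N : FDModule k D.H, IsUnit (N.ρ D.y) ∧ x = greenClass N}

/-- The element is a difference [M] - [N] of modules of this kind, and M and N are then isomorphic
because they have the same character. -/
theorem eq_zero_of_mem_inflClasses [CharZero k] {x : GreenRing k D.H} (hx : x ∈ D.inflClasses)
    (h : ∀ h, D.traceHom h x = 0) : x = 0 := by
  obtain ⟨M, N, hM, hN, rfl⟩ := exists_eq_greenClass_sub_greenClass ⟨_, D.isInfl_trivial⟩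
    (fun _ _ => IsInfl.directSum) hx
  rw [sub_eq_zero]
  refine greenClass_congr (D.iso_of_traceOf_eq_of_isInfl hM hN fun x => ?_)
  rw [← traceHom_greenClass, ← traceHom_greenClass, ← sub_eq_zero, ← map_sub, h]

theorem exists_isUnit_ρ_y : ∃ N : FDModule k D.H, IsUnit (N.ρ D.y) := by
  refine ⟨(FDModule.trivial k D.H).sub ⊥ fun a w hw => ?_, ?_⟩
  · rw [(Submodule.mem_bot k).1 hw, map_zero]; exact zero_mem _
  · rw [Module.End.isUnit_iff]
    exact ⟨fun (v w : (⊥ : Submodule k k)) _ => Subsingleton.elim v w,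
      fun (v : (⊥ : Submodule k k)) => ⟨v, Subsingleton.elim (α := (⊥ : Submodule k k)) _ _⟩⟩

theorem eq_zero_of_mem_unitClasses [CharZero k] [IsAlgClosed k] {x : GreenRing k D.H}
    (hx : x ∈ D.unitClasses) (h : ∀ h, D.traceHom h x = 0) : x = 0 := by
  obtain ⟨M, N, hM, hN, rfl⟩ := exists_eq_greenClass_sub_greenClass D.exists_isUnit_ρ_y
    (fun _ _ => D.isUnit_ρ_y_directSum) hx
  rw [sub_eq_zero]
  refine greenClass_congr (D.iso_of_traceOf_eq_of_isUnit hM hN fun x => ?_)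
  rw [← traceHom_greenClass, ← traceHom_greenClass, ← sub_eq_zero, ← map_sub, h]

theorem traceHom_of_mem_unitClasses {x : GreenRing k D.H} (hx : x ∈ D.unitClasses) {h : G}
    (hh : (D.χ h : k) ≠ 1) : D.traceHom h x = 0 := by
  induction hx using AddSubgroup.closure_induction with
  | mem x hx =>
    obtain ⟨N, hN, rfl⟩ := hx
    rw [traceHom_greenClass, D.traceOf_of_isUnit hN hh]
  | zero => exact map_zero _
  | add x y _ _ hx hy => rw [map_add, hx, hy, add_zero]
  | neg x _ hx => rw [map_neg, hx, neg_zero]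

theorem sum_traceHom_of_mem_unitClasses (hμ : D.μ ≠ 0) {x : GreenRing k D.H}
    (hx : x ∈ D.unitClasses) (h : G) :
    ∑ m ∈ Finset.range (Nat.card G), D.traceHom (h * (D.g ^ D.n) ^ m) x = 0 := by
  induction hx using AddSubgroup.closure_induction with
  | mem x hx =>
    obtain ⟨N, hN, rfl⟩ := hx
    simp only [traceHom_greenClass]
    exact D.sum_traceOf_of_isUnit hμ hN h
  | zero => simp
  | add x y _ _ hx hy => simp only [map_add, Finset.sum_add_distrib, hx, hy, add_zero]
  | neg x _ hx => simp only [map_neg, Finset.sum_neg_distrib, hx, neg_zero]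

/-- If g^n is trivial on M, it acts on M ⊗ N as id ⊗ g^n. By flatness it has no nonzero fixed vector
there, so y is bijective. -/
theorem isUnit_ρ_y_tensor_left (hμ : D.μ ≠ 0) {M N : FDModule k D.H}
    (hM : M.ρ (D.of (D.g ^ D.n)) = 1) (hN : IsUnit (N.ρ D.y)) :
    IsUnit ((M.tensor N).ρ D.y) := by
  refine D.isUnit_ρ_y_of_injective hμ _ fun (v : M.V ⊗[k] N.V) hv => ?_
  rw [D.tensor_ρ_of, hM] at hv
  have h1 := ((Module.End.isUnit_iff _).1 (D.isUnit_g_pow_n_sub_one hμ hN)).injective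
  refine (injective_iff_map_eq_zero _).1
    (Module.Flat.lTensor_preserves_injective_linearMap (M := M.V) _ h1) v ?_
  rw [LinearMap.lTensor_sub, LinearMap.sub_apply, sub_eq_zero]
  exact hv.trans (LinearMap.congr_fun (LinearMap.lTensor_id M.V N.V) v).symm

theorem isUnit_ρ_y_tensor_right (hμ : D.μ ≠ 0) {M N : FDModule k D.H}
    (hM : M.ρ (D.of (D.g ^ D.n)) = 1) (hN : IsUnit (N.ρ D.y)) :
    IsUnit ((N.tensor M).ρ D.y) := by
  refine D.isUnit_ρ_y_of_injective hμ _ fun (v : N.V ⊗[k] M.V) hv => ?_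
  rw [D.tensor_ρ_of, hM] at hv
  have h1 := ((Module.End.isUnit_iff _).1 (D.isUnit_g_pow_n_sub_one hμ hN)).injective
  refine (injective_iff_map_eq_zero _).1
    (Module.Flat.rTensor_preserves_injective_linearMap (M := M.V) _ h1) v ?_
  rw [LinearMap.rTensor_sub, LinearMap.sub_apply, sub_eq_zero]
  exact hv.trans (LinearMap.congr_fun (LinearMap.rTensor_id M.V N.V) v).symm

variable {D} in
theorem IsInfl.ρ_y_pow_n {V : FDModule k D.H} (hV : D.IsInfl V) : V.ρ D.y ^ D.n = 0 := by
  rw [hV, zero_pow D.n_pos.ne']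

theorem mul_mem_unitClasses (hμ : D.μ ≠ 0) {M : FDModule k D.H} (hM : M.ρ D.y ^ D.n = 0)
    {x : GreenRing k D.H} (hx : x ∈ D.unitClasses) : greenClass M * x ∈ D.unitClasses := by
  induction hx using AddSubgroup.closure_induction with
  | mem x hx =>
    obtain ⟨N, hN, rfl⟩ := hx
    rw [← greenClass_tensor]
    exact AddSubgroup.subset_closure ⟨_, D.isUnit_ρ_y_tensor_left hμ
      (D.ρ_g_pow_n_of_nilpotent hμ M hM) hN, rfl⟩
  | zero => rw [mul_zero]; exact zero_mem _
  | add x y _ _ hx hy => rw [mul_add]; exact add_mem hx hy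
  | neg x _ hx => rw [mul_neg]; exact neg_mem hx

theorem mul_mem_unitClasses' (hμ : D.μ ≠ 0) {M : FDModule k D.H} (hM : M.ρ D.y ^ D.n = 0)
    {x : GreenRing k D.H} (hx : x ∈ D.unitClasses) : x * greenClass M ∈ D.unitClasses := by
  induction hx using AddSubgroup.closure_induction with
  | mem x hx =>
    obtain ⟨N, hN, rfl⟩ := hx
    rw [← greenClass_tensor]
    exact AddSubgroup.subset_closure ⟨_, D.isUnit_ρ_y_tensor_right hμ
      (D.ρ_g_pow_n_of_nilpotent hμ M hM) hN, rfl⟩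
  | zero => rw [zero_mul]; exact zero_mem _
  | add x y _ _ hx hy => rw [add_mul]; exact add_mem hx hy
  | neg x _ hx => rw [neg_mul]; exact neg_mem hx

/-- Multiplying by a scales the trace of h by χ(h)⁻¹, which changes nothing: the trace is zero
unless χ(h) = 1. -/
theorem charClass_mul_of_mem_unitClasses [CharZero k] [IsAlgClosed k] (hμ : D.μ ≠ 0)
    {x : GreenRing k D.H} (hx : x ∈ D.unitClasses) : D.charClass * x = x := by
  rw [← sub_eq_zero]
  refine D.eq_zero_of_mem_unitClasses
    (sub_mem (D.mul_mem_unitClasses hμ (D.isInfl_charModule _ _).ρ_y_pow_n hx) hx) fun h => ?_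
  rw [map_sub, map_mul, D.traceHom_charClass]
  by_cases hh : (D.χ h : k) = 1
  · rw [hh, inv_one, one_mul, sub_self]
  · rw [D.traceHom_of_mem_unitClasses hx hh, mul_zero, sub_zero]

theorem mul_charClass_of_mem_unitClasses [CharZero k] [IsAlgClosed k] (hμ : D.μ ≠ 0)
    {x : GreenRing k D.H} (hx : x ∈ D.unitClasses) : x * D.charClass = x := by
  rw [← sub_eq_zero]
  refine D.eq_zero_of_mem_unitClasses
    (sub_mem (D.mul_mem_unitClasses' hμ (D.isInfl_charModule _ _).ρ_y_pow_n hx) hx) fun h => ?_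
  rw [map_sub, map_mul, D.traceHom_charClass]
  by_cases hh : (D.χ h : k) = 1
  · rw [hh, inv_one, mul_one, sub_self]
  · rw [D.traceHom_of_mem_unitClasses hx hh, zero_mul, sub_zero]

theorem uniserialClass_mul_mem_unitClasses (hμ : D.μ ≠ 0) {j : ℕ} (hj : j ≤ D.n)
    {x : GreenRing k D.H} (hx : x ∈ D.unitClasses) : D.uniserialClass j * x ∈ D.unitClasses := by
  rw [D.uniserialClass_of_le hj]
  exact D.mul_mem_unitClasses hμ (D.uniserial_ρ_y_pow_n hj) hx

/-- The character of M(n, 0) is n on ker χ, and off ker χ the traces of x vanish. This identity is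
later used to divide by M(n, 0). -/
theorem uniserialClass_mul_of_mem_unitClasses [CharZero k] [IsAlgClosed k] (hμ : D.μ ≠ 0)
    {x : GreenRing k D.H} (hx : x ∈ D.unitClasses) : D.uniserialClass D.n * x = D.n • x := by
  rw [← sub_eq_zero]
  refine D.eq_zero_of_mem_unitClasses
    (sub_mem (D.uniserialClass_mul_mem_unitClasses hμ le_rfl hx) (nsmul_mem hx _)) fun h => ?_
  rw [map_sub, map_mul, map_nsmul, D.traceHom_uniserialClass h le_rfl]
  by_cases hh : (D.χ h : k) = 1
  · simp [hh]
  · rw [D.traceHom_of_mem_unitClasses hx hh, mul_zero, smul_zero, sub_zero]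

/-- Every element of the Green ring is `∑ v_j M(j, 0)` plus a combination of classes of modules on
which `y` acts bijectively. -/
theorem exists_decomposition [CharZero k] (hμ : D.μ ≠ 0) (x : GreenRing k D.H) :
    ∃ v : ℕ → GreenRing k D.H, (∀ j, v j ∈ D.inflClasses) ∧ ∃ w ∈ D.unitClasses,
      x = ∑ j ∈ Finset.Icc 1 D.n, v j * D.uniserialClass j + w := by
  have hx := D.closure_generators hμ x
  induction hx using AddSubgroup.closure_induction with
  | mem x hx =>
    rcases hx with ⟨V, j, hV, hj1, hj, rfl⟩ | ⟨N, hN, rfl⟩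
    · refine ⟨Pi.single j (greenClass V), fun i => ?_, 0, zero_mem _, ?_⟩
      · rcases eq_or_ne i j with rfl | hij
        · rw [Pi.single_eq_same]; exact AddSubgroup.subset_closure ⟨V, hV, rfl⟩
        · rw [Pi.single_eq_of_ne hij]; exact zero_mem _
      · rw [Finset.sum_eq_single j, Pi.single_eq_same, add_zero]
        · intro i _ hij; rw [Pi.single_eq_of_ne hij, zero_mul]
        · intro h; exact absurd (Finset.mem_Icc.2 ⟨hj1, hj⟩) h
    · exact ⟨0, fun _ => zero_mem _, _, AddSubgroup.subset_closure ⟨N, hN, rfl⟩, by simp⟩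
  | zero => exact ⟨0, fun _ => zero_mem _, 0, zero_mem _, by simp⟩
  | add x y _ _ hx hy =>
    obtain ⟨v, hv, w, hw, rfl⟩ := hx
    obtain ⟨v', hv', w', hw', rfl⟩ := hy
    refine ⟨v + v', fun j => add_mem (hv j) (hv' j), w + w', add_mem hw hw', ?_⟩
    simp only [Pi.add_apply, add_mul, Finset.sum_add_distrib]
    abel
  | neg x _ hx =>
    obtain ⟨v, hv, w, hw, rfl⟩ := hx
    refine ⟨-v, fun j => neg_mem (hv j), -w, neg_mem hw, ?_⟩
    simp only [Pi.neg_apply, neg_mul, Finset.sum_neg_distrib]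
    abel

end GroupDatum

/-! ### Traces on Jordan block multiplicities, and the homomorphisms built from them. -/

/-- The homogeneous sum `∑ u ^ i v ^ (j - 1 - i)`, that is, `(u ^ j - v ^ j) / (u - v)`. -/
def quantumSum {k : Type*} [Field k] (u v : k) (j : ℕ) : k :=
  ∑ i ∈ Finset.range j, u ^ i * v ^ (j - 1 - i)

section QuantumSum

variable {k : Type*} [Field k] (u v : k)

theorem quantumSum_mul_sub (j : ℕ) : quantumSum u v j * (u - v) = u ^ j - v ^ j :=
  (Commute.all u v).geom_sum₂_mul j

theorem quantumSum_zero : quantumSum u v 0 = 0 := Finset.sum_range_zero _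

theorem quantumSum_one : quantumSum u v 1 = 1 := by simp [quantumSum]

variable {u v} in
theorem quantumSum_eq_zero (h : u ≠ v) {j : ℕ} (hj : u ^ j = v ^ j) : quantumSum u v j = 0 := by
  have := quantumSum_mul_sub u v j
  rw [hj, sub_self] at this
  exact (mul_eq_zero.1 this).resolve_right (sub_ne_zero.2 h)

variable {u v} in
-- The numerical counterpart of the rule for M(2, 0) M(j, 0), with uv in the role of a.
theorem quantumSum_two_mul (h : u ≠ v) {j : ℕ} (hj : 1 ≤ j) : quantumSum u v 2 * quantumSum u v j =
    quantumSum u v (j + 1) + u * v * quantumSum u v (j - 1) := by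
  obtain ⟨j, rfl⟩ : ∃ i, j = i + 1 := ⟨j - 1, by omega⟩
  have h' := sub_ne_zero.2 h
  apply mul_right_cancel₀ h'
  apply mul_right_cancel₀ h'
  have h0 := quantumSum_mul_sub u v j
  have h1 := quantumSum_mul_sub u v (j + 1)
  have h2 := quantumSum_mul_sub u v (j + 1 + 1)
  have h3 := quantumSum_mul_sub u v 2
  rw [Nat.add_sub_cancel]
  linear_combination (quantumSum u v (j + 1) * (u - v)) * h3 + (u ^ 2 - v ^ 2) * h1 -
    (u - v) * h2 - u * v * (u - v) * h0

variable {u v} in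
theorem isIntegral_quantumSum (hu : IsIntegral ℤ u) (hv : IsIntegral ℤ v) (j : ℕ) :
    IsIntegral ℤ (quantumSum u v j) :=
  IsIntegral.sum _ fun _ _ => (hu.pow _).mul (hv.pow _)

end QuantumSum

/-- The only index r that enters is l - 1 - i. With α = χ(h)⁻¹ this is the trace of h on the layer
ker y^(i+1) / ker y^i of M(l, 0). -/
theorem sum_truncated_succ_sub {k : Type*} [Field k] (α : k) (l i : ℕ) :
    (∑ r ∈ Finset.range l, if l ≤ r + (i + 1) then α ^ r else 0) -
      (∑ r ∈ Finset.range l, if l ≤ r + i then α ^ r else 0) =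
      if i < l then α ^ (l - 1 - i) else 0 := by
  rw [← Finset.sum_sub_distrib]
  have h : ∀ r ∈ Finset.range l, ((if l ≤ r + (i + 1) then α ^ r else 0) -
      if l ≤ r + i then α ^ r else 0) = if l = r + i + 1 then α ^ r else 0 := by
    intro r _
    split_ifs <;> first | omega | simp
  rw [Finset.sum_congr rfl h]
  split_ifs with hi
  · rw [Finset.sum_eq_single (l - 1 - i)]
    · rw [if_pos (by omega)]
    · intro r _ hr; rw [if_neg (by omega)]
    · intro h; exact absurd (Finset.mem_range.2 (by omega)) h
  · exact Finset.sum_eq_zero fun r _ => if_neg (by omega)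

namespace GroupDatum

variable {k : Type u} {G : Type v} [Field k] [Group G] (D : GroupDatum k G)

theorem ρ_of_mem_ker (X : FDModule k D.H) (h : G) (i : ℕ) :
    ∀ v ∈ LinearMap.ker (X.ρ D.y ^ i), X.ρ (D.of h) v ∈ LinearMap.ker (X.ρ D.y ^ i) :=
  fun v hv => by rw [LinearMap.mem_ker, D.ρ_y_pow_of, LinearMap.mem_ker.1 hv, map_zero, smul_zero]

/-- The trace of `h ∈ G` on the kernel of `y ^ i`. -/
noncomputable def kerTrace (h : G) (i : ℕ) (X : FDModule k D.H) : k :=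
  LinearMap.trace k (LinearMap.ker (X.ρ D.y ^ i))
    ((X.ρ (D.of h)).restrict (D.ρ_of_mem_ker X h i))

/-- A trace on a kernel becomes a trace on the whole space through any projection onto it. This form
is easy to transport along isomorphisms, direct sums and tensor products. -/
theorem kerTrace_eq (h : G) (i : ℕ) (X : FDModule k D.H) (π : Module.End k X.V)
    (h1 : ∀ v, (X.ρ D.y ^ i) (π v) = 0) (h2 : ∀ v, (X.ρ D.y ^ i) v = 0 → π v = v) :
    D.kerTrace h i X = LinearMap.trace k X.V (X.ρ (D.of h) * π) := by
  rw [← LinearMap.trace_restrict_eq_of_forall_mem (LinearMap.ker (X.ρ D.y ^ i))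
    (X.ρ (D.of h) * π) (fun v => D.ρ_of_mem_ker X h i _ (h1 v)), kerTrace]
  congr 1
  refine LinearMap.ext fun v => Subtype.ext ?_
  change X.ρ (D.of h) v = X.ρ (D.of h) (π v)
  rw [h2 v v.2]

theorem exists_projection_ker (i : ℕ) (X : FDModule k D.H) : ∃ π : Module.End k X.V,
    (∀ v, (X.ρ D.y ^ i) (π v) = 0) ∧ ∀ v, (X.ρ D.y ^ i) v = 0 → π v = v := by
  obtain ⟨π, hπ⟩ := LinearMap.exists_leftInverse_of_injective
    (LinearMap.ker (X.ρ D.y ^ i)).subtype (Submodule.ker_subtype _)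
  exact ⟨(LinearMap.ker (X.ρ D.y ^ i)).subtype ∘ₗ π, fun v => (π v).2,
    fun v hv => congrArg Subtype.val (LinearMap.congr_fun hπ ⟨v, hv⟩)⟩

theorem kerTrace_congr (h : G) (i : ℕ) {X Y : FDModule k D.H} (e : X.Iso Y) :
    D.kerTrace h i X = D.kerTrace h i Y := by
  obtain ⟨e, he⟩ := e
  obtain ⟨π, h1, h2⟩ := D.exists_projection_ker i X
  have he' : ∀ v, e ((X.ρ D.y ^ i) v) = (Y.ρ D.y ^ i) (e v) := fun v => by
    rw [← map_pow, ← map_pow, he]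
  rw [D.kerTrace_eq h i X π h1 h2, D.kerTrace_eq h i Y (e.conj π) (fun v => ?_) (fun v hv => ?_),
    ← LinearMap.trace_conj' _ e]
  · congr 1
    refine LinearMap.ext fun v => ?_
    rw [LinearEquiv.conj_apply_apply, Module.End.mul_apply, Module.End.mul_apply, he,
      LinearEquiv.conj_apply_apply]
  · rw [LinearEquiv.conj_apply_apply, ← he', h1, map_zero]
  · rw [LinearEquiv.conj_apply_apply, h2, LinearEquiv.apply_symm_apply]
    apply e.injective
    rw [he', LinearEquiv.apply_symm_apply, hv, map_zero]

theorem kerTrace_directSum (h : G) (i : ℕ) (X Y : FDModule k D.H) :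
    D.kerTrace h i (X.directSum Y) = D.kerTrace h i X + D.kerTrace h i Y := by
  obtain ⟨π, h1, h2⟩ := D.exists_projection_ker i X
  obtain ⟨π', h1', h2'⟩ := D.exists_projection_ker i Y
  have hy : ∀ v : X.V × Y.V, ((X.directSum Y).ρ D.y ^ i) v =
      ((X.ρ D.y ^ i) v.1, (Y.ρ D.y ^ i) v.2) := fun v => by
    rw [← map_pow, ← map_pow, ← map_pow]
    rfl
  rw [D.kerTrace_eq h i X π h1 h2, D.kerTrace_eq h i Y π' h1' h2',
    D.kerTrace_eq h i (X.directSum Y) (π.prodMap π')]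
  · exact LinearMap.trace_prodMap' (X.ρ (D.of h) * π) (Y.ρ (D.of h) * π')
  · intro v
    exact (hy _).trans (Prod.ext (h1 v.1) (h1' v.2))
  · intro v hv
    have hv' := (hy v).symm.trans hv
    exact Prod.ext (h2 v.1 (congrArg Prod.fst hv')) (h2' v.2 (congrArg Prod.snd hv'))

theorem kerTrace_of_isUnit (h : G) (i : ℕ) {N : FDModule k D.H} (hN : IsUnit (N.ρ D.y)) :
    D.kerTrace h i N = 0 := by
  rw [D.kerTrace_eq h i N 0 (fun v => map_zero _) (fun v hv => ?_), mul_zero, map_zero]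
  have h1 := ((Module.End.isUnit_iff _).1 (hN.pow i)).injective
  exact ((injective_iff_map_eq_zero _).1 h1 v hv).symm

/-- The projection of `k ^ j` onto the kernel of the `i`-th power of the shift. -/
def shiftProj (k : Type u) [Field k] (j i : ℕ) : Module.End k (Fin j → k) where
  toFun v l := if (l : ℕ) + i < j then 0 else v l
  map_add' v w := by ext l; by_cases h : (l : ℕ) + i < j <;> simp [h]
  map_smul' c v := by ext l; by_cases h : (l : ℕ) + i < j <;> simp [h]

/-- The inverse shift, cut off to the complement of the kernel of the `i`-th power of the shift. -/
def shiftBack (k : Type u) [Field k] (j i : ℕ) : Module.End k (Fin j → k) where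
  toFun v l := if h : (l : ℕ) + i < j then v ⟨l + i, h⟩ else 0
  map_add' v w := by ext l; by_cases h : (l : ℕ) + i < j <;> simp [h]
  map_smul' c v := by ext l; by_cases h : (l : ℕ) + i < j <;> simp [h]

theorem shift_pow_mul_shiftProj (j i : ℕ) : shift k j ^ i * shiftProj k j i = 0 := by
  refine LinearMap.ext fun v => funext fun l => ?_
  rw [Module.End.mul_apply, shift_pow_apply]
  split_ifs with h
  · rfl
  · exact if_pos (show (l : ℕ) - i + i < j by omega)

/-- It shows that the projection is the identity on the kernel of the i-th power. As an identity of
operators it survives tensoring with V. -/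
theorem shiftProj_add (j i : ℕ) : shiftProj k j i + shiftBack k j i * shift k j ^ i = 1 := by
  refine LinearMap.ext fun v => funext fun l => ?_
  change (if (l : ℕ) + i < j then 0 else v l) +
    (if h : (l : ℕ) + i < j then (shift k j ^ i) v ⟨l + i, h⟩ else 0) = v l
  by_cases h : (l : ℕ) + i < j
  · rw [if_pos h, dif_pos h, shift_pow_apply, dif_neg (by simp), zero_add]
    exact congrArg v (Fin.ext (by simp))
  · rw [if_neg h, dif_neg h, add_zero]

theorem trace_diagAct_mul_shiftProj (h : G) (j i : ℕ) :
    LinearMap.trace k (Fin j → k) (D.diagAct j h * shiftProj k j i) =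
      ∑ l ∈ Finset.range j, if j ≤ l + i then ((D.χ h : k)⁻¹) ^ l else 0 := by
  rw [LinearMap.trace_eq_matrix_trace k (Pi.basisFun k (Fin j)), Matrix.trace,
    Finset.sum_range fun l => if j ≤ l + i then ((D.χ h : k)⁻¹) ^ l else 0]
  refine Finset.sum_congr rfl fun l _ => ?_
  rw [Matrix.diag_apply, LinearMap.toMatrix_apply]
  by_cases hl : (l : ℕ) + i < j
  · simp [diagAct, shiftProj, hl]
  · simp [diagAct, shiftProj, not_lt.1 hl]

variable [Finite G]

theorem kerTrace_tensor_uniserial (h : G) (i : ℕ) {V : FDModule k D.H} (hV : D.IsInfl V) {j : ℕ}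
    (hj : j ≤ D.n) : D.kerTrace h i (V.tensor (D.uniserial j hj)) =
      D.traceOf h V * ∑ l ∈ Finset.range j, if j ≤ l + i then ((D.χ h : k)⁻¹) ^ l else 0 := by
  have hy : (V.tensor (D.uniserial j hj)).ρ D.y ^ i =
      (LinearMap.lTensor V.V (shift k j ^ i) : Module.End k (V.V ⊗[k] (Fin j → k))) := by
    have h1 : (V.tensor (D.uniserial j hj)).ρ D.y =
        (LinearMap.lTensor V.V (shift k j) : Module.End k (V.V ⊗[k] (Fin j → k))) := by
      rw [hV.tensor_ρ_y, uniserial_ρ_y]; rfl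
    rw [h1]
    exact LinearMap.lTensor_pow (shift k j) i
  rw [D.kerTrace_eq h i _ (LinearMap.lTensor V.V (shiftProj k j i)), D.tensor_ρ_of,
    uniserial_ρ_of, ← trace_diagAct_mul_shiftProj]
  · refine Eq.trans ?_ (LinearMap.trace_tensorProduct' (V.ρ (D.of h))
      (D.diagAct j h * shiftProj k j i))
    congr 1
    exact TensorProduct.ext' fun v w => rfl
  · intro (v : V.V ⊗[k] (Fin j → k))
    rw [hy]
    refine (LinearMap.lTensor_comp_apply V.V _ _ v).symm.trans ?_
    change LinearMap.lTensor V.V (shift k j ^ i * shiftProj k j i) v = 0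
    rw [shift_pow_mul_shiftProj, LinearMap.lTensor_zero, LinearMap.zero_apply]
  · intro (v : V.V ⊗[k] (Fin j → k)) hv
    rw [hy] at hv
    have h1 := congrArg (fun f => LinearMap.lTensor V.V f v) (shiftProj_add (k := k) j i)
    have h2 : LinearMap.lTensor V.V (shiftBack k j i * shift k j ^ i) v = 0 :=
      (LinearMap.lTensor_comp_apply V.V _ _ v).trans
        ((congrArg (LinearMap.lTensor V.V (shiftBack k j i)) hv).trans (map_zero _))
    simp only [LinearMap.lTensor_add, LinearMap.add_apply] at h1
    rw [h2, add_zero] at h1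
    exact h1.trans (LinearMap.congr_fun (LinearMap.lTensor_id V.V (Fin j → k)) v)

/-- The additive map on the Green ring induced by `kerTrace`. -/
noncomputable def kerTraceHom (h : G) (i : ℕ) : GreenRing k D.H →+ k :=
  greenAddLift (D.kerTrace h i) (fun _ _ e => D.kerTrace_congr h i e) (D.kerTrace_directSum h i)

theorem kerTraceHom_mul_uniserialClass (h : G) (i : ℕ) {V : FDModule k D.H} (hV : D.IsInfl V)
    {j : ℕ} (hj : j ≤ D.n) : D.kerTraceHom h i (greenClass V * D.uniserialClass j) =
      D.traceOf h V * ∑ l ∈ Finset.range j, if j ≤ l + i then ((D.χ h : k)⁻¹) ^ l else 0 := by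
  rw [D.uniserialClass_of_le hj, ← greenClass_tensor, ← D.kerTrace_tensor_uniserial h i hV hj]
  exact greenAddLift_greenClass _ _ (D.kerTrace_directSum h i) _

/-- The trace of `h ∈ G` on the multiplicity space of the Jordan blocks of size `j` of `y`. -/
noncomputable def blockTrace (h : G) (j : ℕ) : GreenRing k D.H →+ k :=
  D.kerTraceHom h j - D.kerTraceHom h (j - 1) -
    (AddMonoidHom.mulLeft (D.χ h : k)⁻¹).comp (D.kerTraceHom h (j + 1) - D.kerTraceHom h j)

/-- The layer ker y^i / ker y^(i-1) of V ⊗ M(j, 0) has trace tr_V(h) χ(h)^(-(j-i)) for i ≤ j and is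
zero otherwise. Twisting the next layer by χ⁻¹ gives the same value when i < j, so the difference
survives only for i = j. -/
theorem blockTrace_mul_uniserialClass (h : G) {i : ℕ} (hi : 1 ≤ i) {V : FDModule k D.H}
    (hV : D.IsInfl V) {j : ℕ} (hj : j ≤ D.n) :
    D.blockTrace h i (greenClass V * D.uniserialClass j) =
      if i = j then D.traceOf h V else 0 := by
  obtain ⟨i, rfl⟩ : ∃ i', i = i' + 1 := ⟨i - 1, by omega⟩
  rw [blockTrace, Nat.add_sub_cancel, AddMonoidHom.sub_apply, AddMonoidHom.comp_apply,
    AddMonoidHom.sub_apply, AddMonoidHom.sub_apply, AddMonoidHom.coe_mulLeft,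
    D.kerTraceHom_mul_uniserialClass h _ hV hj, D.kerTraceHom_mul_uniserialClass h _ hV hj,
    D.kerTraceHom_mul_uniserialClass h _ hV hj, ← mul_sub, ← mul_sub, sum_truncated_succ_sub,
    sum_truncated_succ_sub]
  rcases lt_trichotomy (i + 1) j with hij | hij | hij
  · rw [if_pos (by omega), if_pos hij, if_neg (by omega),
      show j - 1 - i = j - 1 - (i + 1) + 1 by omega, pow_succ]
    ring
  · subst hij
    rw [if_pos (by omega), if_neg (by omega), if_pos rfl, show i + 1 - 1 - i = 0 by omega]
    ring
  · rw [if_neg (by omega), if_neg (by omega), if_neg (by omega)]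
    ring

theorem blockTrace_of_isUnit (h : G) (i : ℕ) {N : FDModule k D.H} (hN : IsUnit (N.ρ D.y)) :
    D.blockTrace h i (greenClass N) = 0 := by
  have h1 : ∀ i, D.kerTraceHom h i (greenClass N) = 0 := fun i =>
    (greenAddLift_greenClass _ _ (D.kerTrace_directSum h i) N).trans (D.kerTrace_of_isUnit h i hN)
  rw [blockTrace, AddMonoidHom.sub_apply, AddMonoidHom.comp_apply, AddMonoidHom.sub_apply,
    AddMonoidHom.sub_apply, h1, h1, h1]
  simp

/-- The combination of the traces on multiplicity spaces in which a Jordan block of size `j` has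
the weight `quantumSum u v j`. -/
noncomputable def blockMap (h : G) (u v : k) : GreenRing k D.H →+ k :=
  ∑ j ∈ Finset.Icc 1 D.n, (AddMonoidHom.mulLeft (quantumSum u v j)).comp (D.blockTrace h j)

theorem blockMap_apply (h : G) (u v : k) (x : GreenRing k D.H) :
    D.blockMap h u v x = ∑ j ∈ Finset.Icc 1 D.n, quantumSum u v j * D.blockTrace h j x := by
  rw [blockMap, AddMonoidHom.finsetSum_apply]
  rfl

theorem blockMap_mul_uniserialClass (h : G) (u v : k) {V : FDModule k D.H} (hV : D.IsInfl V)
    {j : ℕ} (hj : j ≤ D.n) : D.blockMap h u v (greenClass V * D.uniserialClass j) =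
      D.traceOf h V * quantumSum u v j := by
  rw [blockMap_apply]
  rcases Nat.eq_zero_or_pos j with rfl | hj0
  · rw [D.uniserialClass_zero, quantumSum_zero]
    simp
  · rw [Finset.sum_eq_single j]
    · rw [D.blockTrace_mul_uniserialClass h hj0 hV hj, if_pos rfl, mul_comm]
    · intro i hi hij
      rw [D.blockTrace_mul_uniserialClass h (Finset.mem_Icc.1 hi).1 hV hj, if_neg hij, mul_zero]
    · intro h; exact absurd (Finset.mem_Icc.2 ⟨hj0, hj⟩) h

theorem blockMap_of_mem_unitClasses (h : G) (u v : k) {x : GreenRing k D.H}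
    (hx : x ∈ D.unitClasses) : D.blockMap h u v x = 0 := by
  induction hx using AddSubgroup.closure_induction with
  | mem x hx =>
    obtain ⟨N, hN, rfl⟩ := hx
    rw [blockMap_apply]
    exact Finset.sum_eq_zero fun j _ => by rw [D.blockTrace_of_isUnit h j hN, mul_zero]
  | zero => exact map_zero _
  | add x y _ _ hx hy => rw [map_add, hx, hy, add_zero]
  | neg x _ hx => rw [map_neg, hx, neg_zero]

variable {D} in
theorem IsInfl.greenClass_mul_comm {V : FDModule k D.H} (hV : D.IsInfl V) (j : ℕ) :
    greenClass V * D.uniserialClass j = D.uniserialClass j * greenClass V := by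
  by_cases hj : j ≤ D.n
  · rcases Nat.eq_zero_or_pos j with rfl | hj0
    · rw [D.uniserialClass_zero, mul_zero, zero_mul]
    · rw [D.uniserialClass_of_le hj, ← greenClass_tensor, ← greenClass_tensor]
      exact greenClass_congr (hV.tensor_uniserial_comm hj hj0)
  · rw [uniserialClass, dif_neg hj, mul_zero, zero_mul]

theorem blockMap_uniserialClass (h : G) (u v : k) {j : ℕ} (hj : j ≤ D.n) :
    D.blockMap h u v (D.uniserialClass j) = quantumSum u v j := by
  rw [← one_mul (D.uniserialClass j), ← greenClass_trivial,
    D.blockMap_mul_uniserialClass h u v D.isInfl_trivial hj, traceOf_trivial, one_mul]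

variable [CharZero k]

theorem blockMap_greenClass_mul (hμ : D.μ ≠ 0) (h : G) (u v : k) {V : FDModule k D.H}
    (hV : D.IsInfl V) (x : GreenRing k D.H) :
    D.blockMap h u v (greenClass V * x) = D.traceOf h V * D.blockMap h u v x := by
  have hx := D.closure_generators hμ x
  induction hx using AddSubgroup.closure_induction with
  | mem x hx =>
    rcases hx with ⟨W, j, hW, hj1, hj, rfl⟩ | ⟨N, hN, rfl⟩
    · rw [← mul_assoc, ← greenClass_tensor, D.blockMap_mul_uniserialClass h u v (hV.tensor hW) hj,
        D.blockMap_mul_uniserialClass h u v hW hj, D.traceOf_tensor, mul_assoc]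
    · have hN' : greenClass N ∈ D.unitClasses := AddSubgroup.subset_closure ⟨N, hN, rfl⟩
      rw [D.blockMap_of_mem_unitClasses h u v hN', D.blockMap_of_mem_unitClasses h u v
        (D.mul_mem_unitClasses hμ hV.ρ_y_pow_n hN'), mul_zero]
  | zero => rw [mul_zero, map_zero, mul_zero]
  | add x y _ _ hx hy => rw [mul_add, map_add, map_add, hx, hy, mul_add]
  | neg x _ hx => rw [mul_neg, map_neg, map_neg, hx, mul_neg]

/-- For j < n the rule for M(2, 0) M(j, 0) matches the recursion of the sums in u and v, because a
has value uv. For j = n both sides vanish, since u^n = v^n. -/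
theorem blockMap_two_mul (hμ : D.μ ≠ 0) (hn : 2 ≤ D.n) (h : G) {u v : k}
    (huv : u * v = (D.χ h : k)⁻¹) (hne : u ≠ v) (hun : u ^ D.n = v ^ D.n) (x : GreenRing k D.H) :
    D.blockMap h u v (D.uniserialClass 2 * x) = quantumSum u v 2 * D.blockMap h u v x := by
  have hx := D.closure_generators hμ x
  have ha := D.isInfl_charModule D.χ⁻¹ D.inv_χ_g_pow_n
  have hta : D.traceOf h (D.charModule D.χ⁻¹ D.inv_χ_g_pow_n) = u * v := by
    rw [D.traceOf_charModule, huv]; simp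
  induction hx using AddSubgroup.closure_induction with
  | mem x hx =>
    rcases hx with ⟨W, j, hW, hj1, hj, rfl⟩ | ⟨N, hN, rfl⟩
    · rw [← mul_assoc, ← hW.greenClass_mul_comm, mul_assoc]
      rcases hj.lt_or_eq with hj' | rfl
      · rw [D.uniserialClass_two_mul hn hj1 hj', mul_add, map_add, charClass,
          D.blockMap_greenClass_mul hμ h u v hW (_ * _), D.blockMap_mul_uniserialClass h u v hW hj',
          D.blockMap_mul_uniserialClass h u v ha (by omega), hta,
          D.blockMap_mul_uniserialClass h u v hW hj]
        linear_combination (-D.traceOf h W) * quantumSum_two_mul hne hj1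
      · rw [D.uniserialClass_two_mul_n hn, mul_add, map_add, charClass,
          D.blockMap_greenClass_mul hμ h u v hW (_ * _), D.blockMap_mul_uniserialClass h u v hW le_rfl,
          D.blockMap_mul_uniserialClass h u v ha le_rfl, quantumSum_eq_zero hne hun]
        simp
    · have hN' : greenClass N ∈ D.unitClasses := AddSubgroup.subset_closure ⟨N, hN, rfl⟩
      rw [D.blockMap_of_mem_unitClasses h u v hN', D.blockMap_of_mem_unitClasses h u v
        (D.uniserialClass_mul_mem_unitClasses hμ hn hN'), mul_zero]
  | zero => rw [mul_zero, map_zero, mul_zero]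
  | add x y _ _ hx hy => rw [mul_add, map_add, map_add, hx, hy, mul_add]
  | neg x _ hx => rw [mul_neg, map_neg, map_neg, hx, mul_neg]

theorem blockMap_uniserialClass_mul (hμ : D.μ ≠ 0) (hn : 2 ≤ D.n) (h : G) {u v : k}
    (huv : u * v = (D.χ h : k)⁻¹) (hne : u ≠ v) (hun : u ^ D.n = v ^ D.n) (x : GreenRing k D.H)
    {j : ℕ} (hj : j ≤ D.n) :
    D.blockMap h u v (D.uniserialClass j * x) = quantumSum u v j * D.blockMap h u v x := by
  induction j using Nat.strong_induction_on with
  | h j ih =>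
    match j with
    | 0 => rw [D.uniserialClass_zero, quantumSum_zero, zero_mul, zero_mul, map_zero]
    | 1 => rw [D.uniserialClass_one (by omega), quantumSum_one, one_mul, one_mul]
    | j + 2 =>
      have h1 : D.uniserialClass (j + 2) = D.uniserialClass 2 * D.uniserialClass (j + 1) -
          D.charClass * D.uniserialClass j := by
        rw [D.uniserialClass_two_mul hn (by omega) (by omega)]
        simp
      have h2 := quantumSum_two_mul hne (show 1 ≤ j + 1 by omega)
      rw [Nat.add_sub_cancel] at h2
      rw [h1, sub_mul, map_sub, mul_assoc, mul_assoc, D.blockMap_two_mul hμ hn h huv hne hun,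
        ih (j + 1) (by omega) (by omega), charClass, D.blockMap_greenClass_mul hμ h u v
        (D.isInfl_charModule _ _), ih j (by omega) (by omega), traceOf_charModule, ← mul_assoc, h2,
        huv]
      simp
      ring

variable [IsAlgClosed k]

/-- `blockMap` is multiplicative. -/
theorem blockMap_mul (hμ : D.μ ≠ 0) (hn : 2 ≤ D.n) (h : G) {u v : k}
    (huv : u * v = (D.χ h : k)⁻¹) (hne : u ≠ v) (hun : u ^ D.n = v ^ D.n) (x y : GreenRing k D.H) :
    D.blockMap h u v (x * y) = D.blockMap h u v x * D.blockMap h u v y := by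
  have hx := D.closure_generators hμ x
  induction hx using AddSubgroup.closure_induction with
  | mem x hx =>
    rcases hx with ⟨W, j, hW, hj1, hj, rfl⟩ | ⟨N, hN, rfl⟩
    · rw [mul_assoc, D.blockMap_greenClass_mul hμ h u v hW,
        D.blockMap_uniserialClass_mul hμ hn h huv hne hun y hj,
        D.blockMap_mul_uniserialClass h u v hW hj, mul_assoc]
    · have hN' : greenClass N ∈ D.unitClasses := AddSubgroup.subset_closure ⟨N, hN, rfl⟩
      rw [D.blockMap_of_mem_unitClasses h u v hN', zero_mul]
      -- With `y` an arbitrary ring element, it is not known that [N] `y` lies in the span of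
      -- modules with bijective action. But n [N] `y` = M(n) [N] `y`, and M(n) has value zero
      -- because u^n = v^n; dividing by n gives the claim.
      have h1 := D.blockMap_uniserialClass_mul hμ hn h huv hne hun (greenClass N * y) le_rfl
      rw [← mul_assoc, D.uniserialClass_mul_of_mem_unitClasses hμ hN', smul_mul_assoc, map_nsmul,
        quantumSum_eq_zero hne hun, zero_mul, smul_eq_zero] at h1
      exact h1.resolve_left D.n_pos.ne'
  | zero => rw [zero_mul, map_zero, zero_mul]
  | add x y _ _ hx hy => rw [add_mul, map_add, map_add, hx, hy, add_mul]
  | neg x _ hx => rw [neg_mul, map_neg, map_neg, hx, neg_mul]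

theorem isIntegral_blockMap (hμ : D.μ ≠ 0) (h : G) {u v : k} (hu : IsIntegral ℤ u)
    (hv : IsIntegral ℤ v) (x : GreenRing k D.H) : IsIntegral ℤ (D.blockMap h u v x) := by
  have hx := D.closure_generators hμ x
  induction hx using AddSubgroup.closure_induction with
  | mem x hx =>
    rcases hx with ⟨W, j, hW, hj1, hj, rfl⟩ | ⟨N, hN, rfl⟩
    · rw [D.blockMap_mul_uniserialClass h u v hW hj, ← traceHom_greenClass]
      exact (D.isIntegral_traceHom h _).mul (isIntegral_quantumSum hu hv j)
    · rw [D.blockMap_of_mem_unitClasses h u v (AddSubgroup.subset_closure ⟨N, hN, rfl⟩)]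
      exact isIntegral_zero
  | zero => rw [map_zero]; exact isIntegral_zero
  | add x y _ _ hx hy => rw [map_add]; exact hx.add hy
  | neg x _ hx => rw [map_neg]; exact hx.neg

theorem blockMap_eq_zero_of_mem_jacobson (hμ : D.μ ≠ 0) (hn : 2 ≤ D.n) (h : G) {u v : k}
    (huv : u * v = (D.χ h : k)⁻¹) (hne : u ≠ v) (hun : u ^ D.n = v ^ D.n)
    (hu : IsIntegral ℤ u) (hv : IsIntegral ℤ v) {x : GreenRing k D.H}
    (hx : x ∈ Ring.jacobson (GreenRing k D.H)) : D.blockMap h u v x = 0 := by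
  let φ : GreenRing k D.H →+* k :=
    { D.blockMap h u v with
      map_one' := by
        change D.blockMap h u v 1 = 1
        rw [← D.uniserialClass_one (by omega), D.blockMap_uniserialClass h u v (by omega),
          quantumSum_one]
      map_mul' := D.blockMap_mul hμ hn h huv hne hun }
  exact φ.map_eq_zero_of_mem_jacobson (D.isIntegral_blockMap hμ h hu hv) hx

end GroupDatum

/-! ### Determination of the radical. -/

/-- On 2n-th roots of unity w^(-j) = w^(2n-j), so the sum is the value of a polynomial of degree
below 2n. It vanishes at all of them, the points w = ±1 being automatic, and hence is zero; the
exponents j and 2n - j with 1 ≤ j < n are all distinct. The term j = n is identically zero there, so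
nothing is learned about b_n. -/
theorem eq_zero_of_sum_pow_sub_inv_pow {k : Type*} [Field k] [IsAlgClosed k] [CharZero k] {n : ℕ}
    (hn : 0 < n) (b : ℕ → k) (hb : ∀ w : k, w ^ (2 * n) = 1 → w ^ 2 ≠ 1 →
      ∑ j ∈ Finset.Icc 1 n, b j * (w ^ j - w⁻¹ ^ j) = 0) {j : ℕ} (hj : 1 ≤ j) (hjn : j < n) :
    b j = 0 := by
  let F : Polynomial k := ∑ j ∈ Finset.Ico 1 n,
    (Polynomial.monomial j (b j) - Polynomial.monomial (2 * n - j) (b j))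
  have hev : ∀ w : k, w ^ (2 * n) = 1 → F.eval w = 0 := by
    intro w hw
    have hw0 : w ≠ 0 := by
      rintro rfl
      rw [zero_pow (by omega)] at hw
      exact zero_ne_one hw
    have hinv : ∀ j ≤ 2 * n, w ^ (2 * n - j) = w⁻¹ ^ j := fun j hj => by
      rw [inv_pow]
      exact eq_inv_of_mul_eq_one_left (by rw [← pow_add, Nat.sub_add_cancel hj, hw])
    have h1 : F.eval w = ∑ j ∈ Finset.Ico 1 n, b j * (w ^ j - w⁻¹ ^ j) := by
      rw [Polynomial.eval_finsetSum]
      refine Finset.sum_congr rfl fun j hj => ?_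
      rw [Polynomial.eval_sub, Polynomial.eval_monomial, Polynomial.eval_monomial, hinv j (by
        have := Finset.mem_Ico.1 hj; omega), mul_sub]
    rw [h1]
    by_cases hw2 : w ^ 2 = 1
    · have : w⁻¹ = w := inv_eq_of_mul_eq_one_left (by rw [← sq, hw2])
      simp [this]
    · have h2 := hb w hw hw2
      rw [← Finset.Ico_insert_right (by omega : 1 ≤ n), Finset.sum_insert (by simp),
        ← hinv n (by omega), show 2 * n - n = n by omega, sub_self, mul_zero, zero_add] at h2
      exact h2
  have hdvd := Polynomial.X_pow_sub_one_dvd_of_eval (by omega : 0 < 2 * n) F hev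
  have hdeg : F.degree < (2 * n : ℕ) := by
    rw [← Polynomial.mem_degreeLT]
    refine sum_mem fun j hj => sub_mem ?_ ?_ <;> rw [Polynomial.mem_degreeLT] <;>
    refine (Polynomial.degree_monomial_le _ _).trans_lt (Nat.cast_lt.2 ?_) <;>
    have := Finset.mem_Ico.1 hj <;> omega
  have hF : F = 0 := by
    refine Polynomial.eq_zero_of_dvd_of_degree_lt hdvd (hdeg.trans_eq ?_)
    rw [← Polynomial.C_1, Polynomial.degree_X_pow_sub_C (by omega)]
  have hc := congrArg (fun P => Polynomial.coeff P j) hF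
  simp only [F, Polynomial.finsetSum_coeff, Polynomial.coeff_sub, Polynomial.coeff_monomial,
    Polynomial.coeff_zero] at hc
  rw [Finset.sum_eq_single j] at hc
  · rwa [if_pos rfl, if_neg (by omega), sub_zero] at hc
  · intro i hi hij
    have := Finset.mem_Ico.1 hi
    rw [if_neg hij, if_neg (by omega), sub_zero]
  · intro h; exact absurd (Finset.mem_Ico.2 ⟨hj, hjn⟩) h

/-- For every y the element yz has square zero, so 1 - yz is an inverse of 1 + yz. -/
theorem Ideal.span_singleton_le_jacobson_of_isNilpotent_center {R : Type*} [Ring R] {z : R}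
    (hz : ∀ x, x * z = z * x) (hzz : z * z = 0) : Ideal.span {z} ≤ Ring.jacobson R := by
  rw [Ideal.span_singleton_le_iff_mem, ← Ideal.jacobson_bot, Ideal.mem_jacobson_iff]
  intro y
  refine ⟨1 - y * z, ?_⟩
  have h1 : (y * z) * (y * z) = 0 := by
    rw [mul_assoc, ← mul_assoc z, ← hz, mul_assoc y z, hzz, mul_zero, mul_zero]
  rw [Ideal.mem_bot, mul_assoc, sub_mul, h1, one_mul]
  abel

namespace GroupDatum

variable {k : Type u} {G : Type v} [Field k] [Group G] (D : GroupDatum k G)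

theorem IsNonNilpotent.μ_ne_zero {D : GroupDatum k G} (hD : D.IsNonNilpotent) : D.μ ≠ 0 :=
  fun h => hD.1 (by rw [h, zero_smul])

theorem IsNonNilpotent.χ_pow {D : GroupDatum k G} (hD : D.IsNonNilpotent) (h : G) :
    D.χ h ^ D.n = 1 := by
  rw [← MonoidHom.pow_apply, hD.2, MonoidHom.one_apply]

variable [Finite G]

theorem mul_mem_inflClasses {x y : GreenRing k D.H} (hx : x ∈ D.inflClasses)
    (hy : y ∈ D.inflClasses) : x * y ∈ D.inflClasses := by
  induction hx using AddSubgroup.closure_induction with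
  | mem x hx =>
    obtain ⟨V, hV, rfl⟩ := hx
    induction hy using AddSubgroup.closure_induction with
    | mem y hy =>
      obtain ⟨W, hW, rfl⟩ := hy
      rw [← greenClass_tensor]
      exact AddSubgroup.subset_closure ⟨_, hV.tensor hW, rfl⟩
    | zero => rw [mul_zero]; exact zero_mem _
    | add x y _ _ hx hy => rw [mul_add]; exact add_mem hx hy
    | neg x _ hx => rw [mul_neg]; exact neg_mem hx
  | zero => rw [zero_mul]; exact zero_mem _
  | add x y _ _ hx hy => rw [add_mul]; exact add_mem hx hy
  | neg x _ hx => rw [neg_mul]; exact neg_mem hx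

theorem one_mem_inflClasses : (1 : GreenRing k D.H) ∈ D.inflClasses := by
  rw [← greenClass_trivial]
  exact AddSubgroup.subset_closure ⟨_, D.isInfl_trivial, rfl⟩

theorem charClass_mem_inflClasses : D.charClass ∈ D.inflClasses :=
  AddSubgroup.subset_closure ⟨_, D.isInfl_charModule _ _, rfl⟩

theorem charClass_pow_mem_inflClasses (m : ℕ) : D.charClass ^ m ∈ D.inflClasses := by
  induction m with
  | zero => rw [pow_zero]; exact D.one_mem_inflClasses
  | succ m ih => rw [pow_succ]; exact D.mul_mem_inflClasses ih D.charClass_mem_inflClasses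

theorem traceHom_mul_g_pow {x : GreenRing k D.H}
    (hx : x ∈ AddSubgroup.closure {x | ∃ W : FDModule k D.H,
      (D.IsInfl W ∧ W.ρ (D.of D.g) = 1) ∧ x = greenClass W}) (h : G) (m : ℕ) :
    D.traceHom (h * D.g ^ m) x = D.traceHom h x := by
  induction hx using AddSubgroup.closure_induction with
  | mem x hx =>
    obtain ⟨W, ⟨-, hW⟩, rfl⟩ := hx
    rw [traceHom_greenClass, traceHom_greenClass, traceOf, map_mul, map_mul, map_pow D.of,
      map_pow W.ρ, hW, one_pow, mul_one, traceOf]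
  | zero => rw [map_zero, map_zero]
  | add x y _ _ hx hy => rw [map_add, map_add, hx, hy]
  | neg x _ hx => rw [map_neg, map_neg, hx]

theorem traceHom_mul_g_pow_n_pow (hμ : D.μ ≠ 0) {x : GreenRing k D.H} (hx : x ∈ D.inflClasses)
    (h : G) (m : ℕ) : D.traceHom (h * (D.g ^ D.n) ^ m) x = D.traceHom h x := by
  induction hx using AddSubgroup.closure_induction with
  | mem x hx =>
    obtain ⟨W, hW, rfl⟩ := hx
    rw [traceHom_greenClass, traceHom_greenClass, traceOf, map_mul, map_mul, map_pow D.of _ m,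
      map_pow W.ρ, D.ρ_g_pow_n_of_nilpotent hμ W hW.ρ_y_pow_n, one_pow, mul_one, traceOf]
  | zero => rw [map_zero, map_zero]
  | add x y _ _ hx hy => rw [map_add, map_add, hx, hy]
  | neg x _ hx => rw [map_neg, map_neg, hx]

theorem blockTrace_mul_of_mem_inflClasses (h : G) {i : ℕ} (hi : 1 ≤ i) {x : GreenRing k D.H}
    (hx : x ∈ D.inflClasses) {j : ℕ} (hj : j ≤ D.n) :
    D.blockTrace h i (x * D.uniserialClass j) = if i = j then D.traceHom h x else 0 := by
  induction hx using AddSubgroup.closure_induction with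
  | mem x hx =>
    obtain ⟨W, hW, rfl⟩ := hx
    rw [D.blockTrace_mul_uniserialClass h hi hW hj, traceHom_greenClass]
  | zero => simp
  | add x y _ _ hx hy => rw [add_mul, map_add, map_add, hx, hy]; split_ifs <;> simp
  | neg x _ hx => rw [neg_mul, map_neg, map_neg, hx]; split_ifs <;> simp

theorem blockTrace_of_mem_unitClasses (h : G) (i : ℕ) {x : GreenRing k D.H}
    (hx : x ∈ D.unitClasses) : D.blockTrace h i x = 0 := by
  induction hx using AddSubgroup.closure_induction with
  | mem x hx =>
    obtain ⟨N, hN, rfl⟩ := hx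
    exact D.blockTrace_of_isUnit h i hN
  | zero => exact map_zero _
  | add x y _ _ hx hy => rw [map_add, hx, hy, add_zero]
  | neg x _ hx => rw [map_neg, hx, neg_zero]

/-- Twists by powers of the inverse of `χ` of a module on which `g` acts by a scalar. -/
theorem exists_twist {Y : FDModule k D.H} (hY : D.IsInfl Y) {c : k}
    (hc : ∀ v, Y.ρ (D.of D.g) v = c • v) (i : ℕ) :
    ∃ W : FDModule k D.H, D.IsInfl W ∧ greenClass W = D.charClass ^ i * greenClass Y ∧
      ∀ v, W.ρ (D.of D.g) v = ((D.χ D.g : k)⁻¹ ^ i * c) • v := by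
  induction i with
  | zero => exact ⟨Y, hY, by rw [pow_zero, one_mul], fun v => by rw [pow_zero, one_mul, hc]⟩
  | succ i ih =>
    obtain ⟨W, hW, hW', hWg⟩ := ih
    refine ⟨(D.charModule D.χ⁻¹ D.inv_χ_g_pow_n).tensor W, (D.isInfl_charModule _ _).tensor hW,
      by rw [greenClass_tensor, hW', pow_succ', mul_assoc, charClass], ?_⟩
    intro (v : k ⊗[k] W.V)
    rw [D.tensor_ρ_of]
    have h1 : (TensorProduct.map ((D.charModule D.χ⁻¹ D.inv_χ_g_pow_n).ρ (D.of D.g))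
        (W.ρ (D.of D.g)) : k ⊗[k] W.V →ₗ[k] k ⊗[k] W.V) =
        ((D.χ D.g : k)⁻¹ ^ (i + 1) * c) • LinearMap.id := by
      refine TensorProduct.ext' fun x w => ?_
      refine (TensorProduct.map_tmul _ _ _ _).trans ?_
      refine (congrArg₂ (fun (a : k) b => a ⊗ₜ[k] b) (D.charModule_ρ_of _ _ _ x) (hWg w)).trans ?_
      rw [← smul_eq_mul, TensorProduct.smul_tmul_smul, LinearMap.smul_apply,
        LinearMap.id_apply, pow_succ', mul_assoc]
      simp
    exact LinearMap.congr_fun h1 v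

theorem uniserialClass_add_two (hn : 2 ≤ D.n) {j : ℕ} (hj : j + 2 ≤ D.n) :
    D.uniserialClass (j + 2) = D.uniserialClass 2 * D.uniserialClass (j + 1) -
      D.charClass * D.uniserialClass j := by
  rw [D.uniserialClass_two_mul hn (by omega) (by omega)]
  simp

variable [CharZero k]

/-- Here the condition χ^n = 1 of non-nilpotent type enters; it is what makes the generator of the
radical nilpotent. -/
theorem charClass_pow_n (hD : D.IsNonNilpotent) : D.charClass ^ D.n = 1 := by
  rw [← sub_eq_zero]
  refine D.eq_zero_of_mem_inflClasses
    (sub_mem (D.charClass_pow_mem_inflClasses _) D.one_mem_inflClasses) fun h => ?_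
  rw [map_sub, map_pow, map_one, D.traceHom_charClass, inv_pow, ← Units.val_pow_eq_pow_val,
    hD.χ_pow, Units.val_one, inv_one, sub_self]

variable [IsAlgClosed k]

/-- Classes of modules with y = 0 commute by comparison of characters and commute with M(j, 0) by an
explicit isomorphism. On modules with y bijective, a acts as the identity from either side. -/
theorem charClass_mul_comm (hμ : D.μ ≠ 0) (x : GreenRing k D.H) :
    D.charClass * x = x * D.charClass := by
  have hx := D.closure_generators hμ x
  induction hx using AddSubgroup.closure_induction with
  | mem x hx =>
    rcases hx with ⟨W, j, hW, hj1, hj, rfl⟩ | ⟨N, hN, rfl⟩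
    · have h1 : D.charClass * greenClass W = greenClass W * D.charClass := by
        have hW' : greenClass W ∈ D.inflClasses := AddSubgroup.subset_closure ⟨W, hW, rfl⟩
        rw [← sub_eq_zero]
        refine D.eq_zero_of_mem_inflClasses
          (sub_mem (D.mul_mem_inflClasses D.charClass_mem_inflClasses hW')
            (D.mul_mem_inflClasses hW' D.charClass_mem_inflClasses)) fun h => ?_
        rw [map_sub, map_mul, map_mul, mul_comm, sub_self]
      have h2 : D.charClass * D.uniserialClass j = D.uniserialClass j * D.charClass :=
        (D.isInfl_charModule _ _).greenClass_mul_comm j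
      rw [← mul_assoc, h1, mul_assoc, h2, mul_assoc]
    · have hN' : greenClass N ∈ D.unitClasses := AddSubgroup.subset_closure ⟨N, hN, rfl⟩
      rw [D.charClass_mul_of_mem_unitClasses hμ hN', D.mul_charClass_of_mem_unitClasses hμ hN']
  | zero => rw [mul_zero, zero_mul]
  | add x y _ _ hx hy => rw [mul_add, add_mul, hx, hy]
  | neg x _ hx => rw [mul_neg, neg_mul, hx]

/-- By the recursion, M(j, 0) is an integral polynomial in M(2, 0) and the central class a. -/
theorem commute_uniserialClass (hμ : D.μ ≠ 0) (hn : 2 ≤ D.n) {x : GreenRing k D.H}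
    (hx : Commute (D.uniserialClass 2) x) {j : ℕ} (hj : j ≤ D.n) :
    Commute (D.uniserialClass j) x := by
  induction j using Nat.strong_induction_on with
  | h j ih =>
    match j with
    | 0 => rw [D.uniserialClass_zero]; exact Commute.zero_left x
    | 1 => rw [D.uniserialClass_one (by omega)]; exact Commute.one_left x
    | j + 2 =>
      rw [D.uniserialClass_add_two hn hj]
      exact (hx.mul_left (ih (j + 1) (by omega) (by omega))).sub_left
        (Commute.mul_left (D.charClass_mul_comm hμ x) (ih j (by omega) (by omega)))

theorem commute_uniserialClass_n (hμ : D.μ ≠ 0) (hn : 2 ≤ D.n) {j : ℕ} (hj : j ≤ D.n) :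
    Commute (D.uniserialClass j) (D.uniserialClass D.n) :=
  D.commute_uniserialClass hμ hn
    (D.commute_uniserialClass hμ hn (Commute.refl _) le_rfl).symm hj

/-- M(2, 0) multiplies M(n, 0) by 1 + a, so the factors satisfy f(j + 2) = (1 + a) f(j + 1) - a
f(j), with solution 1 + a + ⋯ + a^(j-1). -/
theorem uniserialClass_mul_uniserialClass_n (hμ : D.μ ≠ 0) (hn : 2 ≤ D.n) {j : ℕ}
    (hj : j ≤ D.n) : D.uniserialClass j * D.uniserialClass D.n =
      (∑ i ∈ Finset.range j, D.charClass ^ i) * D.uniserialClass D.n := by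
  induction j using Nat.strong_induction_on with
  | h j ih =>
    match j with
    | 0 => rw [D.uniserialClass_zero]; simp
    | 1 => rw [D.uniserialClass_one (by omega)]; simp
    | j + 2 =>
      have ha : ∀ m x, x * D.charClass ^ m = D.charClass ^ m * x := fun m x =>
        (Commute.pow_left (D.charClass_mul_comm hμ x : Commute _ _) m).eq.symm
      have hs : ∀ m x, x * ∑ i ∈ Finset.range m, D.charClass ^ i =
          (∑ i ∈ Finset.range m, D.charClass ^ i) * x := fun m x => by
        rw [Finset.mul_sum, Finset.sum_mul]
        exact Finset.sum_congr rfl fun i _ => ha i x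
      rw [D.uniserialClass_add_two hn hj, sub_mul, mul_assoc, mul_assoc,
        ih (j + 1) (by omega) (by omega), ih j (by omega) (by omega), ← mul_assoc, hs, mul_assoc,
        D.uniserialClass_two_mul_n hn, ← mul_assoc, hs, Finset.sum_range_succ _ (j + 1),
        Finset.sum_range_succ _ j, pow_succ]
      noncomm_ring

/-- The generator of the Jacobson radical is central. -/
theorem mul_one_sub_charClass_mul_uniserialClass (hμ : D.μ ≠ 0) (hn : 2 ≤ D.n)
    (x : GreenRing k D.H) : x * ((1 - D.charClass) * D.uniserialClass D.n) =
      (1 - D.charClass) * D.uniserialClass D.n * x := by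
  have ha : ∀ x, x * (1 - D.charClass) = (1 - D.charClass) * x := fun x => by
    rw [mul_sub, sub_mul, D.charClass_mul_comm hμ, mul_one, one_mul]
  have hx := D.closure_generators hμ x
  induction hx using AddSubgroup.closure_induction with
  | mem x hx =>
    rcases hx with ⟨W, j, hW, hj1, hj, rfl⟩ | ⟨N, hN, rfl⟩
    · rw [← mul_assoc, ha, mul_assoc, mul_assoc, mul_assoc,
        (D.commute_uniserialClass_n hμ hn hj).eq, ← mul_assoc (greenClass W),
        hW.greenClass_mul_comm, mul_assoc]
    -- Both products are zero, since 1 - a kills [N] and M(n) multiplies it by n.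
    · have hN' : greenClass N ∈ D.unitClasses := AddSubgroup.subset_closure ⟨N, hN, rfl⟩
      rw [← mul_assoc, mul_sub, D.mul_charClass_of_mem_unitClasses hμ hN', mul_one, sub_self,
        zero_mul, mul_assoc, D.uniserialClass_mul_of_mem_unitClasses hμ hN', mul_smul_comm, sub_mul,
        one_mul, D.charClass_mul_of_mem_unitClasses hμ hN', sub_self, smul_zero]
  | zero => rw [mul_zero, zero_mul]
  | add x y _ _ hx hy => rw [mul_add, add_mul, hx, hy]
  | neg x _ hx => rw [mul_neg, neg_mul, hx]

/-- M(n)^2 = (1 + a + ⋯ + a^(n-1)) M(n), and one factor 1 - a turns the geometric sum into 1 - a^n =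
0. -/
theorem one_sub_charClass_mul_uniserialClass_sq (hD : D.IsNonNilpotent) (hn : 2 ≤ D.n) :
    (1 - D.charClass) * D.uniserialClass D.n * ((1 - D.charClass) * D.uniserialClass D.n) = 0 := by
  have h1 : D.uniserialClass D.n * (1 - D.charClass) =
      (1 - D.charClass) * D.uniserialClass D.n := by
    rw [mul_sub, sub_mul, D.charClass_mul_comm hD.μ_ne_zero, mul_one, one_mul]
  rw [mul_assoc, ← mul_assoc (D.uniserialClass D.n), h1, mul_assoc (1 - D.charClass),
    D.uniserialClass_mul_uniserialClass_n hD.μ_ne_zero hn le_rfl,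
    ← mul_assoc _ _ (D.uniserialClass D.n), mul_neg_geom_sum, D.charClass_pow_n hD, sub_self,
    zero_mul, mul_zero]

/-- As g^n = 1 on V, each eigenvalue of g is a power q^m. Twisting the eigenspace Y by a^m makes g
act trivially, and [Y] - a^m [Y] is a multiple of 1 - a. Eigenspaces are split off one at a time. -/
theorem exists_eq_add_mul_one_sub_charClass_of_isInfl (hμ : D.μ ≠ 0) {V : FDModule k D.H}
    (hV : D.IsInfl V) : ∃ w ∈ AddSubgroup.closure {x | ∃ W : FDModule k D.H,
      (D.IsInfl W ∧ W.ρ (D.of D.g) = 1) ∧ x = greenClass W},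
      ∃ r, greenClass V = w + r * (1 - D.charClass) := by
  induction hd : Module.finrank k V.V using Nat.strong_induction_on generalizing V with
  | h d ih =>
    rcases subsingleton_or_nontrivial V.V with hX | hX
    · exact ⟨0, zero_mem _, 0, by rw [greenClass_eq_zero_of_subsingleton]; simp⟩
    obtain ⟨c, hc⟩ := Module.End.exists_eigenvalue (V.ρ (D.of D.g))
    obtain ⟨e, he⟩ := hc.exists_hasEigenvector
    obtain ⟨Y, Z, i, j, hiso, hi, hj, hii, hji, hri, -⟩ := D.exists_eigenspace_decomposition V
      D.g D.commute_g (fun v => by rw [hV]; simp) c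
    have hYi : D.IsInfl Y := LinearMap.ext fun v => hii (by rw [hi, hV]; simp)
    have hZi : D.IsInfl Z := LinearMap.ext fun v => hji (by rw [hj, hV]; simp)
    have hYc : ∀ v, Y.ρ (D.of D.g) v = c • v := fun v => hii (by
      have hv : i v ∈ LinearMap.range i := ⟨v, rfl⟩
      rw [hri, LinearMap.mem_ker, LinearMap.sub_apply, sub_eq_zero,
        Module.algebraMap_end_apply] at hv
      rw [hi, hv, map_smul])
    obtain ⟨y, hy⟩ : e ∈ LinearMap.range i := by
      rw [hri, LinearMap.mem_ker, LinearMap.sub_apply, sub_eq_zero, Module.algebraMap_end_apply]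
      exact he.apply_eq_smul
    have hy0 : y ≠ 0 := by
      rintro rfl
      exact he.2 (hy.symm.trans (map_zero i))
    have hdim : Module.finrank k V.V = Module.finrank k Y.V + Module.finrank k Z.V := by
      obtain ⟨e, -⟩ := hiso
      rw [← e.finrank_eq]
      exact Module.finrank_prod
    have hYpos : 0 < Module.finrank k Y.V := by
      have : Nontrivial Y.V := ⟨y, 0, hy0⟩
      exact Module.finrank_pos
    have hcn : c ^ D.n = 1 := by
      have h1 : ∀ m, (Y.ρ (D.of D.g) ^ m) y = c ^ m • y := by
        intro m
        induction m with
        | zero => simp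
        | succ m ih => rw [pow_succ', Module.End.mul_apply, ih, map_smul, hYc, smul_smul, pow_succ]
      have h2 := h1 D.n
      rw [← map_pow, ← map_pow, D.ρ_g_pow_n_of_nilpotent hμ Y hYi.ρ_y_pow_n,
        Module.End.one_apply] at h2
      by_contra h3
      have h4 : (c ^ D.n - 1) • y = 0 := by rw [sub_smul, ← h2, one_smul, sub_self]
      exact hy0 ((smul_eq_zero.1 h4).resolve_left (sub_ne_zero.2 h3))
    have : NeZero D.n := ⟨D.n_pos.ne'⟩
    obtain ⟨m, -, hm⟩ := D.isPrimitiveRoot.eq_pow_of_pow_eq_one hcn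
    obtain ⟨W, hW, hW', hWg⟩ := D.exists_twist hYi hYc m
    obtain ⟨w, hw, r, hr⟩ := ih _ (by omega) hZi rfl
    refine ⟨greenClass W + w, add_mem (AddSubgroup.subset_closure ⟨W, ⟨hW, ?_⟩, rfl⟩) hw,
      (∑ i ∈ Finset.range m, D.charClass ^ i) * greenClass Y + r, ?_⟩
    · refine LinearMap.ext fun v => ?_
      rw [hWg, ← hm, inv_pow, inv_mul_cancel₀ (pow_ne_zero _ (Units.ne_zero _)), one_smul]
      rfl
    · have h1 : greenClass Y * (1 - D.charClass) = (1 - D.charClass) * greenClass Y := by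
        rw [mul_sub, sub_mul, D.charClass_mul_comm hμ, mul_one, one_mul]
      rw [← greenClass_congr hiso, greenClass_directSum, hr, hW', add_mul, mul_assoc, h1,
        ← mul_assoc, geom_sum_mul_neg, sub_mul, one_mul]
      abel

theorem exists_eq_add_mul_one_sub_charClass (hμ : D.μ ≠ 0) {x : GreenRing k D.H}
    (hx : x ∈ D.inflClasses) : ∃ w ∈ AddSubgroup.closure {x | ∃ W : FDModule k D.H,
      (D.IsInfl W ∧ W.ρ (D.of D.g) = 1) ∧ x = greenClass W},
      ∃ r, x = w + r * (1 - D.charClass) := by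
  induction hx using AddSubgroup.closure_induction with
  | mem x hx =>
    obtain ⟨V, hV, rfl⟩ := hx
    exact D.exists_eq_add_mul_one_sub_charClass_of_isInfl hμ hV
  | zero => exact ⟨0, zero_mem _, 0, by simp⟩
  | add x y _ _ hx hy =>
    obtain ⟨w, hw, r, rfl⟩ := hx
    obtain ⟨w', hw', r', rfl⟩ := hy
    exact ⟨w + w', add_mem hw hw', r + r', by rw [add_mul]; abel⟩
  | neg x _ hx =>
    obtain ⟨w, hw, r, rfl⟩ := hx
    exact ⟨-w, neg_mem hw, -r, by rw [neg_mul]; abel⟩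

/-- An element on which the traces of the kernel of `χ` vanish is a multiple of `1 - a`. -/
theorem exists_eq_mul_one_sub_charClass (hD : D.IsNonNilpotent) {x : GreenRing k D.H}
    (hx : x ∈ D.inflClasses) (h : ∀ h, D.χ h = 1 → D.traceHom h x = 0) :
    ∃ r, x = r * (1 - D.charClass) := by
  obtain ⟨w, hw, r, rfl⟩ := D.exists_eq_add_mul_one_sub_charClass hD.μ_ne_zero hx
  refine ⟨r, ?_⟩
  rw [D.eq_zero_of_mem_inflClasses (x := w), zero_add]
  · refine AddSubgroup.closure_mono ?_ hw
    rintro _ ⟨W, ⟨hW, -⟩, rfl⟩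
    exact ⟨W, hW, rfl⟩
  · have h1 : ∀ x, D.χ x = 1 → D.traceHom x w = 0 := by
      intro x hx
      have := h x hx
      rwa [map_add, map_mul, map_sub, map_one, D.traceHom_charClass, hx, Units.val_one, inv_one,
        sub_self, mul_zero, add_zero] at this
    -- Since χ(x) is a power q^m, the element x g^(n-m) lies in ker χ. The traces of w do not notice
    -- the factor g^(n-m), so they vanish on all of G.
    intro x
    have : NeZero D.n := ⟨D.n_pos.ne'⟩
    obtain ⟨m, hm, hm'⟩ := D.isPrimitiveRoot.eq_pow_of_pow_eq_one (ξ := (D.χ x : k))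
      (by rw [← Units.val_pow_eq_pow_val, hD.χ_pow, Units.val_one])
    rw [← D.traceHom_mul_g_pow hw x (D.n - m)]
    apply h1
    apply Units.ext
    rw [map_mul, map_pow, Units.val_mul, ← hm', Units.val_pow_eq_pow_val, ← pow_add,
      Nat.add_sub_cancel' hm.le, D.isPrimitiveRoot.pow_eq_one, Units.val_one]

/-- With β² = χ(h)⁻¹ and w a 2n-th root of unity, w² ≠ 1, the pair u = βw, v = βw⁻¹ is admissible
and integral. Clearing u - v gives ∑ β^j (w^j - w^(-j)) t_j = 0, where t_j is the trace on the
blocks of size j; letting w vary isolates each t_j with j < n. -/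
theorem blockTrace_eq_zero_of_mem_jacobson (hμ : D.μ ≠ 0) (hn : 2 ≤ D.n) (h : G) {j : ℕ}
    (hj : 1 ≤ j) (hjn : j < D.n) {x : GreenRing k D.H}
    (hx : x ∈ Ring.jacobson (GreenRing k D.H)) : D.blockTrace h j x = 0 := by
  obtain ⟨β, hβ⟩ := IsAlgClosed.exists_pow_nat_eq ((D.χ h : k)⁻¹) (show 0 < 2 by omega)
  have hβ0 : β ≠ 0 := by
    rintro rfl
    rw [zero_pow (by omega)] at hβ
    exact inv_ne_zero (Units.ne_zero _) hβ.symm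
  have hβi : IsIntegral ℤ β := by
    refine IsIntegral.of_pow (n := 2 * Nat.card G) (by have := Nat.card_pos (α := G); omega) ?_
    rw [pow_mul, hβ, inv_pow, ← Units.val_pow_eq_pow_val, ← map_pow, pow_card_eq_one', map_one,
      Units.val_one, inv_one]
    exact isIntegral_one
  have key := eq_zero_of_sum_pow_sub_inv_pow D.n_pos (fun j => β ^ j * D.blockTrace h j x) (by
    intro w hw hw2
    have hw0 : w ≠ 0 := by
      rintro rfl
      rw [zero_pow (by omega)] at hw
      exact zero_ne_one hw
    have hwi : ∀ w : k, w ^ (2 * D.n) = 1 → IsIntegral ℤ w := fun w hw =>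
      IsIntegral.of_pow (n := 2 * D.n) (by omega) (by rw [hw]; exact isIntegral_one)
    have h1 := D.blockMap_eq_zero_of_mem_jacobson hμ hn h (u := β * w) (v := β * w⁻¹)
      (by rw [← hβ]; field_simp)
      (fun h => hw2 (by
        have := mul_left_cancel₀ hβ0 h
        rw [sq]
        nth_rewrite 1 [this]
        exact inv_mul_cancel₀ hw0))
      (by
        rw [mul_pow, mul_pow, inv_pow]
        congr 1
        exact eq_inv_of_mul_eq_one_left (by rw [← pow_add, ← two_mul, hw]))
      (hβi.mul (hwi w hw)) (hβi.mul (hwi _ (by rw [inv_pow, hw, inv_one]))) hx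
    rw [blockMap_apply] at h1
    have h2 := congrArg (· * (β * w - β * w⁻¹)) h1
    simp only [Finset.sum_mul, zero_mul] at h2
    rw [← h2]
    refine Finset.sum_congr rfl fun i _ => ?_
    have h3 := quantumSum_mul_sub (β * w) (β * w⁻¹) i
    rw [mul_pow, mul_pow] at h3
    linear_combination (-(D.blockTrace h i x)) * h3) hj hjn
  exact (mul_eq_zero.1 key).resolve_left (pow_ne_zero _ hβ0)

theorem mem_span_of_mem_jacobson (hD : D.IsNonNilpotent) (hn : 2 ≤ D.n) {x : GreenRing k D.H}
    (hx : x ∈ Ring.jacobson (GreenRing k D.H)) :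
    x ∈ Ideal.span {(1 - D.charClass) * D.uniserialClass D.n} := by
  have hμ := hD.μ_ne_zero
  obtain ⟨v, hv, w, hw, hxv⟩ := D.exists_decomposition hμ x
  have hv0 : ∀ j, 1 ≤ j → j < D.n → v j = 0 := by
    intro j hj hjn
    refine D.eq_zero_of_mem_inflClasses (hv j) fun h => ?_
    have h1 := D.blockTrace_eq_zero_of_mem_jacobson hμ hn h hj hjn hx
    rw [hxv, map_add, D.blockTrace_of_mem_unitClasses h j hw, add_zero, map_sum,
      Finset.sum_eq_single j, D.blockTrace_mul_of_mem_inflClasses h hj (hv j) hjn.le,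
      if_pos rfl] at h1
    · exact h1
    · intro i hi hij
      rw [D.blockTrace_mul_of_mem_inflClasses h hj (hv i) (Finset.mem_Icc.1 hi).2, if_neg hij.symm]
    · intro h; exact absurd (Finset.mem_Icc.2 ⟨hj, hjn.le⟩) h
  have hxn : x = v D.n * D.uniserialClass D.n + w := by
    rw [hxv, Finset.sum_eq_single D.n]
    · intro i hi hin
      have := Finset.mem_Icc.1 hi
      rw [hv0 i this.1 (lt_of_le_of_ne this.2 hin), zero_mul]
    · intro h; exact absurd (Finset.mem_Icc.2 ⟨by omega, le_rfl⟩) h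
  have htr : ∀ h, D.traceHom h x = 0 := fun h =>
    (D.traceHom h).map_eq_zero_of_mem_jacobson (D.isIntegral_traceHom h) hx
  have hχ : ∀ h m, D.χ (h * (D.g ^ D.n) ^ m) = D.χ h := fun h m => by
    have : D.χ D.g ^ D.n = 1 := pow_orderOf_eq_one _
    rw [map_mul, map_pow, map_pow, this, one_pow, mul_one]
  -- Averaging over the powers of g^n kills the contribution of w and leaves that of v_n M(n)
  -- unchanged, because g^n acts trivially on the modules involved in v_n and χ(g^n) = 1.
  have hvn : ∀ h, D.traceHom h (v D.n * D.uniserialClass D.n) = 0 := by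
    intro h
    have h1 : ∑ m ∈ Finset.range (Nat.card G), D.traceHom (h * (D.g ^ D.n) ^ m) x = 0 :=
      Finset.sum_eq_zero fun m _ => htr _
    have h2 : ∀ m, D.traceHom (h * (D.g ^ D.n) ^ m) (v D.n * D.uniserialClass D.n) =
        D.traceHom h (v D.n * D.uniserialClass D.n) := fun m => by
      rw [map_mul, map_mul, D.traceHom_mul_g_pow_n_pow hμ (hv _), D.traceHom_uniserialClass _ le_rfl,
        D.traceHom_uniserialClass _ le_rfl, hχ]
    rw [hxn] at h1
    simp only [map_add, h2, Finset.sum_add_distrib, D.sum_traceHom_of_mem_unitClasses hμ hw h,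
      add_zero, Finset.sum_const, Finset.card_range, smul_eq_zero] at h1
    exact h1.resolve_left Nat.card_pos.ne'
  have hw0 : w = 0 := D.eq_zero_of_mem_unitClasses hw fun h => by
    have := htr h
    rwa [hxn, map_add, hvn, zero_add] at this
  -- On ker χ the trace of M(n, 0) is n ≠ 0 and can be cancelled. Off ker χ it is zero, which is why
  -- v_n is determined only up to multiples of 1 - a.
  obtain ⟨r, hr⟩ := D.exists_eq_mul_one_sub_charClass hD (hv D.n) fun h hh => by
    have := hvn h
    rw [map_mul, D.traceHom_uniserialClass h le_rfl, hh, Units.val_one, inv_one] at this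
    simpa [D.n_pos.ne'] using this
  rw [Ideal.mem_span_singleton']
  exact ⟨r, by rw [hxn, hw0, add_zero, hr, mul_assoc]⟩

end GroupDatum

theorem mainTheorem7 {k : Type u} {G : Type v} [Field k] [IsAlgClosed k] [CharZero k]
    [Group G] [Finite G] (D : GroupDatum k G) (hD : D.IsNonNilpotent) (hn : 2 ≤ D.n) :
    Ring.jacobson (GreenRing k D.H) =
      Ideal.span {(1 - greenClass (D.charModule D.χ⁻¹ D.inv_χ_g_pow_n)) *
        greenClass (D.uniserial D.n le_rfl)} := by
  have h : (1 - greenClass (D.charModule D.χ⁻¹ D.inv_χ_g_pow_n)) *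
      greenClass (D.uniserial D.n le_rfl) = (1 - D.charClass) * D.uniserialClass D.n := by
    rw [D.uniserialClass_of_le le_rfl, GroupDatum.charClass]
  rw [h]
  exact le_antisymm (fun x hx => D.mem_span_of_mem_jacobson hD hn hx)
    (Ideal.span_singleton_le_jacobson_of_isNilpotent_center
      (D.mul_one_sub_charClass_mul_uniserialClass hD.μ_ne_zero hn)
      (D.one_sub_charClass_mul_uniserialClass_sq hD hn))
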